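/- Let $N\geq 1$. All algebras are unital $C^*$-algebras over $\mathbb C$, and noncommutative spaces are described by their algebras together with standard coordinates; an inclusion $X\subset Y$ means a morphism $C(Y)\to C(X)$ mapping standard coordinates to standard coordinates, and $X=Y$ means an isomorphism with this property. *Partitions.* $P(k,l)$ is the set of partitions between an upper row of $k$ points and a lower row of $l$ points. A pair of multi-indices $(i,j)$, $i\in\{1,\ldots,N\}^k$, $j\in\{1,\ldots,N\}^l$ *fits* $\pi\in P(k,l)$ if the blocks of $\pi$ join equal indices. A category of partitions is a family $D(k,l)\subset P(k,l)$ containing the one-block partitions $|\in P(1,1)$ and $\cap\in P(0,2)$ and stable under horizontal concatenation, vertical concatenation and upside-down turning. $P_{even}^{[\infty]}$ is the category of partitions generated by $\eta=\ker\binom{aab}{baa}\in P(3,3)$ (one block formed by the first two upper points and the last two lower points, the other one by the last upper point and the first lower point). $P_{vert}$ is the set of partitions each of whose blocks has as many upper as lower legs. *Spheres.* The free sphere is $C(S^{N-1}_{\mathbb R,+})=C^*(x_1,\ldots,x_N\,|\,x_i=x_i^*,\ \sum_ix_i^2=1)$. The monomial sphere associated to a set $E$ of partitions is the subspace of it given by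 the relations $x_{i_1}\cdots x_{i_k}=x_{j_1}\cdots x_{j_l}$ for all $\pi\in E\cap P_{vert}$ and all $(i,j)$ fitting $\pi$. The monomial sphere coming from a group $\Gamma=\langle g_1,\ldots,g_N\rangle$ is the one associated to the set of the partitions $\pi$ such that $g_{i_1}\cdots g_{i_k}=g_{j_1}\cdots g_{j_l}$ for all $(i,j)$ fitting $\pi$. Further, $S^{N-1}_{\mathbb R}$ is the usual sphere, $S^{N-1}_{\mathbb R,*}\subset S^{N-1}_{\mathbb R,+}$ is given by the relations $x_ix_jx_k=x_kx_jx_i$, and $S^{N-1}_{\mathbb R,\infty}$ is the monomial sphere associated to $P_{even}^{[\infty]}$. The group $\mathbb Z_2^{\circ N}$ is the quotient of the free product $\mathbb Z_2^{*N}$ by the relations $abc=cba$ between the standard generators. *Quantum groups.* A quantum group $G\subset O_N^+$ is a $C^*$-algebra $C(G)$ generated by the entries of a matrix $u=(u_{ij})_{i,j\le N}$ with $u_{ij}=u_{ij}^*$, $uu^t=u^tu=1$, such that there are morphisms $\Delta:C(G)\to C(G)\otimes C(G)$, $\varepsilon:C(G)\to\mathbb C$, $S:C(G)\to C(G)^{opp}$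 with $\Delta(u_{ij})=\sum_ku_{ik}\otimes u_{kj}$, $\varepsilon(u_{ij})=\delta_{ij}$, $S(u_{ij})=u_{ji}$; here $\otimes$ is the maximal tensor product. It acts affinely on $X$ if there is a morphism $\Phi:C(X)\to C(G)\otimes C(X)$ with $\Phi(x_i)=\sum_ju_{ij}\otimes x_j$. For $X$ with linearly independent coordinates, $G^+(X)$ denotes the biggest quantum group $G\subset O_N^+$ acting affinely on $X$. $O_N$ is the usual orthogonal group, $O_N^*\subset O_N^+$ is given by the relations $abc=cba$ for $a,b,c\in\{u_{ij}\}$, and $H_N^{[\infty]}\subset O_N^+$ is the easy quantum group associated to $P_{even}^{[\infty]}$, given by the relations $T_\pi u^{\otimes k}=u^{\otimes l}T_\pi$ for all $\pi\in P_{even}^{[\infty]}(k,l)$, where $T_\pi(e_{i_1}\otimes\cdots\otimes e_{i_k})=\sum_{j:(i,j)\text{ fits }\pi}e_{j_1}\otimes\cdots\otimes e_{j_l}$. **Proposition 5.2.** The monomial spheres coming from $\mathbb Z_2^N$, $\mathbb Z_2^{\circ N}$, $\mathbb Z_2^{*N}$ are respectively $S^{N-1}_{\mathbb R}\subset S^{N-1}_{\mathbb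 R,*}\subset S^{N-1}_{\mathbb R,\infty}$. The following quantum isometry groups exist (in particular, the coordinates of these spheres are linearly independent) and are given by $$G^+(S^{N-1}_{\mathbb R})=O_N,\qquad G^+(S^{N-1}_{\mathbb R,*})=O_N^*,\qquad G^+(S^{N-1}_{\mathbb R,\infty})=H_N^{[\infty]}\ \text{ if } N\neq 2 .$$ Moreover $O_N\subset O_N^*$, while $O_N^*\not\subset H_N^{[\infty]}$ for $N\geq 2$, and $H_N^{[\infty]}\not\subset O_N^*$ for $N\geq 3$. -/

import Mathlib

open scoped TensorProduct

noncomputable section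

/-! ### C⋆-seminorms and enveloping C⋆-algebras -/

/-- A C⋆-seminorm on a unital complex ⋆-algebra. -/
structure CStarSeminorm (A : Type*) [Ring A] [StarRing A] [Algebra ℂ A] where
  toSeminorm : Seminorm ℂ A
  mul_le' : ∀ a b : A, toSeminorm (a * b) ≤ toSeminorm a * toSeminorm b
  cstar' : ∀ a : A, toSeminorm (star a * a) = toSeminorm a * toSeminorm a

namespace CStarSeminorm

section sup

variable {A : Type*} [Ring A] [StarRing A] [Algebra ℂ A]

/-- The pointwise supremum of a pointwise bounded set of C⋆-seminorms. -/
def supOf (P : Set (CStarSeminorm A))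
    (hP : ∀ a : A, ∃ M : ℝ, ∀ p ∈ P, p.toSeminorm a ≤ M) : CStarSeminorm A :=
  have hb : ∀ a : A, BddAbove (Set.range fun p : P => p.1.toSeminorm a) := fun a => by
    obtain ⟨M, hM⟩ := hP a
    exact ⟨M, by rintro _ ⟨p, rfl⟩; exact hM p.1 p.2⟩
  have h0 : ∀ a : A, 0 ≤ ⨆ p : P, p.1.toSeminorm a := fun a =>
    Real.iSup_nonneg fun p => apply_nonneg _ _
  { toSeminorm :=
      { toFun := fun a => ⨆ p : P, p.1.toSeminorm a
        map_zero' := by simp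
        add_le' := fun a b => Real.iSup_le (fun p => (map_add_le_add p.1.toSeminorm a b).trans
          (add_le_add (le_ciSup (hb a) p) (le_ciSup (hb b) p))) (add_nonneg (h0 a) (h0 b))
        neg' := fun a => by simp [map_neg_eq_map]
        smul' := fun r a => by
          simp only [map_smul_eq_mul]
          rw [Real.mul_iSup_of_nonneg (norm_nonneg r)] }
    mul_le' := fun a b => Real.iSup_le (fun p => (p.1.mul_le' a b).trans
      (mul_le_mul (le_ciSup (hb a) p) (le_ciSup (hb b) p) (apply_nonneg _ _) (h0 a)))
      (mul_nonneg (h0 a) (h0 b))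
    cstar' := fun a => by
      change (⨆ p : P, p.1.toSeminorm (star a * a)) =
        (⨆ p : P, p.1.toSeminorm a) * ⨆ p : P, p.1.toSeminorm a
      apply le_antisymm
      · refine Real.iSup_le (fun p => ?_) (mul_nonneg (h0 a) (h0 a))
        rw [p.1.cstar' a]
        exact mul_le_mul (le_ciSup (hb a) p) (le_ciSup (hb a) p) (apply_nonneg _ _) (h0 a)
      · rw [← pow_two, ← Real.le_sqrt (h0 a) (h0 _)]
        refine Real.iSup_le (fun p => ?_) (Real.sqrt_nonneg _)
        refine Real.le_sqrt_of_sq_le ?_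
        rw [pow_two, ← p.1.cstar' a]
        exact le_ciSup (hb (star a * a)) p }

theorem map_one_le (p : CStarSeminorm A) : p.toSeminorm 1 ≤ 1 := by
  have h : p.toSeminorm (star 1 * 1) = p.toSeminorm 1 * p.toSeminorm 1 := p.cstar' 1
  rw [star_one, one_mul] at h
  nlinarith [sq_nonneg (p.toSeminorm 1 - 1)]

theorem map_star_le (p : CStarSeminorm A) (a : A) : p.toSeminorm (star a) ≤ p.toSeminorm a := by
  have key : ∀ a : A, p.toSeminorm a ≤ p.toSeminorm (star a) := fun a => by
    have h1 : p.toSeminorm (star a * a) = p.toSeminorm a * p.toSeminorm a := p.cstar' a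
    have h2 : p.toSeminorm (star a * a) ≤ p.toSeminorm (star a) * p.toSeminorm a := p.mul_le' _ _
    by_contra hlt
    push Not at hlt
    have h3 : 0 ≤ p.toSeminorm (star a) := apply_nonneg _ _
    nlinarith
  simpa using key (star a)

end sup

variable {A : Type*} [Ring A] [StarRing A] [Algebra ℂ A]

/-- The algebra `A`, equipped with the topology of the C⋆-seminorm `p`. -/
def Carrier (_p : CStarSeminorm A) : Type _ := A

variable (p : CStarSeminorm A)

instance : Ring p.Carrier := inferInstanceAs (Ring A)
instance : StarRing p.Carrier := inferInstanceAs (StarRing A)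
instance : Algebra ℂ p.Carrier := inferInstanceAs (Algebra ℂ A)
instance [StarModule ℂ A] : StarModule ℂ p.Carrier := inferInstanceAs (StarModule ℂ A)

/-- The identity map from `A` to its copy that carries the seminorm `p`. -/
def toCarrier : A ≃⋆ₐ[ℂ] p.Carrier := StarAlgEquiv.refl ℂ A

/-- The seminorm `p`, on the copy of `A` that carries it. -/
def carrierSeminorm : Seminorm ℂ p.Carrier := p.toSeminorm

instance : SeminormedRing p.Carrier :=
  { p.carrierSeminorm.toAddGroupSeminorm.toSeminormedAddCommGroup,
    (inferInstance : Ring p.Carrier) with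
    norm_mul_le := fun a b => p.mul_le' a b }

theorem norm_toCarrier (a : A) : ‖p.toCarrier a‖ = p.toSeminorm a := rfl

instance : NormedAlgebra ℂ p.Carrier where
  norm_smul_le r a := (map_smul_eq_mul p.carrierSeminorm r a).le

theorem norm_star_carrier (a : p.Carrier) : ‖star a‖ = ‖a‖ :=
  le_antisymm (p.map_star_le a)
    ((congrArg p.carrierSeminorm (star_star a).symm).le.trans (p.map_star_le (star a)))

theorem norm_star_mul_self_carrier (a : p.Carrier) : ‖star a * a‖ = ‖a‖ * ‖a‖ := p.cstar' a

namespace Completion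

open UniformSpace (Completion)

/-- The involution of `A`, as a norm preserving additive map. -/
def starHom : NormedAddGroupHom p.Carrier p.Carrier where
  toFun := star
  map_add' := star_add
  bound' := ⟨1, fun a => by rw [one_mul, norm_star_carrier]⟩

instance : Star (Completion p.Carrier) := ⟨fun a => (starHom p).completion a⟩

theorem star_coe (a : p.Carrier) :
    star (a : Completion p.Carrier) = ((star a : p.Carrier) : Completion p.Carrier) :=
  (starHom p).completion_coe a

instance : ContinuousStar (Completion p.Carrier) := ⟨(starHom p).completion.continuous⟩

instance : StarRing (Completion p.Carrier) where
  star_involutive a := by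
    induction a using Completion.induction_on with
    | hp => exact isClosed_eq (by fun_prop) (by fun_prop)
    | ih a => rw [star_coe, star_coe, star_star]
  star_mul a b := by
    induction a, b using Completion.induction_on₂ with
    | hp => exact isClosed_eq (by fun_prop) (by fun_prop)
    | ih a b => rw [← Completion.coe_mul, star_coe, star_coe, star_coe, star_mul,
        Completion.coe_mul]
  star_add a b := map_add (starHom p).completion a b

instance : NormedAlgebra ℂ (Completion p.Carrier) where
  norm_smul_le := norm_smul_le

instance : CStarRing (Completion p.Carrier) where
  norm_mul_self_le a := by
    induction a using Completion.induction_on with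
    | hp => exact isClosed_le (by fun_prop) (by fun_prop)
    | ih a => rw [star_coe, ← Completion.coe_mul, Completion.norm_coe, Completion.norm_coe,
        norm_star_mul_self_carrier]

instance [StarModule ℂ A] : StarModule ℂ (Completion p.Carrier) where
  star_smul r a := by
    have h1 : Continuous fun a : Completion p.Carrier => r • a :=
      UniformSpace.Completion.continuous_map
    have h2 : Continuous fun a : Completion p.Carrier => star r • a :=
      UniformSpace.Completion.continuous_map
    refine Completion.induction_on a
      (isClosed_eq (continuous_star.comp h1) (h2.comp continuous_star)) fun a => ?_
    have e1 : r • (a : Completion p.Carrier) = ((r • a : p.Carrier) : Completion p.Carrier) :=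
      (Completion.coe_smul r a).symm
    have e2 : star r • ((star a : p.Carrier) : Completion p.Carrier) =
        ((star r • star a : p.Carrier) : Completion p.Carrier) :=
      (Completion.coe_smul (star r) (star a)).symm
    rw [e1, star_coe, star_coe, e2, star_smul]

instance [StarModule ℂ A] : CStarAlgebra (Completion p.Carrier) where

end Completion

/-- The C⋆-algebra obtained from `(A, p)` by separation and completion. -/
def Envelope : Type _ := UniformSpace.Completion p.Carrier

instance [StarModule ℂ A] : CStarAlgebra p.Envelope :=
  inferInstanceAs (CStarAlgebra (UniformSpace.Completion p.Carrier))

/-- The canonical ⋆-homomorphism, with dense range, from `A` to its completion. -/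
def toEnvelope [StarModule ℂ A] : A →⋆ₐ[ℂ] p.Envelope where
  toFun a := ((p.toCarrier a : p.Carrier) : UniformSpace.Completion p.Carrier)
  map_one' := rfl
  map_mul' a b := UniformSpace.Completion.coe_mul (p.toCarrier a) (p.toCarrier b)
  map_zero' := rfl
  map_add' a b := UniformSpace.Completion.coe_add (p.toCarrier a) (p.toCarrier b)
  commutes' _ := rfl
  map_star' a := (Completion.star_coe p (p.toCarrier a)).symm

end CStarSeminorm

/-! ### Universal C⋆-algebras on self-adjoint generators -/

/-- The ⋆-algebra `ℂ⟨X_i⟩` of noncommutative polynomials in variables `X_i = X_i⋆`: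
the algebra of the free monoid, with the conjugate linear involution that reverses words. -/
def NCPoly (ι : Type*) : Type _ := MonoidAlgebra ℂ (FreeMonoid ι)

namespace NCPoly

variable {ι : Type*}

instance : Ring (NCPoly ι) := inferInstanceAs (Ring (MonoidAlgebra ℂ (FreeMonoid ι)))
instance : Algebra ℂ (NCPoly ι) := inferInstanceAs (Algebra ℂ (MonoidAlgebra ℂ (FreeMonoid ι)))

/-- The monomial `c • X_{i₁} ⋯ X_{iₖ}`. -/
def monomial (w : FreeMonoid ι) (c : ℂ) : NCPoly ι := MonoidAlgebra.single w c

/-- The variable `X_i`. -/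
def X (i : ι) : NCPoly ι := monomial (FreeMonoid.of i) 1

theorem monomial_add (w : FreeMonoid ι) (c d : ℂ) :
    monomial w (c + d) = monomial w c + monomial w d := MonoidAlgebra.single_add ..

theorem monomial_mul (v w : FreeMonoid ι) (c d : ℂ) :
    monomial v c * monomial w d = monomial (v * w) (c * d) := MonoidAlgebra.single_mul_single ..

theorem one_def : (1 : NCPoly ι) = monomial 1 1 := rfl

theorem smul_monomial (r : ℂ) (w : FreeMonoid ι) (c : ℂ) :
    r • monomial w c = monomial w (r * c) := MonoidAlgebra.smul_single ..

theorem induction {P : NCPoly ι → Prop} (f : NCPoly ι) (h0 : P 0)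
    (hm : ∀ w c, P (monomial w c)) (ha : ∀ f g, P f → P g → P (f + g)) : P f :=
  MonoidAlgebra.induction_linear f h0 ha hm

/-- The involution, as an additive map. -/
def starHom : NCPoly ι →+ NCPoly ι :=
  (Finsupp.liftAddHom fun w : FreeMonoid ι =>
      { toFun := fun c => monomial (star w) (star c)
        map_zero' := by rw [star_zero]; exact MonoidAlgebra.single_zero _
        map_add' := fun c d => by rw [star_add, monomial_add] }).comp
    (MonoidAlgebra.coeffAddEquiv : MonoidAlgebra ℂ (FreeMonoid ι) ≃+ _).toAddMonoidHom

theorem starHom_monomial (w : FreeMonoid ι) (c : ℂ) :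
    starHom (monomial w c) = monomial (star w) (star c) :=
  Finsupp.liftAddHom_apply_single _ w c

instance : StarRing (NCPoly ι) where
  star := starHom
  star_involutive f := by
    induction f using induction with
    | h0 => simp
    | hm w c => simp [starHom_monomial]
    | ha f g hf hg => rw [map_add, map_add, hf, hg]
  star_mul f g := by
    change starHom (f * g) = starHom g * starHom f
    induction f using induction with
    | h0 => simp
    | hm w c =>
      induction g using induction with
      | h0 => simp
      | hm v d => simp only [monomial_mul, starHom_monomial, star_mul]
      | ha f g hf hg => rw [mul_add, map_add, map_add, add_mul, hf, hg]
    | ha f g' hf hg => rw [add_mul, map_add, map_add, mul_add, hf, hg]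
  star_add f g := map_add starHom f g

theorem star_monomial (w : FreeMonoid ι) (c : ℂ) :
    star (monomial w c) = monomial (star w) (star c) := starHom_monomial w c

instance : StarModule ℂ (NCPoly ι) where
  star_smul r f := by
    induction f using induction with
    | h0 => simp
    | hm w c => simp only [smul_monomial, star_monomial, star_mul']
    | ha f g hf hg => rw [smul_add, star_add, star_add, smul_add, hf, hg]

end NCPoly

/-- The C⋆-seminorms on `ℂ⟨X_i⟩` which vanish on the set `R` of relations, and for which all the
variables are contractions. -/
def admissibleSeminorms {ι : Type*} (R : Set (NCPoly ι)) : Set (CStarSeminorm (NCPoly ι)) :=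
  {p | (∀ i, p.toSeminorm (NCPoly.X i) ≤ 1) ∧ ∀ f ∈ R, p.toSeminorm f = 0}

theorem admissibleSeminorms_bdd {ι : Type*} (R : Set (NCPoly ι)) (f : NCPoly ι) :
    ∃ M : ℝ, ∀ p ∈ admissibleSeminorms R, p.toSeminorm f ≤ M := by
  induction f using NCPoly.induction with
  | h0 => exact ⟨0, fun p _ => (map_zero p.toSeminorm).le⟩
  | hm w c =>
    refine ⟨‖c‖, fun p hp => ?_⟩
    have key : p.toSeminorm (NCPoly.monomial w 1) ≤ 1 := by
      induction w using FreeMonoid.inductionOn' with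
      | one => exact p.map_one_le
      | of_mul i w ih =>
        have h := p.mul_le' (NCPoly.X i) (NCPoly.monomial w 1)
        rw [NCPoly.X, NCPoly.monomial_mul, one_mul] at h
        exact h.trans (mul_le_one₀ (hp.1 i) (apply_nonneg _ _) ih)
    have h := map_smul_eq_mul p.toSeminorm c (NCPoly.monomial w 1)
    rw [NCPoly.smul_monomial, mul_one] at h
    rw [h]
    exact mul_le_of_le_one_right (norm_nonneg c) key
  | ha f g hf hg =>
    obtain ⟨M, hM⟩ := hf
    obtain ⟨L, hL⟩ := hg
    exact ⟨M + L, fun p hp => (map_add_le_add p.toSeminorm f g).trans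
      (add_le_add (hM p hp) (hL p hp))⟩

/-- The universal C⋆-algebra generated by self-adjoint contractions `x_i` subject to the relations
`f(x) = 0`, `f ∈ R`: the completion of `ℂ⟨X_i⟩` with respect to the biggest C⋆-seminorm that
vanishes on `R`. (In all the cases below the relations in `R` imply `‖x_i‖ ≤ 1` in any C⋆-algebra,
so that the contraction requirement is no restriction.) -/
def UnivCStar {ι : Type*} (R : Set (NCPoly ι)) : Type _ :=
  (CStarSeminorm.supOf (admissibleSeminorms R) (admissibleSeminorms_bdd R)).Envelope

instance {ι : Type*} (R : Set (NCPoly ι)) : CStarAlgebra (UnivCStar R) :=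
  inferInstanceAs (CStarAlgebra (CStarSeminorm.Envelope _))

/-- The standard generators of the universal C⋆-algebra. -/
def UnivCStar.gen {ι : Type*} (R : Set (NCPoly ι)) (i : ι) : UnivCStar R :=
  (CStarSeminorm.supOf (admissibleSeminorms R) (admissibleSeminorms_bdd R)).toEnvelope (NCPoly.X i)

/-! ### Tensor products -/

section tensor

variable (A B : Type*) [CStarAlgebra A] [CStarAlgebra B]

/-- The C⋆-seminorms on the algebraic tensor product `A ⊗ B` of two C⋆-algebras, subject to
`p(a ⊗ b) ≤ ‖a‖ ‖b‖` (which is automatic for C⋆-seminorms). -/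
def tensorSeminorms : Set (CStarSeminorm (A ⊗[ℂ] B)) :=
  {p | ∀ (a : A) (b : B), p.toSeminorm (a ⊗ₜ b) ≤ ‖a‖ * ‖b‖}

theorem tensorSeminorms_bdd (t : A ⊗[ℂ] B) :
    ∃ M : ℝ, ∀ p ∈ tensorSeminorms A B, p.toSeminorm t ≤ M := by
  induction t using TensorProduct.induction_on with
  | zero => exact ⟨0, fun p _ => (map_zero p.toSeminorm).le⟩
  | tmul a b => exact ⟨‖a‖ * ‖b‖, fun p hp => hp a b⟩
  | add s t hs ht =>
    obtain ⟨M, hM⟩ := hs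
    obtain ⟨L, hL⟩ := ht
    exact ⟨M + L, fun p hp => (map_add_le_add p.toSeminorm s t).trans
      (add_le_add (hM p hp) (hL p hp))⟩

/-- The (maximal) C⋆-algebraic tensor product of two C⋆-algebras: the completion of the algebraic
tensor product with respect to its biggest C⋆-seminorm. -/
def CStarTensor : Type _ :=
  (CStarSeminorm.supOf (tensorSeminorms A B) (tensorSeminorms_bdd A B)).Envelope

instance : CStarAlgebra (CStarTensor A B) :=
  inferInstanceAs (CStarAlgebra (CStarSeminorm.Envelope _))

variable {A B} in
/-- The elementary tensor `a ⊗ b`. -/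
def CStarTensor.tmul (a : A) (b : B) : CStarTensor A B :=
  (CStarSeminorm.supOf (tensorSeminorms A B) (tensorSeminorms_bdd A B)).toEnvelope (a ⊗ₜ b)

end tensor

/-! ### Noncommutative spaces with coordinates -/

/-- A compact noncommutative space `X` with coordinates: a unital C⋆-algebra `C(X)`, together with
a family of elements of it, the standard coordinates. -/
structure NCSpace (ι : Type) where
  /-- the C⋆-algebra `C(X)` -/
  C : Type
  [cstar : CStarAlgebra C]
  /-- the standard coordinates -/
  coord : ι → C

attribute [instance] NCSpace.cstar

namespace NCSpace

variable {ι : Type}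

/-- The noncommutative space with self-adjoint coordinates defined by the relations `R`. -/
def ofRel (R : Set (NCPoly ι)) : NCSpace ι where
  C := UnivCStar R
  coord := UnivCStar.gen R

/-- Inclusion `X ⊆ Y` of noncommutative spaces with coordinates: a morphism `C(Y) → C(X)` mapping
standard coordinates to standard coordinates. -/
def Incl (X Y : NCSpace ι) : Prop :=
  ∃ π : Y.C →⋆ₐ[ℂ] X.C, ∀ i, π (Y.coord i) = X.coord i

/-- Equality `X = Y` of noncommutative spaces with coordinates: an isomorphism `C(X) ≃ C(Y)`
mapping standard coordinates to standard coordinates. -/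
def Same (X Y : NCSpace ι) : Prop :=
  ∃ e : X.C ≃⋆ₐ[ℂ] Y.C, ∀ i, e (X.coord i) = Y.coord i

end NCSpace

/-! ### Partitions -/

/-- The partitions between an upper row of `k` points and a lower row of `l` points. -/
abbrev RowPartition (k l : ℕ) : Type := Setoid (Fin k ⊕ Fin l)

namespace RowPartition

/-- Horizontal concatenation `π ⊗ σ`. -/
@[reducible]
def tensor {k l k' l' : ℕ} (π : RowPartition k l) (σ : RowPartition k' l') :
    RowPartition (k + k') (l + l') :=
  π.map (Sum.map (Fin.castAdd k') (Fin.castAdd l')) ⊔ σ.map (Sum.map (Fin.natAdd k) (Fin.natAdd l))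

/-- Vertical concatenation, with `π` above and `σ` below: the lower row of `π` is identified with
the upper row of `σ`, then the middle row, including the blocks contained in it, is erased. -/
@[reducible]
def comp {k l m : ℕ} (π : RowPartition k l) (σ : RowPartition l m) : RowPartition k m :=
  Setoid.comap (Sum.map id Sum.inr)
    (π.map (Sum.map id Sum.inl) ⊔ σ.map Sum.inr : Setoid (Fin k ⊕ (Fin l ⊕ Fin m)))

/-- Upside-down turning `π⋆`. -/
@[reducible]
def flip {k l : ℕ} (π : RowPartition k l) : RowPartition l k := Setoid.comap Sum.swap π

/-- The kernel of a multi-index `(i, j)`: the partition that joins the equal indices. -/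
@[reducible]
def ker {α : Type*} {k l : ℕ} (i : Fin k → α) (j : Fin l → α) : RowPartition k l :=
  Setoid.ker (Sum.elim i j)

/-- The strings of `π` join equal indices of `(i, j)`. -/
def Fits {α : Type*} {k l : ℕ} (π : RowPartition k l) (i : Fin k → α) (j : Fin l → α) : Prop :=
  π ≤ ker i j

/-- Each block has the same number of upper and lower legs. -/
def IsVert {k l : ℕ} (π : RowPartition k l) : Prop :=
  ∀ p, Nat.card {a : Fin k // π (Sum.inl a) p} = Nat.card {b : Fin l // π (Sum.inr b) p}

/-- The pair-positioner partition `ker (a a b / b a a)`. -/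
@[reducible]
def eta : RowPartition 3 3 := ker ![0, 0, 1] ![1, 0, 0]

end RowPartition

/-- A category of partitions. -/
structure IsPartitionCategory (D : ∀ k l, Set (RowPartition k l)) : Prop where
  tensor_mem : ∀ {k l k' l'} {π : RowPartition k l} {σ : RowPartition k' l'},
    π ∈ D k l → σ ∈ D k' l' → π.tensor σ ∈ D (k + k') (l + l')
  comp_mem : ∀ {k l m} {π : RowPartition k l} {σ : RowPartition l m},
    π ∈ D k l → σ ∈ D l m → π.comp σ ∈ D k m
  flip_mem : ∀ {k l} {π : RowPartition k l}, π ∈ D k l → π.flip ∈ D l k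
  /-- the identity partition `|` -/
  id_mem : (⊤ : RowPartition 1 1) ∈ D 1 1
  /-- the duality partition `∩` -/
  cap_mem : (⊤ : RowPartition 0 2) ∈ D 0 2

/-- The category of partitions generated by the pair-positioner partition. -/
def PevenInf (k l : ℕ) : Set (RowPartition k l) :=
  {π | ∀ D : ∀ k l, Set (RowPartition k l), IsPartitionCategory D → RowPartition.eta ∈ D 3 3 →
    π ∈ D k l}

/-! ### Noncommutative spheres -/

section spheres

variable (N : ℕ)

/-- The word `X_{i₁} ⋯ X_{iₖ}`. -/
def NCPoly.word {ι : Type*} {k : ℕ} (i : Fin k → ι) : NCPoly ι :=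
  (List.ofFn fun r => NCPoly.X (i r)).prod

/-- The relation `x_1² + ... + x_N² = 1` defining the free sphere. -/
def sphereRel : Set (NCPoly (Fin N)) := {∑ i, NCPoly.X i ^ 2 - 1}

/-- The relations `R_π`. -/
def partitionRel {k l : ℕ} (π : RowPartition k l) : Set (NCPoly (Fin N)) :=
  {f | ∃ (i : Fin k → Fin N) (j : Fin l → Fin N), π.Fits i j ∧
    f = NCPoly.word i - NCPoly.word j}

/-- The monomial sphere associated to a set `E` of partitions: the subspace of the free sphere
given by the relations `R_π`, for the partitions `π ∈ E` having the property that each block has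
the same number of upper and lower legs. -/
def monomialSphere (E : ∀ k l, Set (RowPartition k l)) : NCSpace (Fin N) :=
  NCSpace.ofRel (sphereRel N ∪
    {f | ∃ (k l : ℕ) (π : RowPartition k l), π ∈ E k l ∧ π.IsVert ∧ f ∈ partitionRel N π})

/-- The classical real sphere, with its standard coordinates `x_1, ..., x_N`. -/
def realSphere : NCSpace (Fin N) where
  C := C(Metric.sphere (0 : EuclideanSpace ℝ (Fin N)) 1, ℂ)
  coord i := ⟨fun x => ((x : EuclideanSpace ℝ (Fin N)) i : ℂ), by fun_prop⟩

/-- The half-liberated sphere, `x_i x_j x_k = x_k x_j x_i`. -/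
def halfSphere : NCSpace (Fin N) :=
  NCSpace.ofRel (sphereRel N ∪
    {f | ∃ i j k : Fin N, f = NCPoly.X i * NCPoly.X j * NCPoly.X k -
      NCPoly.X k * NCPoly.X j * NCPoly.X i})

/-- The monomial sphere associated to the category of partitions generated by the pair-positioner
partition. -/
def infSphere : NCSpace (Fin N) := monomialSphere N PevenInf

end spheres

/-! ### Reflection groups -/

section reflection

variable (N : ℕ)

/-- The partitions `π` such that the relations `g_{i₁} ⋯ g_{iₖ} = g_{j₁} ⋯ g_{jₗ}` hold, for any
indices such that the strings of `π` join equal indices of `(i, j)`. -/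
def groupPartitions {N : ℕ} {Γ : Type*} [Group Γ] (g : Fin N → Γ) (k l : ℕ) :
    Set (RowPartition k l) :=
  {π | ∀ (i : Fin k → Fin N) (j : Fin l → Fin N), π.Fits i j →
    (List.ofFn fun r => g (i r)).prod = (List.ofFn fun r => g (j r)).prod}

/-- The monomial sphere associated to a group generated by `g_1, ..., g_N`. -/
def groupSphere {Γ : Type*} [Group Γ] (g : Fin N → Γ) : NCSpace (Fin N) :=
  monomialSphere N (groupPartitions g)

/-- The group `ℤ₂^N`. -/
abbrev Z2Pow : Type := Fin N → Multiplicative (ZMod 2)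

/-- The standard generators of `ℤ₂^N`. -/
def Z2Pow.gen (i : Fin N) : Z2Pow N := Pi.mulSingle i (Multiplicative.ofAdd 1)

/-- The free product `ℤ₂^{*N}`. -/
abbrev Z2Free : Type := Monoid.CoprodI fun _ : Fin N => Multiplicative (ZMod 2)

/-- The standard generators of `ℤ₂^{*N}`. -/
def Z2Free.gen (i : Fin N) : Z2Free N :=
  Monoid.CoprodI.of (M := fun _ : Fin N => Multiplicative (ZMod 2)) (i := i)
    (Multiplicative.ofAdd 1)

/-- The group `ℤ₂^{∘N}`: the quotient of `ℤ₂^{*N}` by the relations `abc = cba` between the standard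
generators. -/
abbrev Z2Half : Type :=
  Z2Free N ⧸ Subgroup.normalClosure {h : Z2Free N | ∃ i j k : Fin N,
    h = Z2Free.gen N i * Z2Free.gen N j * Z2Free.gen N k *
      (Z2Free.gen N k * Z2Free.gen N j * Z2Free.gen N i)⁻¹}

/-- The standard generators of `ℤ₂^{∘N}`. -/
def Z2Half.gen (i : Fin N) : Z2Half N := QuotientGroup.mk (Z2Free.gen N i)

end reflection

/-! ### Orthogonal quantum groups -/

section quantum

variable {N : ℕ}

/-- `(C(G), u)` is a quantum group `G ⊆ O_N⁺`: the C⋆-algebra `C(G)` is generated by the entries of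
the matrix `u`, which is orthogonal (`u = ū`, `uᵗ = u⁻¹`), and there are morphisms of C⋆-algebras
`Δ(u_ij) = ∑ₖ u_ik ⊗ u_kj`, `ε(u_ij) = δ_ij` and `S(u_ij) = u_ji`, the latter with values in the
opposite algebra. -/
structure IsOrthogonalQuantumGroup (G : NCSpace (Fin N × Fin N)) : Prop where
  selfAdjoint : ∀ i j, star (G.coord (i, j)) = G.coord (i, j)
  row : ∀ i j, ∑ k, G.coord (i, k) * G.coord (j, k) = if i = j then 1 else 0
  col : ∀ i j, ∑ k, G.coord (k, i) * G.coord (k, j) = if i = j then 1 else 0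
  generated : (StarAlgebra.adjoin ℂ (Set.range G.coord)).topologicalClosure = ⊤
  comul : ∃ Δ : G.C →⋆ₐ[ℂ] CStarTensor G.C G.C, ∀ i j,
    Δ (G.coord (i, j)) = ∑ k, CStarTensor.tmul (G.coord (i, k)) (G.coord (k, j))
  counit : ∃ ε : G.C →⋆ₐ[ℂ] ℂ, ∀ i j, ε (G.coord (i, j)) = if i = j then 1 else 0
  antipode : ∃ S : G.C →⋆ₐ[ℂ] G.Cᵐᵒᵖ, ∀ i j, S (G.coord (i, j)) = MulOpposite.op (G.coord (j, i))

/-- `G` acts affinely on `X`: there is a morphism `Φ : C(X) → C(G) ⊗ C(X)`, given by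
`Φ(x_i) = ∑ⱼ u_ij ⊗ x_j`. (Such a morphism is automatically coassociative and counital, by the
formulae of `Δ` and `ε` on the coordinates.) -/
def ActsAffinely (G : NCSpace (Fin N × Fin N)) (X : NCSpace (Fin N)) : Prop :=
  ∃ Φ : X.C →⋆ₐ[ℂ] CStarTensor G.C X.C, ∀ i,
    Φ (X.coord i) = ∑ j, CStarTensor.tmul (G.coord (i, j)) (X.coord j)

/-- `G = G⁺(X)` is the quantum isometry group of the nondegenerate space `X`: the biggest quantum
group `G ⊆ O_N⁺` acting affinely on `X`. -/
structure IsQuantumIsometryGroup (G : NCSpace (Fin N × Fin N)) (X : NCSpace (Fin N)) : Prop where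
  nondegenerate : LinearIndependent ℂ X.coord
  quantumGroup : IsOrthogonalQuantumGroup G
  acts : ActsAffinely G X
  maximal : ∀ H : NCSpace (Fin N × Fin N), IsOrthogonalQuantumGroup H → ActsAffinely H X → H.Incl G

variable (N)

/-- The relations `u uᵗ = uᵗ u = 1` defining `O_N⁺`. -/
def orthRel : Set (NCPoly (Fin N × Fin N)) :=
  {f | ∃ i j, f = ∑ k, NCPoly.X (i, k) * NCPoly.X (j, k) - (if i = j then 1 else 0)} ∪
  {f | ∃ i j, f = ∑ k, NCPoly.X (k, i) * NCPoly.X (k, j) - (if i = j then 1 else 0)}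

instance : CompactSpace (Matrix.orthogonalGroup (Fin N) ℝ) := by
  have hK : IsCompact (Set.pi Set.univ fun _ => Set.pi Set.univ fun _ => Set.Icc (-1) 1 :
      Set (Matrix (Fin N) (Fin N) ℝ)) :=
    isCompact_univ_pi fun _ => isCompact_univ_pi fun _ => isCompact_Icc
  have hc : IsClosed (Matrix.orthogonalGroup (Fin N) ℝ : Set (Matrix (Fin N) (Fin N) ℝ)) := by
    have h : (Matrix.orthogonalGroup (Fin N) ℝ : Set (Matrix (Fin N) (Fin N) ℝ)) =
        {U | U * U.transpose = 1} := by
      ext U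
      exact Matrix.mem_orthogonalGroup_iff _ _
    rw [h]
    exact isClosed_eq (by fun_prop) (by fun_prop)
  refine isCompact_iff_compactSpace.mp (hK.of_isClosed_subset hc ?_)
  intro U hU i _ j _
  have h := entry_norm_bound_of_unitary (𝕜 := ℝ) hU i j
  rw [Real.norm_eq_abs] at h
  exact abs_le.mp h

/-- The orthogonal group `O_N`, with its standard coordinates. -/
def orthogonalGroupSpace : NCSpace (Fin N × Fin N) where
  C := C(Matrix.orthogonalGroup (Fin N) ℝ, ℂ)
  coord p := ⟨fun U => ((U : Matrix (Fin N) (Fin N) ℝ) p.1 p.2 : ℂ),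
    Complex.continuous_ofReal.comp
      ((continuous_apply_apply p.1 p.2).comp continuous_subtype_val)⟩

/-- The half-liberated orthogonal quantum group `O_N⋆ ⊆ O_N⁺`, given by `abc = cba` for any
`a, b, c ∈ {u_ij}`. -/
def halfOrthogonalGroup : NCSpace (Fin N × Fin N) :=
  NCSpace.ofRel (orthRel N ∪
    {f | ∃ a b c, f = NCPoly.X a * NCPoly.X b * NCPoly.X c - NCPoly.X c * NCPoly.X b * NCPoly.X a})

open Classical in
/-- The matrix of the linear map `T_π : (ℂ^N)^{⊗k} → (ℂ^N)^{⊗l}`. -/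
def partitionMap {k l : ℕ} (π : RowPartition k l) :
    Matrix (Fin l → Fin N) (Fin k → Fin N) (NCPoly (Fin N × Fin N)) :=
  fun j i => if π.Fits i j then 1 else 0

/-- The matrix `u^{⊗k}`. -/
def tensorPower (k : ℕ) : Matrix (Fin k → Fin N) (Fin k → Fin N) (NCPoly (Fin N × Fin N)) :=
  fun i j => NCPoly.word fun r => (i r, j r)

/-- The relations `T_π ∈ Hom(u^{⊗k}, u^{⊗l})`, that is, `T_π u^{⊗k} = u^{⊗l} T_π`. -/
def intertwinerRel {k l : ℕ} (π : RowPartition k l) : Set (NCPoly (Fin N × Fin N)) :=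
  {f | ∃ j i, f = (partitionMap N π * tensorPower N k - tensorPower N l * partitionMap N π) j i}

/-- The easy quantum group associated to a category of partitions `D`: the subgroup of `O_N⁺` given
by the relations `T_π ∈ Hom(u^{⊗k}, u^{⊗l})`, with `π ∈ D(k, l)`. -/
def easyQuantumGroup (D : ∀ k l, Set (RowPartition k l)) : NCSpace (Fin N × Fin N) :=
  NCSpace.ofRel (orthRel N ∪
    {f | ∃ (k l : ℕ) (π : RowPartition k l), π ∈ D k l ∧ f ∈ intertwinerRel N π})

/-- The quantum group `H_N^{[∞]}`. -/
def hyperoctahedralInf : NCSpace (Fin N × Fin N) := easyQuantumGroup N PevenInf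

end quantum

end

-- Spheres. Two words related by a vertical partition contain the same letters. They are moreover
-- equal in the group, and a suitable action of the group shows how far this determines the order of
-- the letters: for ℤ₂^N not at all, for ℤ₂^{∘N} the letters at even and at odd places are
-- determined, for ℤ₂^{*N} the reduced word is. These data are just what suffices to rewrite one
-- word into the other by ab = ba, by abc = cba, or by aab = baa (`word_eq_of_evenLetters_eq`,
-- `word_eq_of_reduceWord_eq`). No description of P_even^{[∞]} is needed: the partitions of a group
-- generated by involutions form a category containing η (`isPartitionCategory_groupPartitions`), so
-- both the sphere of P_even^{[∞]} and the sphere of ℤ₂^{*N} are given by the centrality of the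
-- squares.
--
-- Quantum groups. The partitions intertwined by an orthogonal matrix form a category
-- (`isPartitionCategory_intertwines`), so H_N^{[∞]} is given by the relation of η alone. That
-- relation means: distinct entries on a row or a column have product 0, and squares of entries are
-- central (`IsPairPositioner`). Each of the three quantum groups thus has a short presentation,
-- checked on Σ u_ij ⊗ x_j for the action and on Σ u_ik ⊗ u_kj for the comultiplication.
--
-- Maximality. If H acts on X, apply Φ to the relations of X and slice by representations of C(X).
-- This gives linear relations between products of the u_ij, and the antipode gives their
-- transposes. For the real sphere, points give the symmetrized relations; for the half-liberated
-- one, the 2 × 2 matrices with entries z_i and their conjugates do, by polarization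
-- (`triForm_antisymm`). Subtracting the antipode version leaves twice the wanted relation. For S_∞,
-- a representation by involutions of a path kills the coefficients of reduced words
-- (`pathMatrix_mul_mul_apply`), and real points make the others antisymmetric. Row and column
-- defects then satisfy one common identity (`rowDefect_eq_colDefect`); contracting it with u_ia
-- leaves the row and column orthogonality multiplied by N - 2, hence N ≠ 2.
--
-- Non-inclusions. A reflection in O_N has two nonzero entries on one row. In the other direction,
-- three involutions not satisfying abc = cba define a diagonal model of H_N^{[∞]}.

noncomputable section

-- Suprema of C⋆-seminorms and morphisms out of completions

namespace CStarSeminorm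

section envelope

variable {A : Type*} [Ring A] [StarRing A] [Algebra ℂ A]

theorem le_supOf {P : Set (CStarSeminorm A)} {hP : ∀ a : A, ∃ M : ℝ, ∀ p ∈ P, p.toSeminorm a ≤ M}
    {p : CStarSeminorm A} (hp : p ∈ P) (a : A) : p.toSeminorm a ≤ (supOf P hP).toSeminorm a := by
  obtain ⟨M, hM⟩ := hP a
  exact le_ciSup (f := fun q : P => q.1.toSeminorm a)
    ⟨M, by rintro _ ⟨q, rfl⟩; exact hM q.1 q.2⟩ ⟨p, hp⟩

theorem supOf_le {P : Set (CStarSeminorm A)} {hP : ∀ a : A, ∃ M : ℝ, ∀ p ∈ P, p.toSeminorm a ≤ M}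
    {a : A} {M : ℝ} (hM : 0 ≤ M) (h : ∀ p ∈ P, p.toSeminorm a ≤ M) :
    (supOf P hP).toSeminorm a ≤ M :=
  Real.iSup_le (fun p => h p.1 p.2) hM

/-- The C⋆-seminorm `a ↦ ‖φ a‖` defined by a ⋆-homomorphism into a C⋆-algebra. -/
def ofHom {B : Type*} [CStarAlgebra B] (φ : A →⋆ₐ[ℂ] B) : CStarSeminorm A where
  toSeminorm := (normSeminorm ℂ B).comp (φ : A →⋆ₐ[ℂ] B).toAlgHom.toLinearMap
  mul_le' a b := by
    change ‖φ (a * b)‖ ≤ ‖φ a‖ * ‖φ b‖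
    rw [map_mul]
    exact norm_mul_le _ _
  cstar' a := by
    change ‖φ (star a * a)‖ = ‖φ a‖ * ‖φ a‖
    rw [map_mul, map_star, CStarRing.norm_star_mul_self]

theorem ofHom_apply {B : Type*} [CStarAlgebra B] (φ : A →⋆ₐ[ℂ] B) (a : A) :
    (ofHom φ).toSeminorm a = ‖φ a‖ := rfl

variable [StarModule ℂ A] (p : CStarSeminorm A)

theorem norm_toEnvelope (a : A) : ‖p.toEnvelope a‖ = p.toSeminorm a :=
  UniformSpace.Completion.norm_coe (p.toCarrier a)

theorem denseRange_toEnvelope : DenseRange p.toEnvelope :=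
  UniformSpace.Completion.denseRange_coe (α := p.Carrier)

/-- Being dominated by the seminorm makes the map uniformly continuous, so it extends to the
completion, and the algebraic identities follow by density. The universal properties of `UnivCStar`
and `CStarTensor` both rest on this. -/
theorem exists_lift_of_norm_le {B : Type*} [CStarAlgebra B] (φ : A →⋆ₐ[ℂ] B)
    (h : ∀ a, ‖φ a‖ ≤ p.toSeminorm a) :
    ∃ ψ : p.Envelope →⋆ₐ[ℂ] B, ∀ a, ψ (p.toEnvelope a) = φ a := by
  let f : p.Carrier →+ B := (φ : A →⋆ₐ[ℂ] B).toAlgHom.toRingHom.toAddMonoidHom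
  have hf : Continuous f := AddMonoidHomClass.continuous_of_bound f 1 fun a => by
    rw [one_mul]; exact h a
  have hu : UniformContinuous f := uniformContinuous_addMonoidHom_of_continuous hf
  let g : UniformSpace.Completion p.Carrier → B := UniformSpace.Completion.extension f
  have hg : Continuous g := UniformSpace.Completion.continuous_extension
  have hgc : ∀ a : p.Carrier, g a = f a := fun a => UniformSpace.Completion.extension_coe hu a
  let F : p.Envelope → B := g
  have hF : Continuous F := hg
  have hFc : ∀ a : A, F (p.toEnvelope a) = φ a := fun a => hgc a
  have hd := p.denseRange_toEnvelope
  refine ⟨{ toFun := F, map_one' := ?_, map_mul' := ?_, map_zero' := ?_, map_add' := ?_,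
            commutes' := ?_, map_star' := ?_ }, hFc⟩
  · rw [← map_one p.toEnvelope, hFc, map_one]
  · intro x y
    refine hd.induction_on₂ (p := fun x y => F (x * y) = F x * F y)
      (isClosed_eq (by fun_prop) (by fun_prop)) (fun a b => ?_) x y
    rw [← map_mul, hFc, hFc, hFc, map_mul]
  · change F 0 = 0
    rw [← map_zero p.toEnvelope, hFc, map_zero]
  · intro x y
    change F (x + y) = F x + F y
    refine hd.induction_on₂ (p := fun x y => F (x + y) = F x + F y)
      (isClosed_eq (by fun_prop) (by fun_prop)) (fun a b => ?_) x y
    rw [← map_add, hFc, hFc, hFc, map_add]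
  · intro r
    change F (algebraMap ℂ _ r) = _
    rw [← AlgHomClass.commutes p.toEnvelope, hFc, AlgHomClass.commutes]
  · intro x
    refine hd.induction_on (p := fun x => F (star x) = star (F x)) x
      (isClosed_eq (by fun_prop) (by fun_prop)) (fun a => ?_)
    rw [← map_star, hFc, hFc, map_star]

end envelope

end CStarSeminorm

/-! ### Evaluation of noncommutative polynomials -/

namespace NCPoly

variable {ι : Type*}

theorem X_mul_monomial (i : ι) (w : FreeMonoid ι) :
    X i * monomial w 1 = monomial (FreeMonoid.of i * w) 1 := by
  rw [X, monomial_mul, one_mul]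

theorem star_X (i : ι) : star (X i) = X i := by
  rw [X, star_monomial, star_one]
  rfl

/-- Evaluation at a family of self-adjoint elements. -/
def eval {B : Type*} [Ring B] [StarRing B] [Algebra ℂ B] [StarModule ℂ B] (b : ι → B)
    (hb : ∀ i, star (b i) = b i) : NCPoly ι →⋆ₐ[ℂ] B where
  toAlgHom := MonoidAlgebra.lift ℂ B (FreeMonoid ι) (FreeMonoid.lift b)
  map_star' f := by
    set φ : NCPoly ι →ₐ[ℂ] B := MonoidAlgebra.lift ℂ B (FreeMonoid ι) (FreeMonoid.lift b) with hφ
    have hm : ∀ w c, φ (monomial w c) = c • FreeMonoid.lift b w := fun w c =>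
      MonoidAlgebra.lift_single ..
    change φ (star f) = star (φ f)
    induction f using NCPoly.induction with
    | h0 => simp
    | hm w c =>
      rw [star_monomial, hm, hm, star_smul]
      congr 1
      induction w using FreeMonoid.inductionOn' with
      | one => simp
      | of_mul i w ih => rw [star_mul, map_mul, map_mul, star_mul, ih, FreeMonoid.star_of,
          FreeMonoid.lift_eval_of, hb]
    | ha f g hf hg => rw [star_add, map_add, map_add, star_add, hf, hg]

section

variable {B : Type*} [Ring B] [StarRing B] [Algebra ℂ B] [StarModule ℂ B] (b : ι → B)
    (hb : ∀ i, star (b i) = b i)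

@[simp]
theorem eval_X (i : ι) : eval b hb (X i) = b i := by
  change MonoidAlgebra.lift ℂ B (FreeMonoid ι) (FreeMonoid.lift b) (MonoidAlgebra.single _ _) = _
  simp

theorem eval_word {k : ℕ} (i : Fin k → ι) :
    eval b hb (word i) = (List.ofFn fun r => b (i r)).prod := by
  rw [word, map_list_prod, List.map_ofFn]
  congr 2
  funext r
  simp

end

theorem adjoin_X : StarAlgebra.adjoin ℂ (Set.range (X : ι → NCPoly ι)) = ⊤ := by
  rw [eq_top_iff]
  rintro f -
  induction f using NCPoly.induction with
  | h0 => exact zero_mem _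
  | hm w c =>
    rw [← mul_one c, ← smul_monomial]
    refine SMulMemClass.smul_mem c ?_
    induction w using FreeMonoid.inductionOn' with
    | one => exact one_mem _
    | of_mul i w ih =>
      rw [← X_mul_monomial]
      exact mul_mem (StarAlgebra.subset_adjoin ℂ _ ⟨i, rfl⟩) ih
  | ha f g hf hg => exact add_mem hf hg

end NCPoly

/-! ### Universal C⋆-algebras -/

/-- A family of elements generates a C⋆-algebra. -/
def GeneratesCStar {ι A : Type*} [CStarAlgebra A] (a : ι → A) : Prop :=
  (StarAlgebra.adjoin ℂ (Set.range a)).topologicalClosure = ⊤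

/-- Morphisms of C⋆-algebras are contractive, so their equalizer is a closed ⋆-subalgebra. -/
theorem GeneratesCStar.hom_ext {ι A B : Type*} [CStarAlgebra A] [CStarAlgebra B] {a : ι → A}
    (ha : GeneratesCStar a) {φ ψ : A →⋆ₐ[ℂ] B} (h : ∀ i, φ (a i) = ψ (a i)) : φ = ψ := by
  have hcont : ∀ χ : A →⋆ₐ[ℂ] B, Continuous χ := fun χ =>
    AddMonoidHomClass.continuous_of_bound χ 1 fun a => by
      rw [one_mul]; exact NonUnitalStarAlgHom.norm_apply_le χ a
  have h1 : StarAlgebra.adjoin ℂ (Set.range a) ≤ StarAlgHom.equalizer φ ψ :=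
    StarAlgHom.adjoin_le_equalizer φ ψ (by rintro _ ⟨i, rfl⟩; exact h i)
  have h2 : (StarAlgebra.adjoin ℂ (Set.range a)).topologicalClosure ≤ StarAlgHom.equalizer φ ψ :=
    StarSubalgebra.topologicalClosure_minimal h1 (isClosed_eq (hcont φ) (hcont ψ))
  rw [ha] at h2
  ext x
  exact h2 (StarSubalgebra.mem_top (x := x))

namespace UnivCStar

variable {ι : Type*} (R : Set (NCPoly ι))

/-- The canonical map from noncommutative polynomials. -/
def mk : NCPoly ι →⋆ₐ[ℂ] UnivCStar R :=
  (CStarSeminorm.supOf (admissibleSeminorms R) (admissibleSeminorms_bdd R)).toEnvelope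

theorem mk_X (i : ι) : mk R (NCPoly.X i) = gen R i := rfl

theorem star_gen (i : ι) : star (gen R i) = gen R i := by
  rw [← mk_X, ← map_star, NCPoly.star_X]

theorem mk_eq_eval (f : NCPoly ι) : mk R f = NCPoly.eval (gen R) (star_gen R) f := by
  have h : StarAlgebra.adjoin ℂ (Set.range (NCPoly.X : ι → NCPoly ι)) ≤
      StarAlgHom.equalizer (mk R) (NCPoly.eval (gen R) (star_gen R)) :=
    StarAlgHom.adjoin_le_equalizer _ _ (by
      rintro _ ⟨i, rfl⟩
      rw [NCPoly.eval_X, mk_X])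
  rw [NCPoly.adjoin_X] at h
  exact h (StarSubalgebra.mem_top (x := f))

theorem eval_gen_eq_zero {f : NCPoly ι} (hf : f ∈ R) :
    NCPoly.eval (gen R) (star_gen R) f = 0 := by
  rw [← mk_eq_eval, ← norm_eq_zero]
  refine (CStarSeminorm.norm_toEnvelope _ f).trans (le_antisymm ?_ (apply_nonneg _ _))
  exact CStarSeminorm.supOf_le le_rfl fun p hp => (hp.2 f hf).le

theorem generates : GeneratesCStar (gen R) := by
  have hd : DenseRange (mk R) := CStarSeminorm.denseRange_toEnvelope _
  have h1 : (mk R).range ≤ StarAlgebra.adjoin ℂ (Set.range (gen R)) := by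
    rintro _ ⟨f, rfl⟩
    have hf : f ∈ StarAlgebra.adjoin ℂ (Set.range (NCPoly.X : ι → NCPoly ι)) := by
      rw [NCPoly.adjoin_X]; exact StarSubalgebra.mem_top
    have h := StarAlgHom.map_adjoin (mk R) (Set.range (NCPoly.X : ι → NCPoly ι))
    rw [← Set.range_comp] at h
    change mk R f ∈ StarAlgebra.adjoin ℂ (Set.range (mk R ∘ NCPoly.X))
    rw [← h]
    exact ⟨f, hf, rfl⟩
  rw [GeneratesCStar, eq_top_iff]
  rintro x -
  exact closure_mono h1 (hd x)

/-- The seminorm f ↦ ‖f(b)‖ is admissible, hence at most the supremum which defines the norm. -/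
theorem exists_lift {B : Type*} [CStarAlgebra B] (b : ι → B) (hb : ∀ i, star (b i) = b i)
    (hb1 : ∀ i, ‖b i‖ ≤ 1) (hR : ∀ f ∈ R, NCPoly.eval b hb f = 0) :
    ∃ φ : UnivCStar R →⋆ₐ[ℂ] B, ∀ i, φ (gen R i) = b i := by
  have hp : CStarSeminorm.ofHom (NCPoly.eval b hb) ∈ admissibleSeminorms R :=
    ⟨fun i => by rw [CStarSeminorm.ofHom_apply, NCPoly.eval_X]; exact hb1 i,
      fun f hf => by rw [CStarSeminorm.ofHom_apply, hR f hf, norm_zero]⟩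
  obtain ⟨φ, hφ⟩ := CStarSeminorm.exists_lift_of_norm_le
    (CStarSeminorm.supOf (admissibleSeminorms R) (admissibleSeminorms_bdd R)) (NCPoly.eval b hb)
    (CStarSeminorm.le_supOf (p := CStarSeminorm.ofHom (NCPoly.eval b hb)) hp)
  exact ⟨φ, fun i => (hφ (NCPoly.X i)).trans (NCPoly.eval_X b hb i)⟩

end UnivCStar

/-! ### Maximal tensor products -/

namespace CStarTensor

variable {A B : Type*} [CStarAlgebra A] [CStarAlgebra B]

variable (A B) in
/-- The canonical map from the algebraic tensor product. -/
def mk : A ⊗[ℂ] B →⋆ₐ[ℂ] CStarTensor A B :=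
  (CStarSeminorm.supOf (tensorSeminorms A B) (tensorSeminorms_bdd A B)).toEnvelope

theorem mk_tmul (a : A) (b : B) : mk A B (a ⊗ₜ b) = tmul a b := rfl

theorem tmul_mul_tmul (a a' : A) (b b' : B) :
    tmul a b * tmul a' b' = tmul (a * a') (b * b') := by
  rw [← mk_tmul, ← mk_tmul, ← map_mul, Algebra.TensorProduct.tmul_mul_tmul, mk_tmul]

theorem star_tmul (a : A) (b : B) : star (tmul a b) = tmul (star a) (star b) := by
  rw [← mk_tmul, ← map_star, TensorProduct.star_tmul, mk_tmul]

theorem one_tmul_one : tmul (1 : A) (1 : B) = 1 := by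
  rw [← mk_tmul, ← Algebra.TensorProduct.one_def, map_one]

theorem add_tmul (a a' : A) (b : B) : tmul (a + a') b = tmul a b + tmul a' b := by
  rw [← mk_tmul, TensorProduct.add_tmul, map_add, mk_tmul, mk_tmul]

@[simp]
theorem zero_tmul (b : B) : tmul (0 : A) b = 0 := by
  rw [← mk_tmul, TensorProduct.zero_tmul, map_zero]

@[simp]
theorem tmul_zero (a : A) : tmul a (0 : B) = 0 := by
  rw [← mk_tmul, TensorProduct.tmul_zero, map_zero]

theorem sum_tmul {σ : Type*} (s : Finset σ) (f : σ → A) (b : B) :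
    tmul (∑ i ∈ s, f i) b = ∑ i ∈ s, tmul (f i) b := by
  rw [← mk_tmul, TensorProduct.sum_tmul, map_sum]
  rfl

theorem tmul_sum {σ : Type*} (s : Finset σ) (a : A) (f : σ → B) :
    tmul a (∑ i ∈ s, f i) = ∑ i ∈ s, tmul a (f i) := by
  rw [← mk_tmul, TensorProduct.tmul_sum, map_sum]
  rfl

/-- Commuting images give a morphism on the algebraic tensor product, and its norm is one of the
seminorms in the supremum because φ and ψ are contractive. -/
theorem exists_lift {E : Type*} [CStarAlgebra E] (φ : A →⋆ₐ[ℂ] E) (ψ : B →⋆ₐ[ℂ] E)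
    (h : ∀ a b, Commute (φ a) (ψ b)) :
    ∃ χ : CStarTensor A B →⋆ₐ[ℂ] E, ∀ a b, χ (tmul a b) = φ a * ψ b := by
  let f : A ⊗[ℂ] B →ₐ[ℂ] E := Algebra.TensorProduct.lift φ.toAlgHom ψ.toAlgHom h
  have hf : ∀ a b, f (a ⊗ₜ b) = φ a * ψ b := fun a b => Algebra.TensorProduct.lift_tmul ..
  let F : A ⊗[ℂ] B →⋆ₐ[ℂ] E :=
    { f with
      map_star' := fun t => by
        change f (star t) = star (f t)
        induction t using TensorProduct.induction_on with
        | zero => simp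
        | tmul a b => rw [TensorProduct.star_tmul, hf, hf, star_mul, map_star, map_star,
            ((h (a) (b)).star_star).eq]
        | add s t hs ht => rw [star_add, map_add, map_add, star_add, hs, ht] }
  obtain ⟨χ, hχ⟩ := CStarSeminorm.exists_lift_of_norm_le
    (CStarSeminorm.supOf (tensorSeminorms A B) (tensorSeminorms_bdd A B)) F
    fun t => CStarSeminorm.le_supOf (p := CStarSeminorm.ofHom F) (fun a b => by
      rw [CStarSeminorm.ofHom_apply]
      change ‖f (a ⊗ₜ b)‖ ≤ _
      rw [hf]
      exact (norm_mul_le _ _).trans (mul_le_mul (NonUnitalStarAlgHom.norm_apply_le φ a)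
        (NonUnitalStarAlgHom.norm_apply_le ψ b) (norm_nonneg _) (norm_nonneg _))) t
  exact ⟨χ, fun a b => (hχ (a ⊗ₜ b)).trans (hf a b)⟩

end CStarTensor

/-! ### Families of self-adjoint elements with `∑ x_i² = 1` -/

/-- In the spectral order 0 ≤ b_i² ≤ ∑ b_j² = 1. This supplies the contraction condition of
`admissibleSeminorms`, both for points of spheres and for rows of orthogonal matrices. -/
theorem norm_le_one_of_sum_mul_self {ι B : Type*} [Fintype ι] [CStarAlgebra B] {b : ι → B}
    (hb : ∀ i, star (b i) = b i) (h : ∑ i, b i * b i = 1) (i : ι) : ‖b i‖ ≤ 1 := by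
  let := CStarAlgebra.spectralOrder B
  have := CStarAlgebra.spectralOrderedRing B
  have h0 : ∀ j, 0 ≤ b j * b j := fun j => by
    have := star_mul_self_nonneg (b j)
    rwa [hb] at this
  have h1 : b i * b i ≤ 1 := by
    rw [← h]
    exact Finset.single_le_sum (fun j _ => h0 j) (Finset.mem_univ i)
  have h2 : ‖b i * b i‖ ≤ 1 := (CStarAlgebra.norm_le_one_iff_of_nonneg _ (h0 i)).2 h1
  have h3 : ‖b i * b i‖ = ‖b i‖ * ‖b i‖ := by
    rw [← CStarRing.norm_star_mul_self, hb]
  nlinarith [norm_nonneg (b i)]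

/-! ### Spaces with coordinates -/

namespace NCSpace

variable {ι : Type}

theorem Incl.trans {X Y Z : NCSpace ι} (h : X.Incl Y) (h' : Y.Incl Z) : X.Incl Z := by
  obtain ⟨φ, hφ⟩ := h
  obtain ⟨ψ, hψ⟩ := h'
  exact ⟨φ.comp ψ, fun i => by rw [StarAlgHom.comp_apply, hψ, hφ]⟩

theorem same_of_incl {X Y : NCSpace ι} (hX : GeneratesCStar X.coord) (hY : GeneratesCStar Y.coord)
    (h : X.Incl Y) (h' : Y.Incl X) : X.Same Y := by
  obtain ⟨φ, hφ⟩ := h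
  obtain ⟨ψ, hψ⟩ := h'
  have h1 : φ.comp ψ = StarAlgHom.id ℂ X.C := hX.hom_ext fun i => by
    rw [StarAlgHom.comp_apply, hψ, hφ]; rfl
  have h2 : ψ.comp φ = StarAlgHom.id ℂ Y.C := hY.hom_ext fun i => by
    rw [StarAlgHom.comp_apply, hφ, hψ]; rfl
  exact ⟨StarAlgEquiv.ofStarAlgHom ψ φ h1 h2, hψ⟩

theorem generates_ofRel (R : Set (NCPoly ι)) : GeneratesCStar (ofRel R).coord :=
  UnivCStar.generates R

end NCSpace

/-! ### Commuting families and algebras of continuous functions -/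

/-- A commuting family of self-adjoint elements of a C⋆-algebra, all of whose joint characters lie
in a compact set `K`, defines a morphism from `C(K)`. -/
theorem exists_hom_continuousMap.{u} {ι K : Type*} {A : Type u} [CStarAlgebra A] [TopologicalSpace K]
    [CompactSpace K] (v : ι → A) (hv : ∀ i, star (v i) = v i) (hc : ∀ i j, v i * v j = v j * v i)
    (κ : K → ι → ℝ) (hκ : Topology.IsInducing κ)
    (hK : ∀ (B : Type u) [CommCStarAlgebra B] (w : ι → B) (j : B →⋆ₐ[ℂ] A),
      Function.Injective j → (∀ i, j (w i) = v i) →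
      ∀ (χ : B →⋆ₐ[ℂ] ℂ), ∃ x : K, ∀ i, χ (w i) = κ x i) :
    ∃ φ : C(K, ℂ) →⋆ₐ[ℂ] A, ∀ (f : C(K, ℂ)) (i : ι), (∀ x, f x = κ x i) → φ f = v i := by
  have hcomm : IsMulCommutative (StarAlgebra.adjoin ℂ (Set.range v)) :=
    StarAlgebra.isMulCommutative_adjoin ℂ
      (by rintro _ ⟨i, rfl⟩ _ ⟨j, rfl⟩; exact hc i j)
      (by rintro _ ⟨i, rfl⟩ _ ⟨j, rfl⟩; rw [hv]; exact hc i j)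
  let S := (StarAlgebra.adjoin ℂ (Set.range v)).topologicalClosure
  have hS : IsClosed (S : Set A) := StarSubalgebra.isClosed_topologicalClosure _
  let iC : CStarAlgebra S := StarSubalgebra.cstarAlgebra S
  have hSc : ∀ x y : S, x * y = y * x :=
    (StarSubalgebra.commRingTopologicalClosure (StarAlgebra.adjoin ℂ (Set.range v))
      (fun x y => hcomm.is_comm.comm x y)).mul_comm
  let : CommCStarAlgebra S := { iC with mul_comm := hSc }
  have hvS : ∀ i, v i ∈ S := fun i =>
    StarSubalgebra.le_topologicalClosure _ (StarAlgebra.subset_adjoin ℂ _ ⟨i, rfl⟩)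
  let w : ι → S := fun i => ⟨v i, hvS i⟩
  have hx : ∀ χ : WeakDual.characterSpace ℂ S, ∃ x : K, ∀ i, χ (w i) = κ x i := fun χ =>
    hK S w S.subtype Subtype.val_injective (fun i => rfl)
      { toFun := χ, map_one' := map_one χ, map_mul' := map_mul χ, map_zero' := map_zero χ,
        map_add' := map_add χ, commutes' := AlgHomClass.commutes χ, map_star' := map_star χ }
  -- Gelfand duality for the commutative algebra S: a character is sent to the point of K having the
  -- same coordinates. Pulling functions back along this map and inverting the Gelfand transform
  -- gives the morphism.
  choose p hp using hx
  have hpc : Continuous p := by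
    rw [hκ.continuous_iff]
    refine continuous_pi fun i => ?_
    have : (fun χ => (κ ∘ p) χ i) =
        fun χ : WeakDual.characterSpace ℂ S => (gelfandStarTransform S (w i) χ).re := by
      funext χ
      have : gelfandStarTransform S (w i) χ = χ (w i) := rfl
      rw [this, hp, Complex.ofReal_re]
      rfl
    rw [this]
    fun_prop
  let φ : C(K, ℂ) →⋆ₐ[ℂ] S :=
    ((gelfandStarTransform S).symm : C(_, ℂ) →⋆ₐ[ℂ] S).comp
      (ContinuousMap.compStarAlgHom' ℂ ℂ ⟨p, hpc⟩)
  refine ⟨S.subtype.comp φ, fun f i hf => ?_⟩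
  have : φ f = w i := by
    change (gelfandStarTransform S).symm _ = _
    rw [StarAlgEquiv.symm_apply_eq]
    ext χ
    have : gelfandStarTransform S (w i) χ = χ (w i) := rfl
    rw [this, hp, ← hf]
    rfl
  rw [StarAlgHom.comp_apply, this]
  rfl

theorem generates_continuousMap {ι K : Type*} [TopologicalSpace K] [CompactSpace K]
    (f : ι → C(K, ℂ)) (h : ∀ x y, x ≠ y → ∃ i, f i x ≠ f i y) : GeneratesCStar f := by
  refine ContinuousMap.starSubalgebra_topologicalClosure_eq_top_of_separatesPoints _ ?_
  intro x y hxy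
  obtain ⟨i, hi⟩ := h x y hxy
  exact ⟨f i, ⟨f i, StarAlgebra.subset_adjoin ℂ _ ⟨i, rfl⟩, rfl⟩, hi⟩

/-- The characters of a commutative C⋆-algebra are real on self-adjoint elements. -/
theorem hom_complex_eq_ofReal {B : Type*} [CStarAlgebra B] (χ : B →⋆ₐ[ℂ] ℂ) {b : B}
    (hb : star b = b) : χ b = ((χ b).re : ℂ) := by
  have : star (χ b) = χ b := by rw [← map_star, hb]
  exact (Complex.conj_eq_iff_re.1 this).symm

/-! ### Words in monoids -/

section words

variable {ι : Type*} [DecidableEq ι]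

/-- Multiplication by a letter in the free product of copies of `ℤ₂`, on reduced words. -/
def reduceCons (a : ι) : List ι → List ι
  | [] => [a]
  | b :: t => if a = b then t else a :: b :: t

/-- The reduced form of a word, in the free product of copies of `ℤ₂`. -/
def reduceWord (L : List ι) : List ι := L.foldr reduceCons []

theorem reduceWord_cons (a : ι) (L : List ι) :
    reduceWord (a :: L) = reduceCons a (reduceWord L) := rfl

theorem isChain_reduceCons {a : ι} {L : List ι} (h : L.IsChain (· ≠ ·)) :
    (reduceCons a L).IsChain (· ≠ ·) := by
  cases L with
  | nil => simp [reduceCons]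
  | cons b t =>
    rw [reduceCons]
    split_ifs with hab
    · exact h.tail
    · exact List.IsChain.cons_cons hab h

theorem reduceCons_reduceCons {a : ι} {L : List ι} (h : L.IsChain (· ≠ ·)) :
    reduceCons a (reduceCons a L) = L := by
  cases L with
  | nil => simp [reduceCons]
  | cons b t =>
    rw [reduceCons]
    split_ifs with hab
    · subst hab
      cases t with
      | nil => rfl
      | cons c t =>
        have : a ≠ c := by
          rw [List.isChain_cons_cons] at h
          exact h.1
        rw [reduceCons, if_neg this]
    · rw [reduceCons, if_pos rfl]

/-- Each cancellation made by the reduction leaves a square, which commutes with all letters and is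
pushed to the right end. The list K collects the cancelled letters; each of them accounts for two
occurrences. -/
theorem exists_word_eq_reduceWord_mul_squares {M : Type*} [Monoid M] {x : ι → M}
    (hx : ∀ a b, x a * x a * x b = x b * (x a * x a)) (L : List ι) :
    ∃ K : List ι, (L.map x).prod =
        ((reduceWord L).map x).prod * (K.map fun a => x a * x a).prod ∧
      ∀ a, L.count a = (reduceWord L).count a + 2 * K.count a := by
  have hcomm : ∀ a (T : List ι), x a * x a * (T.map x).prod = (T.map x).prod * (x a * x a) := by
    intro a T
    have : Commute (x a * x a) (T.map x).prod := by
      refine Commute.list_prod_right _ _ fun y hy => ?_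
      obtain ⟨b, -, rfl⟩ := List.mem_map.1 hy
      exact hx a b
    exact this
  induction L with
  | nil => exact ⟨[], by simp [reduceWord], by simp [reduceWord]⟩
  | cons a L ih =>
    obtain ⟨K, hK, hc⟩ := ih
    rw [reduceWord_cons]
    rcases hr : reduceWord L with _ | ⟨b, t⟩
    · rw [hr] at hK hc
      refine ⟨K, by simp [reduceCons, hK], fun c => ?_⟩
      rw [List.count_cons, hc, reduceCons, List.count_cons]
      ring
    · rw [hr] at hK hc
      rw [reduceCons]
      split_ifs with hab
      · subst hab
        refine ⟨a :: K, ?_, fun c => ?_⟩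
        · rw [List.map_cons, List.prod_cons, hK, List.map_cons, List.prod_cons, List.map_cons,
            List.prod_cons]
          calc x a * (x a * (t.map x).prod * (K.map fun a => x a * x a).prod)
              = x a * x a * (t.map x).prod * (K.map fun a => x a * x a).prod := by
                simp only [mul_assoc]
            _ = _ := by rw [hcomm]; simp only [mul_assoc]
        · rw [List.count_cons, hc, List.count_cons, List.count_cons]
          ring
      · refine ⟨K, by simp [hK, mul_assoc], fun c => ?_⟩
        rw [List.count_cons, hc, List.count_cons (b := a)]
        ring

/-- The letter counts fix the multiset of the extracted squares, and squares commute with each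
other. -/
theorem word_eq_of_reduceWord_eq {M : Type*} [Monoid M] {x : ι → M}
    (hx : ∀ a b, x a * x a * x b = x b * (x a * x a)) {L L' : List ι}
    (hr : reduceWord L = reduceWord L') (hc : ∀ a, L.count a = L'.count a) :
    (L.map x).prod = (L'.map x).prod := by
  obtain ⟨K, hK, hKc⟩ := exists_word_eq_reduceWord_mul_squares hx L
  obtain ⟨K', hK', hKc'⟩ := exists_word_eq_reduceWord_mul_squares hx L'
  have hp : K.Perm K' := by
    rw [List.perm_iff_count]
    intro a
    have := hKc a
    have := hKc' a
    have := hc a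
    rw [hr] at *
    omega
  rw [hK, hK', hr]
  congr 1
  refine (hp.map _).prod_eq' ?_
  rw [List.pairwise_map]
  refine List.pairwise_of_forall fun a b => ?_
  have h : Commute (x a * x a) (x b) := hx a b
  exact h.mul_right h

mutual
/-- The letters of a word at the positions `0, 2, 4, …`. -/
def evenLetters {ι : Type*} : List ι → Multiset ι
  | [] => 0
  | a :: L => a ::ₘ oddLetters L
/-- The letters of a word at the positions `1, 3, 5, …`. -/
def oddLetters {ι : Type*} : List ι → Multiset ι
  | [] => 0
  | _ :: L => evenLetters L
end

/-- Exchanging the outer letters of a triple moves them by two places, so a letter at an even place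
can be brought to the front with all parities preserved. Removing the first letter then exchanges
the parities, which is why `oddLetters` and `evenLetters` of L' appear crossed. -/
theorem exists_word_eq_cons {M : Type*} [Monoid M] {x : ι → M}
    (hx : ∀ a b c, x a * x b * x c = x c * x b * x a) (a : ι) : ∀ L : List ι, a ∈ evenLetters L →
    ∃ L' : List ι, (L.map x).prod = x a * (L'.map x).prod ∧
      evenLetters L = a ::ₘ oddLetters L' ∧ oddLetters L = evenLetters L'
  | [], h => by simp [evenLetters] at h
  | [b], h => by
    have : a = b := by simpa [evenLetters, oddLetters] using h
    subst this
    exact ⟨[], by simp, by simp [evenLetters, oddLetters], by simp [evenLetters, oddLetters]⟩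
  | b :: c :: L, h => by
    by_cases hab : a = b
    · subst hab
      exact ⟨c :: L, by simp, by simp [evenLetters, oddLetters], by simp [oddLetters]⟩
    · have h' : a ∈ evenLetters L := by simpa [evenLetters, oddLetters, hab] using h
      obtain ⟨L', h1, h2, h3⟩ := exists_word_eq_cons hx a L h'
      refine ⟨c :: b :: L', ?_, ?_, ?_⟩
      · simp only [List.map_cons, List.prod_cons, h1]
        rw [← mul_assoc, ← mul_assoc, hx]
        simp only [mul_assoc]
      · simp only [evenLetters, oddLetters, h2]
        exact Multiset.cons_swap _ _ _
      · simp only [evenLetters, oddLetters, h3]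

theorem word_eq_of_evenLetters_eq {M : Type*} [Monoid M] {x : ι → M}
    (hx : ∀ a b c, x a * x b * x c = x c * x b * x a) : ∀ L L' : List ι,
    evenLetters L = evenLetters L' → oddLetters L = oddLetters L' →
    (L.map x).prod = (L'.map x).prod
  | [], [], _, _ => rfl
  | [], _ :: _, h, _ => by simp [evenLetters] at h
  | a :: L, L', h, h' => by
    obtain ⟨L'', h1, h2, h3⟩ := exists_word_eq_cons hx a L' (by rw [← h]; simp [evenLetters])
    rw [h1, List.map_cons, List.prod_cons]
    congr 1
    rw [h2] at h
    rw [h3] at h'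
    exact word_eq_of_evenLetters_eq hx L L'' (by simpa [oddLetters] using h')
      (by simpa [evenLetters] using h)

theorem count_eq_count_evenLetters_add (a : ι) (L : List ι) :
    L.count a = (evenLetters L).count a + (oddLetters L).count a := by
  induction L with
  | nil => simp [evenLetters, oddLetters]
  | cons b L ih =>
    rw [List.count_cons, ih]
    simp only [evenLetters, oddLetters, Multiset.count_cons]
    by_cases h : a = b
    · subst h; simp; ring
    · simp [h, Ne.symm h]; ring

end words

/-! ### Vertical partitions -/

/-- Fitting indices colour the blocks, and the positions coloured `a` form a union of blocks, each
with as many upper as lower legs. -/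
theorem RowPartition.IsVert.count_eq {α : Type*} [DecidableEq α] {k l : ℕ} {π : RowPartition k l}
    (hπ : π.IsVert) {i : Fin k → α} {j : Fin l → α} (h : π.Fits i j) (a : α) :
    (List.ofFn i).count a = (List.ofFn j).count a := by
  classical
  have hcount : ∀ {m : ℕ} (f : Fin m → α),
      (List.ofFn f).count a = (Finset.univ.filter fun r => f r = a).card := by
    intro m f
    rw [← Multiset.coe_count, ← Fin.univ_val_map, Multiset.count_map]
    simp only [eq_comm (a := a)]
    rfl
  let g : Quotient π → α := Quotient.lift (Sum.elim i j) fun _ _ hpq => h hpq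
  have hi : ∀ r ∈ Finset.univ.filter (fun r => i r = a),
      (Quotient.mk π (Sum.inl r)) ∈ Finset.univ.filter (fun q => g q = a) := fun r hr =>
    Finset.mem_filter.2 ⟨Finset.mem_univ _, (Finset.mem_filter.1 hr).2⟩
  have hj : ∀ r ∈ Finset.univ.filter (fun r => j r = a),
      (Quotient.mk π (Sum.inr r)) ∈ Finset.univ.filter (fun q => g q = a) := fun r hr =>
    Finset.mem_filter.2 ⟨Finset.mem_univ _, (Finset.mem_filter.1 hr).2⟩
  rw [hcount, hcount, Finset.card_eq_sum_card_fiberwise hi, Finset.card_eq_sum_card_fiberwise hj]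
  refine Finset.sum_congr rfl fun q hq => ?_
  induction q using Quotient.inductionOn with
  | h p =>
    have hp : Sum.elim i j p = a := (Finset.mem_filter.1 hq).2
    have h2 := hπ p
    rw [Nat.card_eq_fintype_card, Nat.card_eq_fintype_card, Fintype.card_subtype,
      Fintype.card_subtype] at h2
    rw [Finset.filter_filter, Finset.filter_filter]
    convert h2 using 2
    · ext r
      simp only [Finset.mem_filter, Finset.mem_univ, true_and, Quotient.eq]
      exact ⟨fun h => h.2, fun h' => ⟨(show Sum.elim i j (Sum.inl r) = _ from h h').trans hp, h'⟩⟩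
    · ext r
      simp only [Finset.mem_filter, Finset.mem_univ, true_and, Quotient.eq]
      exact ⟨fun h => h.2, fun h' => ⟨(show Sum.elim i j (Sum.inr r) = _ from h h').trans hp, h'⟩⟩

/-! ### The reflection groups -/

/-- A morphism from `ℤ₂` to a group containing an involution. -/
theorem exists_hom_zmod_two {G : Type*} [Group G] (s : G) (hs : s * s = 1) :
    ∃ φ : Multiplicative (ZMod 2) →* G, φ (Multiplicative.ofAdd 1) = s := by
  have h01 : ∀ x : ZMod 2, x = 0 ∨ x = 1 := by decide
  refine ⟨MonoidHom.mk' (fun z => if z.toAdd = 0 then 1 else s) fun x y => ?_, by simp⟩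
  rcases h01 x.toAdd with hx | hx <;> rcases h01 y.toAdd with hy | hy <;>
    simp [toAdd_mul, hx, hy, hs, CharTwo.add_self_eq_zero]

theorem Z2Free.exists_lift {N : ℕ} {G : Type*} [Group G] (s : Fin N → G)
    (hs : ∀ i, s i * s i = 1) : ∃ φ : Z2Free N →* G, ∀ i, φ (Z2Free.gen N i) = s i := by
  choose φ hφ using fun i => exists_hom_zmod_two (s i) (hs i)
  exact ⟨Monoid.CoprodI.lift φ, fun i => by rw [Z2Free.gen, Monoid.CoprodI.lift_of, hφ]⟩

theorem Z2Free.gen_mul_gen {N : ℕ} (i : Fin N) : Z2Free.gen N i * Z2Free.gen N i = 1 := by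
  rw [Z2Free.gen, ← map_mul]
  exact map_one _

/-- Van der Waerden's argument: the maps `reduceCons a` are involutions of the set of reduced words,
so the free product acts on it, and a word applied to the empty word returns its reduced form. -/
theorem Z2Free.reduceWord_eq {N : ℕ} {L L' : List (Fin N)}
    (h : (L.map (Z2Free.gen N)).prod = (L'.map (Z2Free.gen N)).prod) :
    reduceWord L = reduceWord L' := by
  let W := {L : List (Fin N) // L.IsChain (· ≠ ·)}
  let s : Fin N → Equiv.Perm W := fun a =>
    { toFun := fun w => ⟨reduceCons a w.1, isChain_reduceCons w.2⟩
      invFun := fun w => ⟨reduceCons a w.1, isChain_reduceCons w.2⟩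
      left_inv := fun w => Subtype.ext (reduceCons_reduceCons w.2)
      right_inv := fun w => Subtype.ext (reduceCons_reduceCons w.2) }
  obtain ⟨φ, hφ⟩ := Z2Free.exists_lift s fun i =>
    Equiv.ext fun w => Subtype.ext (reduceCons_reduceCons w.2)
  have key : ∀ L : List (Fin N),
      (φ (L.map (Z2Free.gen N)).prod ⟨[], List.isChain_nil⟩).1 = reduceWord L := by
    intro L
    induction L with
    | nil => simp [reduceWord]
    | cons a L ih =>
      rw [List.map_cons, List.prod_cons, map_mul, hφ, reduceWord_cons, ← ih]
      rfl
  rw [← key, ← key, h]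

theorem Z2Half.exists_lift {N : ℕ} {G : Type*} [Group G] (s : Fin N → G)
    (hs : ∀ i, s i * s i = 1) (hs' : ∀ i j k, s i * s j * s k = s k * s j * s i) :
    ∃ φ : Z2Half N →* G, ∀ i, φ (Z2Half.gen N i) = s i := by
  obtain ⟨φ, hφ⟩ := Z2Free.exists_lift s hs
  refine ⟨QuotientGroup.lift _ φ ?_, fun i => ?_⟩
  · have h : Subgroup.normalClosure {h : Z2Free N | ∃ i j k : Fin N,
        h = Z2Free.gen N i * Z2Free.gen N j * Z2Free.gen N k *
          (Z2Free.gen N k * Z2Free.gen N j * Z2Free.gen N i)⁻¹} ≤ φ.ker := by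
      refine Subgroup.normalClosure_le_normal ?_
      rintro _ ⟨i, j, k, rfl⟩
      rw [SetLike.mem_coe, MonoidHom.mem_ker, map_mul, map_inv, mul_inv_eq_one]
      simp only [map_mul, hφ, hs']
    exact fun x hx => h hx
  · exact hφ i

theorem Z2Half.gen_mul_gen_mul_gen {N : ℕ} (i j k : Fin N) :
    Z2Half.gen N i * Z2Half.gen N j * Z2Half.gen N k =
      Z2Half.gen N k * Z2Half.gen N j * Z2Half.gen N i := by
  rw [← mul_inv_eq_one]
  exact (QuotientGroup.eq_one_iff _).2 (Subgroup.subset_normalClosure ⟨i, j, k, rfl⟩)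

/-- The generators act on ℤ^N by the point reflections v ↦ e_i - v. Three of them compose to v ↦ e_i
- e_j + e_k - v, symmetric in i and k, so the defining relations hold. The image of 0 is the
alternating count of the letters. -/
theorem Z2Half.count_evenLetters_sub_eq {N : ℕ} {L L' : List (Fin N)}
    (h : (L.map (Z2Half.gen N)).prod = (L'.map (Z2Half.gen N)).prod) (a : Fin N) :
    ((evenLetters L).count a : ℤ) - (oddLetters L).count a =
      (evenLetters L').count a - (oddLetters L').count a := by
  let s : Fin N → Equiv.Perm (Fin N → ℤ) := fun i => Equiv.subLeft (Pi.single i 1)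
  obtain ⟨φ, hφ⟩ := Z2Half.exists_lift s
    (fun i => Equiv.ext fun v => by simp [s])
    (fun i j k => Equiv.ext fun v => by simp [s]; abel)
  have key : ∀ L : List (Fin N), φ (L.map (Z2Half.gen N)).prod 0 a =
      ((evenLetters L).count a : ℤ) - (oddLetters L).count a := by
    intro L
    induction L with
    | nil => simp [evenLetters, oddLetters]
    | cons b L ih =>
      rw [List.map_cons, List.prod_cons, map_mul, hφ]
      change (Pi.single b 1 - φ (L.map (Z2Half.gen N)).prod 0 : Fin N → ℤ) a = _
      rw [Pi.sub_apply, ih]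
      simp only [evenLetters, oddLetters, Multiset.count_cons, Pi.single_apply]
      push_cast
      ring
  rw [← key, ← key, h]

/-! ### Partitions and indices fitting them -/

theorem Setoid.map_le_iff {α β : Type*} {r : Setoid α} {f : α → β} {s : Setoid β} :
    r.map f ≤ s ↔ r ≤ s.comap f :=
  ⟨fun h => Setoid.le_comap_map.trans fun _ _ hxy => h hxy, fun h => by
    refine Setoid.eqvGen_le ?_
    rintro _ _ ⟨x, y, hxy, rfl, rfl⟩
    exact h hxy⟩

theorem List.prod_ofFn_add {M : Type*} [Monoid M] {k l : ℕ} (f : Fin (k + l) → M) :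
    (List.ofFn f).prod =
      (List.ofFn (f ∘ Fin.castAdd l)).prod * (List.ofFn (f ∘ Fin.natAdd k)).prod := by
  rw [← List.prod_append, ← List.ofFn_fin_append]
  congr 2
  exact (Fin.append_castAdd_natAdd).symm

namespace RowPartition

variable {α : Type*} {k l m k' l' : ℕ}

theorem fits_tensor {π : RowPartition k l} {σ : RowPartition k' l'} {i : Fin (k + k') → α}
    {j : Fin (l + l') → α} : (π.tensor σ).Fits i j ↔
      π.Fits (i ∘ Fin.castAdd k') (j ∘ Fin.castAdd l') ∧
        σ.Fits (i ∘ Fin.natAdd k) (j ∘ Fin.natAdd l) := by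
  have h1 : ∀ (f : Fin k → Fin (k + k')) (g : Fin l → Fin (l + l')),
      Setoid.comap (Sum.map f g) (Setoid.ker (Sum.elim i j)) =
      Setoid.ker (Sum.elim (i ∘ f) (j ∘ g)) := fun f g => by
    ext p q; rcases p with p | p <;> rcases q with q | q <;> rfl
  have h2 : ∀ (f : Fin k' → Fin (k + k')) (g : Fin l' → Fin (l + l')),
      Setoid.comap (Sum.map f g) (Setoid.ker (Sum.elim i j)) =
      Setoid.ker (Sum.elim (i ∘ f) (j ∘ g)) := fun f g => by
    ext p q; rcases p with p | p <;> rcases q with q | q <;> rfl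
  rw [Fits, tensor, sup_le_iff, Setoid.map_le_iff, Setoid.map_le_iff, ker, h1, h2]
  rfl

theorem fits_flip {π : RowPartition k l} {i : Fin k → α} {j : Fin l → α} :
    π.flip.Fits j i ↔ π.Fits i j := by
  constructor
  · intro h p q hpq
    have := @h p.swap q.swap (by
      change π p.swap.swap q.swap.swap
      rwa [Sum.swap_swap, Sum.swap_swap])
    rcases p with p | p <;> rcases q with q | q <;> exact this
  · intro h p q hpq
    have := @h p.swap q.swap hpq
    rcases p with p | p <;> rcases q with q | q <;> exact this

/-- The partition of three rows obtained by drawing `π` above `σ`. -/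
@[reducible]
def stack (π : RowPartition k l) (σ : RowPartition l m) : Setoid (Fin k ⊕ (Fin l ⊕ Fin m)) :=
  π.map (Sum.map id Sum.inl) ⊔ σ.map Sum.inr

theorem stack_le_ker {π : RowPartition k l} {σ : RowPartition l m}
    {h : Fin k ⊕ (Fin l ⊕ Fin m) → α} : stack π σ ≤ Setoid.ker h ↔
      π.Fits (h ∘ Sum.inl) (h ∘ Sum.inr ∘ Sum.inl) ∧
        σ.Fits (h ∘ Sum.inr ∘ Sum.inl) (h ∘ Sum.inr ∘ Sum.inr) := by
  rw [stack, sup_le_iff, Setoid.map_le_iff, Setoid.map_le_iff]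
  refine and_congr (iff_of_eq ?_) (iff_of_eq ?_) <;> rw [Fits, ker] <;> congr 1 <;> ext p q <;>
    rcases p with p | p <;> rcases q with q | q <;> rfl

/-- The inclusion of the outer rows. -/
def outer : Fin k ⊕ Fin m → Fin k ⊕ (Fin l ⊕ Fin m) := Sum.map id Sum.inr

theorem fits_comp_of_fits {π : RowPartition k l} {σ : RowPartition l m} {i : Fin k → α}
    {j : Fin l → α} {n : Fin m → α} (h : π.Fits i j) (h' : σ.Fits j n) :
    (π.comp σ).Fits i n := by
  have hle : stack π σ ≤ Setoid.ker (Sum.elim i (Sum.elim j n)) := stack_le_ker.2 ⟨h, h'⟩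
  intro p q hpq
  have := hle hpq
  rcases p with p | p <;> rcases q with q | q <;> exact this

/-- A middle block connected to an outer row has its index forced, consistently since the
composition fits. A block confined to the middle row can take any value, whence the nonemptiness of
`α`. -/
theorem exists_fits_of_fits_comp [Nonempty α] {π : RowPartition k l} {σ : RowPartition l m}
    {i : Fin k → α} {n : Fin m → α} (h : (π.comp σ).Fits i n) :
    ∃ j : Fin l → α, π.Fits i j ∧ σ.Fits j n := by
  classical
  let f : Fin k ⊕ (Fin l ⊕ Fin m) → α := fun p =>
    if hp : ∃ q : Fin k ⊕ Fin m, stack π σ (outer q) p then Sum.elim i n hp.choose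
    else Classical.arbitrary α
  have hf : ∀ p q, stack π σ (outer q) p → f p = Sum.elim i n q := by
    intro p q hpq
    have hp : ∃ q : Fin k ⊕ Fin m, stack π σ (outer q) p := ⟨q, hpq⟩
    have h1 : f p = Sum.elim i n hp.choose := dif_pos hp
    rw [h1]
    exact h ((stack π σ).trans hp.choose_spec ((stack π σ).symm hpq))
  have hle : stack π σ ≤ Setoid.ker f := by
    intro p q hpq
    by_cases hp : ∃ o : Fin k ⊕ Fin m, stack π σ (outer o) p
    · obtain ⟨o, ho⟩ := hp
      change f p = f q
      rw [hf p o ho, hf q o ((stack π σ).trans ho hpq)]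
    · have hq : ¬ ∃ o : Fin k ⊕ Fin m, stack π σ (outer o) q := fun ⟨o, ho⟩ =>
        hp ⟨o, (stack π σ).trans ho ((stack π σ).symm hpq)⟩
      change f p = f q
      simp only [f, dif_neg hp, dif_neg hq]
  have h1 : f ∘ Sum.inl = i := funext fun r => hf _ (Sum.inl r) ((stack π σ).refl _)
  have h2 : f ∘ Sum.inr ∘ Sum.inr = n := funext fun r => hf _ (Sum.inr r) ((stack π σ).refl _)
  have := stack_le_ker.1 hle
  rw [h1, h2] at this
  exact ⟨_, this⟩

open Classical in
/-- The indices of the middle row which fit two partitions drawn above each other. -/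
def middle [Fintype α] (π : RowPartition k l) (σ : RowPartition l m) (i : Fin k → α)
    (n : Fin m → α) : Finset (Fin l → α) :=
  Finset.univ.filter fun j => π.Fits i j ∧ σ.Fits j n

theorem mem_middle [Fintype α] {π : RowPartition k l} {σ : RowPartition l m} {i : Fin k → α}
    {n : Fin m → α} {j : Fin l → α} : j ∈ middle π σ i n ↔ π.Fits i j ∧ σ.Fits j n := by
  simp [middle]

/-- The blocks confined to the middle row are the only freedom, so the count does not depend on the
fitting outer indices. The injection keeps the values on those blocks and replaces all others by
those of one solution `j₀`; the inequality is later used in both directions. -/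
theorem card_middle_le [Fintype α] [Nonempty α] (π : RowPartition k l) (σ : RowPartition l m)
    {i i' : Fin k → α} {n n' : Fin m → α} (h' : (π.comp σ).Fits i' n') :
    (middle π σ i n).card ≤ (middle π σ i' n').card := by
  classical
  obtain ⟨j₀, hj₀⟩ := exists_fits_of_fits_comp h'
  let touched : Fin k ⊕ (Fin l ⊕ Fin m) → Prop := fun p => ∃ q, stack π σ (outer q) p
  have ht : ∀ p q, stack π σ p q → (touched p ↔ touched q) := fun p q hpq =>
    ⟨fun ⟨o, ho⟩ => ⟨o, (stack π σ).trans ho hpq⟩,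
      fun ⟨o, ho⟩ => ⟨o, (stack π σ).trans ho ((stack π σ).symm hpq)⟩⟩
  refine Finset.card_le_card_of_injOn
    (fun j b => if touched (Sum.inr (Sum.inl b)) then j₀ b else j b) ?_ ?_
  · intro j hj
    have hj := mem_middle.1 hj
    let g : Fin k ⊕ (Fin l ⊕ Fin m) → α := Sum.elim i' (Sum.elim j₀ n')
    let g' : Fin k ⊕ (Fin l ⊕ Fin m) → α := Sum.elim i (Sum.elim j n)
    have hg : stack π σ ≤ Setoid.ker g := stack_le_ker.2 hj₀
    have hg' : stack π σ ≤ Setoid.ker g' := stack_le_ker.2 hj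
    let f : Fin k ⊕ (Fin l ⊕ Fin m) → α := fun p => if touched p then g p else g' p
    have hf : stack π σ ≤ Setoid.ker f := by
      intro p q hpq
      change f p = f q
      by_cases hp : touched p
      · simp only [f, if_pos hp, if_pos ((ht p q hpq).1 hp)]
        exact hg hpq
      · simp only [f, if_neg hp, if_neg (fun hq => hp ((ht p q hpq).2 hq))]
        exact hg' hpq
    have h1 : f ∘ Sum.inl = i' := funext fun r => if_pos ⟨Sum.inl r, (stack π σ).refl _⟩
    have h2 : f ∘ Sum.inr ∘ Sum.inr = n' :=
      funext fun r => if_pos ⟨Sum.inr r, (stack π σ).refl _⟩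
    have := stack_le_ker.1 hf
    rw [h1, h2] at this
    exact mem_middle.2 this
  · intro j₁ hj₁ j₂ hj₂ h
    have hj₁ := mem_middle.1 hj₁
    have hj₂ := mem_middle.1 hj₂
    funext b
    by_cases hb : touched (Sum.inr (Sum.inl b))
    · obtain ⟨q, hq⟩ := hb
      have e : ∀ j : Fin l → α, π.Fits i j ∧ σ.Fits j n → j b = Sum.elim i n q := fun j hj => by
        have h1 : stack π σ ≤ Setoid.ker (Sum.elim i (Sum.elim j n)) := stack_le_ker.2 hj
        have h2 := (stack π σ).symm hq
        rcases q with q | q <;> exact h1 h2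
      rw [e j₁ hj₁, e j₂ hj₂]
    · have := congrFun h b
      simpa only [if_neg hb] using this

theorem fits_eta {i j : Fin 3 → α} :
    eta.Fits i j ↔ i 0 = i 1 ∧ i 0 = j 1 ∧ i 0 = j 2 ∧ i 2 = j 0 := by
  constructor
  · intro h
    exact ⟨@h (Sum.inl 0) (Sum.inl 1) rfl, @h (Sum.inl 0) (Sum.inr 1) rfl,
      @h (Sum.inl 0) (Sum.inr 2) rfl, @h (Sum.inl 2) (Sum.inr 0) rfl⟩
  · rintro ⟨h1, h2, h3, h4⟩ p q hpq
    change Sum.elim i j p = Sum.elim i j q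
    have hpq : (Sum.elim ![0, 0, 1] ![1, 0, 0] p : ℕ) = Sum.elim ![0, 0, 1] ![1, 0, 0] q := hpq
    rcases p with p | p <;> rcases q with q | q <;> fin_cases p <;> fin_cases q <;>
      simp_all

theorem isVert_eta : eta.IsVert := by
  intro p
  have h1 : Fintype.card {a : Fin 3 // (![0, 0, 1] a : ℕ) =
      Sum.elim ![0, 0, 1] ![1, 0, 0] p} = Fintype.card {b : Fin 3 // (![1, 0, 0] b : ℕ) =
      Sum.elim ![0, 0, 1] ![1, 0, 0] p} := by
    revert p; decide
  rw [← Nat.card_eq_fintype_card, ← Nat.card_eq_fintype_card] at h1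
  exact h1

end RowPartition

/-- Composition uses that the relation of a composed partition factors through a middle word; the
relation of `∩` is that the generators are involutions. -/
theorem isPartitionCategory_groupPartitions {N : ℕ} [NeZero N] {Γ : Type*} [Group Γ]
    {g : Fin N → Γ} (hg : ∀ a, g a * g a = 1) : IsPartitionCategory (groupPartitions g) where
  tensor_mem {k l k' l' π σ} hπ hσ i j h := by
    obtain ⟨h1, h2⟩ := RowPartition.fits_tensor.1 h
    rw [List.prod_ofFn_add, List.prod_ofFn_add]
    exact congrArg₂ (· * ·) (hπ _ _ h1) (hσ _ _ h2)
  comp_mem {k l m π σ} hπ hσ i j h := by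
    obtain ⟨n, h1, h2⟩ := RowPartition.exists_fits_of_fits_comp h
    exact (hπ _ _ h1).trans (hσ _ _ h2)
  flip_mem {k l π} hπ i j h := (hπ _ _ (RowPartition.fits_flip.1 h)).symm
  id_mem i j h := by
    have : i 0 = j 0 := @h (Sum.inl 0) (Sum.inr 0) trivial
    simp [this]
  cap_mem i j h := by
    have : j 0 = j 1 := @h (Sum.inr 0) (Sum.inr 1) trivial
    simp [List.ofFn_succ, this, hg]

theorem eta_mem_groupPartitions {N : ℕ} {Γ : Type*} [Group Γ] {g : Fin N → Γ}
    (hg : ∀ a, g a * g a = 1) : RowPartition.eta ∈ groupPartitions g 3 3 := by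
  intro i j h
  obtain ⟨h1, h2, h3, h4⟩ := RowPartition.fits_eta.1 h
  simp [List.ofFn_succ, ← h1, ← h2, ← h3, h4, hg, ← mul_assoc]

/-! ### Intertwiners -/

section intertwiners

variable {N : ℕ} {B : Type*} [Ring B]

/-- The matrix `u^{⊗k}`, for a matrix `u` over a ring. -/
def wordMatrix (u : Fin N × Fin N → B) (k : ℕ) : Matrix (Fin k → Fin N) (Fin k → Fin N) B :=
  fun i j => (List.ofFn fun r => u (i r, j r)).prod

open Classical in
variable (N B) in
/-- The matrix of `T_π`, over a ring. -/
def fitMatrix {k l : ℕ} (π : RowPartition k l) : Matrix (Fin l → Fin N) (Fin k → Fin N) B :=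
  fun j i => if π.Fits i j then 1 else 0

/-- The relation `T_π u^{⊗k} = u^{⊗l} T_π`. -/
def Intertwines (u : Fin N × Fin N → B) {k l : ℕ} (π : RowPartition k l) : Prop :=
  fitMatrix N B π * wordMatrix u k = wordMatrix u l * fitMatrix N B π

theorem intertwines_iff_eval [StarRing B] [Algebra ℂ B] [StarModule ℂ B]
    {u : Fin N × Fin N → B} (hu : ∀ p, star (u p) = u p) {k l : ℕ} {π : RowPartition k l} :
    Intertwines u π ↔ ∀ f ∈ intertwinerRel N π, NCPoly.eval u hu f = 0 := by
  have key : ∀ j i, NCPoly.eval u hu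
      ((partitionMap N π * tensorPower N k - tensorPower N l * partitionMap N π) j i) =
      (fitMatrix N B π * wordMatrix u k) j i - (wordMatrix u l * fitMatrix N B π) j i := by
    intro j i
    rw [Matrix.sub_apply, map_sub, Matrix.mul_apply, Matrix.mul_apply, map_sum, map_sum,
      Matrix.mul_apply, Matrix.mul_apply]
    simp only [map_mul, partitionMap, tensorPower, NCPoly.eval_word, apply_ite (NCPoly.eval u hu),
      map_one, map_zero]
    rfl
  constructor
  · rintro h _ ⟨j, i, rfl⟩
    rw [key, h, sub_self]
  · intro h
    ext j i
    rw [← sub_eq_zero, ← key]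
    exact h _ ⟨j, i, rfl⟩

theorem fitMatrix_commute {k l : ℕ} (π : RowPartition k l) (j i) (b : B) :
    Commute (fitMatrix N B π j i) b := by
  rw [fitMatrix]
  split_ifs
  · exact Commute.one_left b
  · exact Commute.zero_left b

theorem fitMatrix_tensor {k l k' l' : ℕ} (π : RowPartition k l) (σ : RowPartition k' l')
    (j : Fin l → Fin N) (j' : Fin l' → Fin N) (i : Fin k → Fin N) (i' : Fin k' → Fin N) :
    fitMatrix N B (π.tensor σ) (Fin.append j j') (Fin.append i i') =
      fitMatrix N B π j i * fitMatrix N B σ j' i' := by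
  have h : (π.tensor σ).Fits (Fin.append i i') (Fin.append j j') ↔ π.Fits i j ∧ σ.Fits i' j' := by
    rw [RowPartition.fits_tensor]
    have e1 : ∀ {a b : ℕ} (f : Fin a → Fin N) (g : Fin b → Fin N),
        Fin.append f g ∘ Fin.castAdd b = f := fun f g => funext fun r => Fin.append_left f g r
    have e2 : ∀ {a b : ℕ} (f : Fin a → Fin N) (g : Fin b → Fin N),
        Fin.append f g ∘ Fin.natAdd a = g := fun f g => funext fun r => Fin.append_right f g r
    rw [e1, e1, e2, e2]
  simp only [fitMatrix, h]
  split_ifs <;> simp_all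

theorem wordMatrix_append (u : Fin N × Fin N → B) {k k' : ℕ} (i j : Fin k → Fin N)
    (i' j' : Fin k' → Fin N) : wordMatrix u (k + k') (Fin.append i i') (Fin.append j j') =
      wordMatrix u k i j * wordMatrix u k' i' j' := by
  simp only [wordMatrix]
  rw [List.prod_ofFn_add]
  congr 3
  · funext r; simp
  · funext r; simp

theorem Intertwines.tensor {u : Fin N × Fin N → B} {k l k' l' : ℕ} {π : RowPartition k l}
    {σ : RowPartition k' l'} (hπ : Intertwines u π) (hσ : Intertwines u σ) :
    Intertwines u (π.tensor σ) := by
  have hs : ∀ (a b : ℕ) (f : (Fin (a + b) → Fin N) → B),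
      ∑ m, f m = ∑ m, ∑ m', f (Fin.append m m') := fun a b f => by
    rw [← Fintype.sum_prod_type', ← (Fin.appendEquiv a b).sum_comp]
    rfl
  ext J I
  obtain ⟨⟨j, j'⟩, rfl⟩ := (Fin.appendEquiv l l').surjective J
  obtain ⟨⟨i, i'⟩, rfl⟩ := (Fin.appendEquiv k k').surjective I
  change (_ : Matrix _ _ B) (Fin.append j j') (Fin.append i i') =
    (_ : Matrix _ _ B) (Fin.append j j') (Fin.append i i')
  rw [Matrix.mul_apply, Matrix.mul_apply, hs, hs]
  simp only [fitMatrix_tensor, wordMatrix_append]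
  have h1 := congrFun (congrFun hπ j) i
  have h2 := congrFun (congrFun hσ j') i'
  rw [Matrix.mul_apply, Matrix.mul_apply] at h1 h2
  trans (∑ m, fitMatrix N B π j m * wordMatrix u k m i) *
    (∑ m', fitMatrix N B σ j' m' * wordMatrix u k' m' i')
  · rw [Finset.sum_mul_sum]
    refine Finset.sum_congr rfl fun m _ => Finset.sum_congr rfl fun m' _ => ?_
    rw [mul_assoc, mul_assoc, ← mul_assoc (fitMatrix N B σ j' m'), (fitMatrix_commute σ j' m' _).eq,
      mul_assoc]
  · rw [h1, h2, Finset.sum_mul_sum]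
    refine Finset.sum_congr rfl fun m _ => Finset.sum_congr rfl fun m' _ => ?_
    rw [mul_assoc, mul_assoc, ← mul_assoc (fitMatrix N B π m i), (fitMatrix_commute π m i _).eq,
      mul_assoc]

/-- The entries count middle rows. Constant outer indices fit every partition, so they serve as
reference for the constant, which is nonzero and can therefore be divided out in `Intertwines.comp`.
-/
theorem fitMatrix_mul_fitMatrix [NeZero N] {k l m : ℕ} (π : RowPartition k l)
    (σ : RowPartition l m) : ∃ c : ℕ, c ≠ 0 ∧
      fitMatrix N B σ * fitMatrix N B π = c • fitMatrix N B (π.comp σ) := by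
  have hentry : ∀ n i, (fitMatrix N B σ * fitMatrix N B π) n i =
      ((RowPartition.middle π σ i n).card : B) := by
    intro n i
    rw [Matrix.mul_apply, RowPartition.middle, Finset.natCast_card_filter]
    refine Finset.sum_congr rfl fun j _ => ?_
    simp only [fitMatrix]
    split_ifs <;> simp_all
  have h0 : (π.comp σ).Fits (fun _ => (0 : Fin N)) (fun _ => 0) := by
    rintro (p | p) (q | q) - <;> rfl
  refine ⟨(RowPartition.middle π σ (fun _ => (0 : Fin N)) (fun _ => 0)).card, ?_, ?_⟩
  · obtain ⟨j, hj⟩ := RowPartition.exists_fits_of_fits_comp h0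
    exact Finset.card_ne_zero_of_mem (RowPartition.mem_middle.2 hj)
  · ext n i
    rw [hentry, Matrix.smul_apply, fitMatrix]
    split_ifs with h
    · rw [nsmul_one, le_antisymm (RowPartition.card_middle_le π σ h0)
        (RowPartition.card_middle_le π σ h)]
    · rw [smul_zero, Finset.card_eq_zero.2, Nat.cast_zero]
      refine Finset.eq_empty_of_forall_notMem fun j hj => h ?_
      obtain ⟨h1, h2⟩ := RowPartition.mem_middle.1 hj
      exact RowPartition.fits_comp_of_fits h1 h2

theorem Intertwines.comp [NeZero N] [Algebra ℂ B] {u : Fin N × Fin N → B} {k l m : ℕ}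
    {π : RowPartition k l} {σ : RowPartition l m} (hπ : Intertwines u π) (hσ : Intertwines u σ) :
    Intertwines u (π.comp σ) := by
  obtain ⟨c, hc, h⟩ := fitMatrix_mul_fitMatrix (N := N) (B := B) π σ
  have h1 : c • (fitMatrix N B (π.comp σ) * wordMatrix u k) =
      c • (wordMatrix u m * fitMatrix N B (π.comp σ)) := by
    rw [← Matrix.smul_mul, ← Matrix.mul_smul, ← h, Matrix.mul_assoc, hπ, ← Matrix.mul_assoc, hσ,
      Matrix.mul_assoc]
  have h2 := congrArg (fun M => (c : ℂ)⁻¹ • M) h1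
  simpa only [Intertwines, ← Nat.cast_smul_eq_nsmul ℂ, inv_smul_smul₀ (Nat.cast_ne_zero.2 hc : (c : ℂ) ≠ 0)]
    using h2

end intertwiners

-- Orthogonal matrices and the relations of H_N^{[∞]}

section orthogonal

variable {N : ℕ} {B : Type*} [Ring B]

/-- The matrix `u` has self-adjoint entries and is orthogonal. -/
structure IsOrthogonalMatrix [StarRing B] (u : Fin N × Fin N → B) : Prop where
  star_eq : ∀ p, star (u p) = u p
  row : ∀ i j, ∑ k, u (i, k) * u (j, k) = if i = j then 1 else 0
  col : ∀ i j, ∑ k, u (k, i) * u (k, j) = if i = j then 1 else 0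

theorem wordMatrix_cons (u : Fin N × Fin N → B) {k : ℕ} (i j : Fin (k + 1) → Fin N) :
    wordMatrix u (k + 1) i j = u (i 0, j 0) * wordMatrix u k (Fin.tail i) (Fin.tail j) := by
  simp only [wordMatrix, List.ofFn_succ, List.prod_cons]
  rfl

theorem sum_fin_succ_fun {A : Type*} [AddCommMonoid A] {k : ℕ} (f : (Fin (k + 1) → Fin N) → A) :
    ∑ m, f m = ∑ a, ∑ m : Fin k → Fin N, f (Fin.cons a m) := by
  rw [← Fintype.sum_prod_type', ← (Fin.consEquiv fun _ => Fin N).sum_comp]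
  rfl

theorem eq_iff_zero_and_tail {α : Type*} {k : ℕ} {i j : Fin (k + 1) → α} :
    i = j ↔ i 0 = j 0 ∧ Fin.tail i = Fin.tail j := by
  constructor
  · rintro rfl; exact ⟨rfl, rfl⟩
  · rintro ⟨h1, h2⟩
    rw [← Fin.cons_self_tail i, ← Fin.cons_self_tail j, h1, h2]

/-- A row or column of the matrix of η has at most one nonzero entry, so both matrix products
collapse to a single monomial or to 0. -/
theorem intertwines_eta_iff {u : Fin N × Fin N → B} : Intertwines u RowPartition.eta ↔ ∀ i j : Fin 3 → Fin N,
    (if j 1 = j 2 then u (j 1, i 0) * (u (j 1, i 1) * u (j 0, i 2)) else 0) =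
      if i 0 = i 1 then u (j 0, i 2) * (u (j 1, i 0) * u (j 2, i 0)) else 0 := by
  have key : ∀ i j : Fin 3 → Fin N, (fitMatrix N B RowPartition.eta * wordMatrix u 3) j i =
      if j 1 = j 2 then u (j 1, i 0) * (u (j 1, i 1) * u (j 0, i 2)) else 0 := by
    intro i j
    rw [Matrix.mul_apply]
    split_ifs with h
    · rw [Finset.sum_eq_single ![j 1, j 1, j 0]]
      · have : RowPartition.eta.Fits ![j 1, j 1, j 0] j :=
          RowPartition.fits_eta.2 ⟨rfl, rfl, h, rfl⟩
        simp [fitMatrix, this, wordMatrix, List.ofFn_succ]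
      · intro m _ hm
        have : ¬ RowPartition.eta.Fits m j := fun hf => hm (by
          obtain ⟨h1, h2, h3, h4⟩ := RowPartition.fits_eta.1 hf
          funext r
          fin_cases r <;> simp_all)
        simp [fitMatrix, this]
      · simp
    · refine Finset.sum_eq_zero fun m _ => ?_
      have : ¬ RowPartition.eta.Fits m j := fun hf => by
        obtain ⟨h1, h2, h3, h4⟩ := RowPartition.fits_eta.1 hf
        exact h (h2.symm.trans h3)
      simp [fitMatrix, this]
  have key' : ∀ i j : Fin 3 → Fin N, (wordMatrix u 3 * fitMatrix N B RowPartition.eta) j i =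
      if i 0 = i 1 then u (j 0, i 2) * (u (j 1, i 0) * u (j 2, i 0)) else 0 := by
    intro i j
    rw [Matrix.mul_apply]
    split_ifs with h
    · rw [Finset.sum_eq_single ![i 2, i 0, i 0]]
      · have : RowPartition.eta.Fits i ![i 2, i 0, i 0] :=
          RowPartition.fits_eta.2 ⟨h, rfl, rfl, rfl⟩
        simp [fitMatrix, this, wordMatrix, List.ofFn_succ]
      · intro m _ hm
        have : ¬ RowPartition.eta.Fits i m := fun hf => hm (by
          obtain ⟨h1, h2, h3, h4⟩ := RowPartition.fits_eta.1 hf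
          funext r
          fin_cases r <;> simp_all)
        simp [fitMatrix, this]
      · simp
    · refine Finset.sum_eq_zero fun m _ => ?_
      have : ¬ RowPartition.eta.Fits i m := fun hf => by
        obtain ⟨h1, h2, h3, h4⟩ := RowPartition.fits_eta.1 hf
        exact h h1
      simp [fitMatrix, this]
  constructor
  · intro h i j
    rw [← key, ← key', h]
  · intro h
    change _ * _ = _ * _
    ext j i
    rw [key, key', h]

variable [StarRing B] {u : Fin N × Fin N → B}

theorem IsOrthogonalMatrix.wordMatrix_mul_conjTranspose (hu : IsOrthogonalMatrix u) (k : ℕ) :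
    wordMatrix u k * (wordMatrix u k).conjTranspose = 1 := by
  induction k with
  | zero =>
    ext i j
    simp [Matrix.mul_apply, Matrix.one_apply, wordMatrix, Subsingleton.elim i j]
  | succ k ih =>
    ext i j
    have h := congrFun (congrFun ih (Fin.tail i)) (Fin.tail j)
    simp only [Matrix.mul_apply, Matrix.conjTranspose_apply, Matrix.one_apply] at h ⊢
    rw [sum_fin_succ_fun]
    simp only [wordMatrix_cons, Fin.cons_zero, Fin.tail_cons, star_mul, hu.star_eq]
    have : ∀ a, ∑ m : Fin k → Fin N, u (i 0, a) * wordMatrix u k (Fin.tail i) m *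
        (star (wordMatrix u k (Fin.tail j) m) * u (j 0, a)) =
        u (i 0, a) * (if Fin.tail i = Fin.tail j then 1 else 0) * u (j 0, a) := fun a => by
      rw [← h, Finset.mul_sum, Finset.sum_mul]
      simp only [mul_assoc]
    simp only [this, eq_iff_zero_and_tail (i := i)]
    by_cases ht : Fin.tail i = Fin.tail j
    · simp [ht, hu.row]
    · simp [ht]

theorem IsOrthogonalMatrix.conjTranspose_mul_wordMatrix (hu : IsOrthogonalMatrix u) (k : ℕ) :
    (wordMatrix u k).conjTranspose * wordMatrix u k = 1 := by
  induction k with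
  | zero =>
    ext i j
    simp [Matrix.mul_apply, Matrix.one_apply, wordMatrix, Subsingleton.elim i j]
  | succ k ih =>
    ext i j
    have h := congrFun (congrFun ih (Fin.tail i)) (Fin.tail j)
    simp only [Matrix.mul_apply, Matrix.conjTranspose_apply, Matrix.one_apply] at h ⊢
    rw [sum_fin_succ_fun, Finset.sum_comm]
    simp only [wordMatrix_cons, Fin.cons_zero, Fin.tail_cons, star_mul, hu.star_eq]
    have : ∀ m : Fin k → Fin N, ∑ a, star (wordMatrix u k m (Fin.tail i)) * u (a, i 0) *
        (u (a, j 0) * wordMatrix u k m (Fin.tail j)) =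
        star (wordMatrix u k m (Fin.tail i)) * (if i 0 = j 0 then 1 else 0) *
          wordMatrix u k m (Fin.tail j) := fun m => by
      rw [← hu.col, Finset.mul_sum, Finset.sum_mul]
      simp only [mul_assoc]
    simp only [this, eq_iff_zero_and_tail (i := i)]
    by_cases ht : i 0 = j 0
    · simp [ht, h]
    · simp [ht]

theorem conjTranspose_fitMatrix {k l : ℕ} (π : RowPartition k l) :
    (fitMatrix N B π).conjTranspose = fitMatrix N B π.flip := by
  ext i j
  rw [Matrix.conjTranspose_apply, fitMatrix, fitMatrix]
  by_cases h : π.Fits i j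
  · rw [if_pos h, if_pos (RowPartition.fits_flip.2 h), star_one]
  · rw [if_neg h, if_neg (mt RowPartition.fits_flip.1 h), star_zero]

/-- The tensor powers of u are unitary, so the relation can be moved to their adjoints; taking
adjoints then turns T_π upside down. -/
theorem Intertwines.flip (hu : IsOrthogonalMatrix u) {k l : ℕ} {π : RowPartition k l}
    (h : Intertwines u π) : Intertwines u π.flip := by
  have h1 : (wordMatrix u l).conjTranspose * fitMatrix N B π =
      fitMatrix N B π * (wordMatrix u k).conjTranspose := by
    calc (wordMatrix u l).conjTranspose * fitMatrix N B π
        = (wordMatrix u l).conjTranspose * (fitMatrix N B π * wordMatrix u k) *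
            (wordMatrix u k).conjTranspose := by
          rw [Matrix.mul_assoc, Matrix.mul_assoc, hu.wordMatrix_mul_conjTranspose, Matrix.mul_one]
      _ = _ := by
          rw [h, ← Matrix.mul_assoc, hu.conjTranspose_mul_wordMatrix, Matrix.one_mul]
  have h2 := congrArg Matrix.conjTranspose h1
  rwa [Matrix.conjTranspose_mul, Matrix.conjTranspose_mul, Matrix.conjTranspose_conjTranspose,
    Matrix.conjTranspose_conjTranspose, conjTranspose_fitMatrix] at h2

theorem isPartitionCategory_intertwines [NeZero N] [Algebra ℂ B] (hu : IsOrthogonalMatrix u) :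
    IsPartitionCategory fun k l => {π : RowPartition k l | Intertwines u π} where
  tensor_mem hπ hσ := Intertwines.tensor hπ hσ
  comp_mem hπ hσ := Intertwines.comp hπ hσ
  flip_mem hπ := Intertwines.flip hu hπ
  id_mem := by
    have hfit : ∀ i j : Fin 1 → Fin N, (⊤ : RowPartition 1 1).Fits i j ↔ i = j := by
      intro i j
      constructor
      · intro h
        funext r
        rw [Subsingleton.elim r 0]
        exact @h (Sum.inl 0) (Sum.inr 0) trivial
      · rintro rfl p q -
        rcases p with p | p <;> rcases q with q | q <;> rw [Subsingleton.elim p q] <;> rfl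
    have : fitMatrix N B (⊤ : RowPartition 1 1) = 1 := by
      ext j i
      simp only [fitMatrix, hfit, Matrix.one_apply, eq_comm]
    change _ * _ = _ * _
    rw [this, Matrix.one_mul, Matrix.mul_one]
  cap_mem := by
    have hfit : ∀ (i : Fin 0 → Fin N) (j : Fin 2 → Fin N),
        (⊤ : RowPartition 0 2).Fits i j ↔ j 0 = j 1 := by
      intro i j
      constructor
      · intro h
        exact @h (Sum.inr 0) (Sum.inr 1) trivial
      · intro h p q _
        change Sum.elim i j p = Sum.elim i j q
        rcases p with p | p
        · exact p.elim0
        · rcases q with q | q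
          · exact q.elim0
          · fin_cases p <;> fin_cases q <;> simp [h]
    change _ * _ = _ * _
    ext j i
    rw [Matrix.mul_apply, Matrix.mul_apply, sum_fin_succ_fun]
    simp only [sum_fin_succ_fun, fitMatrix, hfit, wordMatrix, Fintype.sum_unique, List.ofFn_succ,
      List.ofFn_zero, List.prod_nil, List.prod_cons, mul_one, Fin.cons_zero, Fin.succ_zero_eq_one,
      Fin.cons_one, mul_ite, mul_zero, Finset.sum_ite_eq, Finset.mem_univ, if_true, hu.row]

/-- The relations of `H_N^{[∞]}`, for an orthogonal matrix. -/
structure IsPairPositioner (u : Fin N × Fin N → B) : Prop extends IsOrthogonalMatrix u where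
  row_mul : ∀ i a b, a ≠ b → u (i, a) * u (i, b) = 0
  col_mul : ∀ i j a, i ≠ j → u (i, a) * u (j, a) = 0
  central : ∀ p q, u p * u p * u q = u q * (u p * u p)

theorem IsPairPositioner.intertwines_eta (hu : IsPairPositioner u) :
    Intertwines u RowPartition.eta := by
  rw [intertwines_eta_iff]
  intro i j
  by_cases hj : j 1 = j 2 <;> by_cases hi : i 0 = i 1
  · rw [if_pos hj, if_pos hi, ← hi, ← hj, ← mul_assoc, hu.central]
  · rw [if_pos hj, if_neg hi, ← mul_assoc, hu.row_mul _ _ _ hi, zero_mul]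
  · rw [if_neg hj, if_pos hi, hu.col_mul _ _ _ hj, mul_zero]
  · rw [if_neg hj, if_neg hi]

/-- Indices for which only one side of the relation of η survives give vanishing cubic monomials,
such as u_ia u_ib u_ka = 0. A further factor u_ka and the sum over k, where ∑ u_ka² = 1, bring the
degree down to two. -/
theorem IsPairPositioner.of_intertwines (hu : IsOrthogonalMatrix u)
    (h : Intertwines u RowPartition.eta) : IsPairPositioner u := by
  rw [intertwines_eta_iff] at h
  refine ⟨hu, fun i a b hab => ?_, fun i j a hij => ?_, fun p q => ?_⟩
  · have h1 : ∀ k, u (i, a) * (u (i, b) * u (k, a)) = 0 := fun k => by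
      simpa [hab] using h ![a, b, a] ![k, i, i]
    calc u (i, a) * u (i, b) = u (i, a) * u (i, b) * ∑ k, u (k, a) * u (k, a) := by
          rw [hu.col, if_pos rfl, mul_one]
      _ = 0 := by
          rw [Finset.mul_sum]
          refine Finset.sum_eq_zero fun k _ => ?_
          rw [← mul_assoc, mul_assoc (u (i, a)), h1, zero_mul]
  · have h1 : ∀ k, u (k, a) * (u (i, a) * u (j, a)) = 0 := fun k => by
      simpa [hij] using (h ![a, a, a] ![k, i, j]).symm
    calc u (i, a) * u (j, a) = (∑ k, u (k, a) * u (k, a)) * (u (i, a) * u (j, a)) := by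
          rw [hu.col, if_pos rfl, one_mul]
      _ = 0 := by
          rw [Finset.sum_mul]
          refine Finset.sum_eq_zero fun k _ => ?_
          rw [mul_assoc, h1, mul_zero]
  · obtain ⟨i, a⟩ := p
    obtain ⟨k, c⟩ := q
    simpa [mul_assoc] using h ![a, a, c] ![k, i, i]

theorem IsPairPositioner.intertwines [NeZero N] [Algebra ℂ B] (hu : IsPairPositioner u) {k l : ℕ}
    {π : RowPartition k l} (hπ : π ∈ PevenInf k l) : Intertwines u π :=
  hπ _ (isPartitionCategory_intertwines hu.toIsOrthogonalMatrix) hu.intertwines_eta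

end orthogonal

theorem eta_mem_PevenInf : RowPartition.eta ∈ PevenInf 3 3 := fun _ _ h => h

/-! ### Evaluation of the defining relations -/

section relations

variable {N : ℕ} {B : Type*} [Ring B] [StarRing B] [Algebra ℂ B] [StarModule ℂ B]

theorem eval_sphereRel {x : Fin N → B} (hx : ∀ i, star (x i) = x i) :
    (∀ f ∈ sphereRel N, NCPoly.eval x hx f = 0) ↔ ∑ i, x i * x i = 1 := by
  simp [sphereRel, sub_eq_zero, sq]

theorem eval_partitionRel {x : Fin N → B} (hx : ∀ i, star (x i) = x i) {k l : ℕ}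
    {π : RowPartition k l} : (∀ f ∈ partitionRel N π, NCPoly.eval x hx f = 0) ↔
      ∀ i j, π.Fits i j → ((List.ofFn i).map x).prod = ((List.ofFn j).map x).prod := by
  simp only [List.map_ofFn]
  constructor
  · intro h i j hij
    have := h _ ⟨i, j, hij, rfl⟩
    rw [map_sub, NCPoly.eval_word, NCPoly.eval_word, sub_eq_zero] at this
    exact this
  · rintro h _ ⟨i, j, hij, rfl⟩
    rw [map_sub, NCPoly.eval_word, NCPoly.eval_word, sub_eq_zero]
    exact h i j hij

theorem eval_orthRel {u : Fin N × Fin N → B} (hu : ∀ p, star (u p) = u p) :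
    (∀ f ∈ orthRel N, NCPoly.eval u hu f = 0) ↔ IsOrthogonalMatrix u := by
  have e : ∀ i j : Fin N, NCPoly.eval u hu (if i = j then 1 else 0) = if i = j then 1 else 0 :=
    fun i j => by split_ifs <;> simp
  constructor
  · intro h
    refine ⟨hu, fun i j => ?_, fun i j => ?_⟩
    · have := h _ (Or.inl ⟨i, j, rfl⟩)
      rw [map_sub, e, sub_eq_zero, map_sum] at this
      simpa using this
    · have := h _ (Or.inr ⟨i, j, rfl⟩)
      rw [map_sub, e, sub_eq_zero, map_sum] at this
      simpa using this
  · rintro h f (⟨i, j, rfl⟩ | ⟨i, j, rfl⟩)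
    · rw [map_sub, e, sub_eq_zero, map_sum]
      simpa using h.row i j
    · rw [map_sub, e, sub_eq_zero, map_sum]
      simpa using h.col i j

end relations

/-! ### Coordinates on spheres -/

/-- Self-adjoint elements with `∑ x_i² = 1`. -/
structure IsSphereFamily {N : ℕ} {B : Type*} [Ring B] [StarRing B] (x : Fin N → B) : Prop where
  star_eq : ∀ i, star (x i) = x i
  sum_eq : ∑ i, x i * x i = 1

section spheres

variable {N : ℕ} {B : Type} [CStarAlgebra B]

theorem NCSpace.exists_hom_ofRel_sphere {S : Set (NCPoly (Fin N))} {x : Fin N → B}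
    (hx : IsSphereFamily x) (hS : ∀ f ∈ S, NCPoly.eval x hx.star_eq f = 0) :
    ∃ φ : (NCSpace.ofRel (sphereRel N ∪ S)).C →⋆ₐ[ℂ] B,
      ∀ i, φ ((NCSpace.ofRel (sphereRel N ∪ S)).coord i) = x i :=
  UnivCStar.exists_lift _ x hx.star_eq
    (norm_le_one_of_sum_mul_self hx.star_eq hx.sum_eq) (by
      rintro f (hf | hf)
      · exact (eval_sphereRel hx.star_eq).2 hx.sum_eq f hf
      · exact hS f hf)

theorem NCSpace.isSphereFamily_ofRel (S : Set (NCPoly (Fin N))) :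
    IsSphereFamily (NCSpace.ofRel (sphereRel N ∪ S)).coord :=
  ⟨UnivCStar.star_gen _, (eval_sphereRel (B := UnivCStar _) (UnivCStar.star_gen _)).1 fun _ hf => UnivCStar.eval_gen_eq_zero _ (Or.inl hf)⟩

theorem exists_hom_monomialSphere {E : ∀ k l, Set (RowPartition k l)} {x : Fin N → B}
    (hx : IsSphereFamily x) (h : ∀ (k l : ℕ) (π : RowPartition k l), π ∈ E k l → π.IsVert →
      ∀ i j, π.Fits i j → ((List.ofFn i).map x).prod = ((List.ofFn j).map x).prod) :
    ∃ φ : (monomialSphere N E).C →⋆ₐ[ℂ] B, ∀ i, φ ((monomialSphere N E).coord i) = x i :=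
  NCSpace.exists_hom_ofRel_sphere hx (by
    rintro f ⟨k, l, π, h1, h2, h3⟩
    exact (eval_partitionRel hx.star_eq).2 (h k l π h1 h2) f h3)

theorem isSphereFamily_monomialSphere (E : ∀ k l, Set (RowPartition k l)) :
    IsSphereFamily (monomialSphere N E).coord := NCSpace.isSphereFamily_ofRel _

theorem monomialSphere_word_eq {E : ∀ k l, Set (RowPartition k l)} {k l : ℕ}
    {π : RowPartition k l} (h : π ∈ E k l) (hv : π.IsVert) {i : Fin k → Fin N} {j : Fin l → Fin N}
    (hf : π.Fits i j) : ((List.ofFn i).map (monomialSphere N E).coord).prod =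
      ((List.ofFn j).map (monomialSphere N E).coord).prod :=
  (eval_partitionRel (isSphereFamily_monomialSphere E).star_eq).1
    (fun _ hf => UnivCStar.eval_gen_eq_zero _ (Or.inr ⟨k, l, π, h, hv, hf⟩)) i j hf

theorem monomialSphere_central {E : ∀ k l, Set (RowPartition k l)}
    (h : RowPartition.eta ∈ E 3 3) (a b : Fin N) :
    (monomialSphere N E).coord a * (monomialSphere N E).coord a * (monomialSphere N E).coord b =
      (monomialSphere N E).coord b *
        ((monomialSphere N E).coord a * (monomialSphere N E).coord a) := by
  have := monomialSphere_word_eq h RowPartition.isVert_eta (i := ![a, a, b]) (j := ![b, a, a])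
    (RowPartition.fits_eta.2 ⟨rfl, rfl, rfl, rfl⟩)
  simpa [mul_assoc] using this

/-- Equality in the group gives the same reduced word and verticality the same letters, so all
relations of this sphere follow from the centrality of squares. -/
theorem exists_hom_groupSphere_free {x : Fin N → B} (hx : IsSphereFamily x)
    (hc : ∀ a b, x a * x a * x b = x b * (x a * x a)) :
    ∃ φ : (groupSphere N (Z2Free.gen N)).C →⋆ₐ[ℂ] B,
      ∀ i, φ ((groupSphere N (Z2Free.gen N)).coord i) = x i :=
  exists_hom_monomialSphere hx fun k l π hπ hv i j hf => by
    have h := hπ i j hf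
    refine word_eq_of_reduceWord_eq hc (Z2Free.reduceWord_eq ?_) (hv.count_eq hf)
    rw [List.map_ofFn, List.map_ofFn]
    exact h

/-- P_even^{[∞]} is contained in the category of partitions of ℤ₂^{*N}, so the argument for the free
product applies. -/
theorem exists_hom_infSphere [NeZero N] {x : Fin N → B} (hx : IsSphereFamily x)
    (hc : ∀ a b, x a * x a * x b = x b * (x a * x a)) :
    ∃ φ : (infSphere N).C →⋆ₐ[ℂ] B, ∀ i, φ ((infSphere N).coord i) = x i :=
  exists_hom_monomialSphere hx fun k l π hπ hv i j hf => by
    have h := hπ (groupPartitions (Z2Free.gen N))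
      (isPartitionCategory_groupPartitions Z2Free.gen_mul_gen)
      (eta_mem_groupPartitions Z2Free.gen_mul_gen) i j hf
    refine word_eq_of_reduceWord_eq hc (Z2Free.reduceWord_eq ?_) (hv.count_eq hf)
    rw [List.map_ofFn, List.map_ofFn]
    exact h

theorem infSphere_central (a b : Fin N) :
    (infSphere N).coord a * (infSphere N).coord a * (infSphere N).coord b =
      (infSphere N).coord b * ((infSphere N).coord a * (infSphere N).coord a) :=
  monomialSphere_central eta_mem_PevenInf a b

variable (N) in
theorem groupSphere_free_same [NeZero N] : (groupSphere N (Z2Free.gen N)).Same (infSphere N) :=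
  NCSpace.same_of_incl (NCSpace.generates_ofRel _) (NCSpace.generates_ofRel _)
    (exists_hom_infSphere (isSphereFamily_monomialSphere _)
      (monomialSphere_central (eta_mem_groupPartitions Z2Free.gen_mul_gen)))
    (exists_hom_groupSphere_free (isSphereFamily_monomialSphere _) infSphere_central)

theorem exists_hom_halfSphere {x : Fin N → B} (hx : IsSphereFamily x)
    (hc : ∀ a b c, x a * x b * x c = x c * x b * x a) :
    ∃ φ : (halfSphere N).C →⋆ₐ[ℂ] B, ∀ i, φ ((halfSphere N).coord i) = x i :=
  NCSpace.exists_hom_ofRel_sphere hx (by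
    rintro f ⟨i, j, k, rfl⟩
    simp [hc i j k])

theorem isSphereFamily_halfSphere : IsSphereFamily (halfSphere N).coord :=
  NCSpace.isSphereFamily_ofRel _

theorem halfSphere_mul_mul (a b c : Fin N) :
    (halfSphere N).coord a * (halfSphere N).coord b * (halfSphere N).coord c =
      (halfSphere N).coord c * (halfSphere N).coord b * (halfSphere N).coord a := by
  have h := UnivCStar.eval_gen_eq_zero (sphereRel N ∪ {f | ∃ i j k : Fin N,
    f = NCPoly.X i * NCPoly.X j * NCPoly.X k - NCPoly.X k * NCPoly.X j * NCPoly.X i})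
    (Or.inr ⟨a, b, c, rfl⟩)
  simp only [map_sub, map_mul, NCPoly.eval_X, sub_eq_zero] at h
  exact h

theorem isVert_ker_reverse : (RowPartition.ker ![0, 1, 2] ![2, 1, 0]).IsVert := by
  intro p
  have h1 : Fintype.card {a : Fin 3 // (![0, 1, 2] a : ℕ) =
      Sum.elim ![0, 1, 2] ![2, 1, 0] p} = Fintype.card {b : Fin 3 // (![2, 1, 0] b : ℕ) =
      Sum.elim ![0, 1, 2] ![2, 1, 0] p} := by
    revert p; decide
  rw [← Nat.card_eq_fintype_card, ← Nat.card_eq_fintype_card] at h1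
  exact h1

theorem isVert_ker_swap : (RowPartition.ker ![0, 1] ![1, 0]).IsVert := by
  intro p
  have h1 : Fintype.card {a : Fin 2 // (![0, 1] a : ℕ) =
      Sum.elim ![0, 1] ![1, 0] p} = Fintype.card {b : Fin 2 // (![1, 0] b : ℕ) =
      Sum.elim ![0, 1] ![1, 0] p} := by
    revert p; decide
  rw [← Nat.card_eq_fintype_card, ← Nat.card_eq_fintype_card] at h1
  exact h1

/-- Indices having a prescribed kernel fit it. -/
theorem RowPartition.fits_ker_comp {α β : Type*} {k l : ℕ} (f : β → α) (i : Fin k → β)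
    (j : Fin l → β) : (RowPartition.ker i j).Fits (f ∘ i) (f ∘ j) := by
  intro p q hpq
  have h : Sum.elim i j p = Sum.elim i j q := hpq
  change Sum.elim (f ∘ i) (f ∘ j) p = Sum.elim (f ∘ i) (f ∘ j) q
  rw [← Sum.comp_elim]
  exact congrArg f h

theorem reverse_mem_groupPartitions {Γ : Type*} [Group Γ] {g : Fin N → Γ}
    (hg : ∀ a b c, g a * g b * g c = g c * g b * g a) :
    RowPartition.ker ![0, 1, 2] ![2, 1, 0] ∈ groupPartitions g 3 3 := by
  intro i j h
  have h1 : i 0 = j 2 := @h (Sum.inl 0) (Sum.inr 2) rfl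
  have h2 : i 1 = j 1 := @h (Sum.inl 1) (Sum.inr 1) rfl
  have h3 : i 2 = j 0 := @h (Sum.inl 2) (Sum.inr 0) rfl
  simp [List.ofFn_succ, h1, h2, h3, ← mul_assoc, hg (j 2)]

variable (N) in
theorem groupSphere_half_same : (groupSphere N (Z2Half.gen N)).Same (halfSphere N) := by
  refine NCSpace.same_of_incl (NCSpace.generates_ofRel _) (NCSpace.generates_ofRel _)
    (exists_hom_halfSphere (isSphereFamily_monomialSphere _) fun a b c => ?_)
    (exists_hom_monomialSphere isSphereFamily_halfSphere fun k l π hπ hv i j hf => ?_)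
  · have := monomialSphere_word_eq (N := N)
      (reverse_mem_groupPartitions (Z2Half.gen_mul_gen_mul_gen (N := N))) isVert_ker_reverse
      -- The indices a, b, c need not be distinct: they are the image of the word 0, 1, 2 under a
      -- colouring.
      (RowPartition.fits_ker_comp (fun n : ℕ => if n = 0 then a else if n = 1 then b else c) _ _)
    simp only [mul_assoc]
    simpa [mul_assoc, List.ofFn_succ] using! this
  · have h := hπ i j hf
    have hc := fun a => hv.count_eq hf a
    have h' := fun a => Z2Half.count_evenLetters_sub_eq (L := List.ofFn i) (L' := List.ofFn j)
      (by rw [List.map_ofFn, List.map_ofFn]; exact h) a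
    simp only [count_eq_count_evenLetters_add] at hc
    -- For every letter, `hc` gives the sum and `h'` the difference of its counts at even and odd
    -- places, hence both counts.
    refine word_eq_of_evenLetters_eq halfSphere_mul_mul _ _ ?_ ?_ <;> ext a <;>
      specialize hc a <;> specialize h' a <;> omega

/-! ### The classical sphere -/

theorem isSphereFamily_realSphere : IsSphereFamily (realSphere N).coord := by
  refine ⟨fun i => ?_, ?_⟩
  · refine ContinuousMap.ext fun x => ?_
    exact Complex.conj_ofReal _
  · refine ContinuousMap.ext fun x => ?_
    have h : ∑ i, (x : EuclideanSpace ℝ (Fin N)) i * (x : EuclideanSpace ℝ (Fin N)) i = 1 := by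
      simp only [← sq]
      rw [← EuclideanSpace.real_norm_sq_eq, norm_eq_of_mem_sphere x, one_pow]
    refine (ContinuousMap.sum_apply (β := ℂ) _ _ x).trans ?_
    exact (by exact_mod_cast h : ∑ i, ((x : EuclideanSpace ℝ (Fin N)) i : ℂ) *
      ((x : EuclideanSpace ℝ (Fin N)) i : ℂ) = 1)

theorem realSphere_mul_comm (f g : (realSphere N).C) : f * g = g * f :=
  mul_comm (G := C(Metric.sphere (0 : EuclideanSpace ℝ (Fin N)) 1, ℂ)) f g

theorem generates_realSphere : GeneratesCStar (realSphere N).coord := by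
  refine generates_continuousMap (K := Metric.sphere (0 : EuclideanSpace ℝ (Fin N)) 1) _
    fun x y hxy => ?_
  by_contra! h
  refine hxy (Subtype.ext (PiLp.ext fun i => ?_))
  exact Complex.ofReal_injective (h i)

/-- By Gelfand duality it is enough that a character, being real on self-adjoint elements, sends the
family to a point of the sphere. -/
theorem exists_hom_realSphere {x : Fin N → B} (hx : IsSphereFamily x)
    (hc : ∀ a b, x a * x b = x b * x a) :
    ∃ φ : (realSphere N).C →⋆ₐ[ℂ] B, ∀ i, φ ((realSphere N).coord i) = x i := by
  have hind : Topology.IsInducing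
      fun (x : Metric.sphere (0 : EuclideanSpace ℝ (Fin N)) 1) (i : Fin N) =>
        (x : EuclideanSpace ℝ (Fin N)) i :=
    ((PiLp.homeomorph 2 fun _ : Fin N => ℝ).isInducing).comp Topology.IsInducing.subtypeVal
  refine (exists_hom_continuousMap x hx.star_eq hc _ hind ?_).imp fun φ hφ i =>
    hφ _ i fun x => rfl
  intro A _ w j hj hjw χ
  have hw : ∀ i, star (w i) = w i := fun i => hj (by rw [map_star, hjw, hx.star_eq])
  have hs : ∑ i, w i * w i = 1 := hj (by
    rw [map_sum, map_one, ← hx.sum_eq]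
    simp only [map_mul, hjw])
  have h1 : ∑ i, (χ (w i)).re ^ 2 = 1 := by
    have := congrArg χ hs
    rw [map_sum, map_one] at this
    apply Complex.ofReal_injective
    rw [Complex.ofReal_one, ← this, Complex.ofReal_sum]
    refine Finset.sum_congr rfl fun i _ => ?_
    rw [map_mul, Complex.ofReal_pow, ← hom_complex_eq_ofReal χ (hw i), sq]
  refine ⟨⟨WithLp.toLp 2 fun i => (χ (w i)).re, ?_⟩, fun i => hom_complex_eq_ofReal χ (hw i)⟩
  rw [mem_sphere_zero_iff_norm, EuclideanSpace.norm_eq]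
  simp [h1]

variable (N) in
theorem groupSphere_pow_same : (groupSphere N (Z2Pow.gen N)).Same (realSphere N) := by
  refine NCSpace.same_of_incl (NCSpace.generates_ofRel _) generates_realSphere
    (exists_hom_realSphere (isSphereFamily_monomialSphere _) fun a b => ?_)
    (exists_hom_monomialSphere isSphereFamily_realSphere fun k l π hπ hv i j hf => ?_)
  · have hmem : RowPartition.ker ![0, 1] ![1, 0] ∈ groupPartitions (Z2Pow.gen N) 2 2 := by
      intro i j h
      have h1 : i 0 = j 1 := @h (Sum.inl 0) (Sum.inr 1) rfl
      have h2 : i 1 = j 0 := @h (Sum.inl 1) (Sum.inr 0) rfl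
      simp [List.ofFn_succ, h1, h2, mul_comm]
    have := monomialSphere_word_eq (N := N) hmem isVert_ker_swap
      (RowPartition.fits_ker_comp (fun n : ℕ => if n = 0 then a else b) _ _)
    simpa [List.ofFn_succ] using! this
  · have hp : (List.ofFn i).Perm (List.ofFn j) := List.perm_iff_count.2 (hv.count_eq hf)
    exact (hp.map _).prod_eq' (List.pairwise_of_forall fun f g => realSphere_mul_comm f g)

variable (N) in
theorem realSphere_incl_halfSphere : (realSphere N).Incl (halfSphere N) :=
  exists_hom_halfSphere isSphereFamily_realSphere fun a b c => by
    rw [realSphere_mul_comm _ ((realSphere N).coord c),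
      realSphere_mul_comm ((realSphere N).coord a), mul_assoc]

variable (N) in
theorem halfSphere_incl_infSphere [NeZero N] : (halfSphere N).Incl (infSphere N) :=
  exists_hom_infSphere isSphereFamily_halfSphere fun a b => by
    rw [halfSphere_mul_mul, mul_assoc]

theorem linearIndependent_realSphere : LinearIndependent ℂ (realSphere N).coord := by
  rw [Fintype.linearIndependent_iff]
  intro c hc i
  let e : Metric.sphere (0 : EuclideanSpace ℝ (Fin N)) 1 := ⟨EuclideanSpace.single i 1, by simp⟩
  let ev : (realSphere N).C →+ ℂ :=
    { toFun := fun f : C(Metric.sphere (0 : EuclideanSpace ℝ (Fin N)) 1, ℂ) => f e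
      map_zero' := rfl
      map_add' := fun _ _ => rfl }
  have h := congrArg ev hc
  rw [map_sum, map_zero] at h
  have h1 : ∀ k, ev (c k • (realSphere N).coord k) = c k * if k = i then 1 else 0 := fun k => by
    change c k * (((EuclideanSpace.single i (1 : ℝ) : EuclideanSpace ℝ (Fin N)) k : ℝ) : ℂ) = _
    by_cases h : k = i <;> simp [h]
  simpa [h1] using h

/-- Nondegeneracy passes from the classical sphere to the bigger ones. -/
theorem NCSpace.Incl.linearIndependent {X Y : NCSpace (Fin N)} (h : X.Incl Y)
    (hX : LinearIndependent ℂ X.coord) : LinearIndependent ℂ Y.coord := by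
  obtain ⟨φ, hφ⟩ := h
  have h : φ.toAlgHom.toLinearMap ∘ Y.coord = X.coord := funext hφ
  refine LinearIndependent.of_comp φ.toAlgHom.toLinearMap ?_
  rw [h]
  exact hX

end spheres

/-! ### Coordinates of orthogonal quantum groups -/

section orthogonal

variable {N : ℕ} {B : Type} [CStarAlgebra B]

theorem IsOrthogonalMatrix.norm_le_one {u : Fin N × Fin N → B} (hu : IsOrthogonalMatrix u)
    (p : Fin N × Fin N) : ‖u p‖ ≤ 1 :=
  norm_le_one_of_sum_mul_self (b := fun k => u (p.1, k)) (fun k => hu.star_eq _)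
    (by rw [hu.row, if_pos rfl]) p.2

theorem NCSpace.exists_hom_ofRel_orth {S : Set (NCPoly (Fin N × Fin N))} {u : Fin N × Fin N → B}
    (hu : IsOrthogonalMatrix u) (hS : ∀ f ∈ S, NCPoly.eval u hu.star_eq f = 0) :
    ∃ φ : (NCSpace.ofRel (orthRel N ∪ S)).C →⋆ₐ[ℂ] B,
      ∀ p, φ ((NCSpace.ofRel (orthRel N ∪ S)).coord p) = u p :=
  UnivCStar.exists_lift _ u hu.star_eq hu.norm_le_one (by
    rintro f (hf | hf)
    · exact (eval_orthRel hu.star_eq).2 hu f hf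
    · exact hS f hf)

theorem NCSpace.isOrthogonalMatrix_ofRel (S : Set (NCPoly (Fin N × Fin N))) :
    IsOrthogonalMatrix (NCSpace.ofRel (orthRel N ∪ S)).coord :=
  (eval_orthRel (B := UnivCStar _) (UnivCStar.star_gen _)).1
    fun _ hf => UnivCStar.eval_gen_eq_zero _ (Or.inl hf)

theorem isOrthogonalMatrix_one : IsOrthogonalMatrix (N := N) (B := B)
    fun p => if p.1 = p.2 then 1 else 0 := by
  refine ⟨fun p => ?_, fun i j => ?_, fun i j => ?_⟩
  · split_ifs <;> simp
  · simp
  · simp [eq_comm]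

theorem IsOrthogonalMatrix.op {u : Fin N × Fin N → B} (hu : IsOrthogonalMatrix u) :
    IsOrthogonalMatrix (B := Bᵐᵒᵖ) fun p => MulOpposite.op (u (p.2, p.1)) := by
  refine ⟨fun p => ?_, fun i j => ?_, fun i j => ?_⟩
  · rw [← MulOpposite.op_star, hu.star_eq]
  · simp only [← MulOpposite.op_mul, ← Finset.op_sum, hu.col]
    split_ifs <;> simp_all
  · simp only [← MulOpposite.op_mul, ← Finset.op_sum, hu.row]
    split_ifs <;> simp_all

theorem IsOrthogonalQuantumGroup.isOrthogonalMatrix {G : NCSpace (Fin N × Fin N)}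
    (hG : IsOrthogonalQuantumGroup G) : IsOrthogonalMatrix G.coord :=
  ⟨fun p => hG.selfAdjoint p.1 p.2, hG.row, hG.col⟩

end orthogonal

/-! ### Affine actions -/

section coaction

variable {N : ℕ} {A B : Type} [CStarAlgebra A] [CStarAlgebra B]

/-- The elements `∑ⱼ u_ij ⊗ x_j`. -/
def coact (u : Fin N × Fin N → A) (x : Fin N → B) (i : Fin N) : CStarTensor A B :=
  ∑ j, CStarTensor.tmul (u (i, j)) (x j)

variable {u : Fin N × Fin N → A} {x y z : Fin N → B}

/-- Two families x, y are allowed because the comultiplication is the same expression with columns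
of u in place of x, and products of its entries involve different columns. -/
theorem coact_mul (i j : Fin N) : coact u x i * coact u y j =
    ∑ a, ∑ b, CStarTensor.tmul (u (i, a) * u (j, b)) (x a * y b) := by
  rw [coact, coact, Finset.sum_mul_sum]
  simp only [CStarTensor.tmul_mul_tmul]

theorem coact_mul_mul (i j k : Fin N) : coact u x i * coact u y j * coact u z k =
    ∑ a, ∑ b, ∑ c, CStarTensor.tmul (u (i, a) * u (j, b) * u (k, c)) (x a * y b * z c) := by
  rw [coact_mul, coact, Finset.sum_mul]
  refine Finset.sum_congr rfl fun a _ => ?_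
  rw [Finset.sum_mul_sum]
  simp only [CStarTensor.tmul_mul_tmul]

theorem star_coact (hu : ∀ p, star (u p) = u p) (hx : ∀ i, star (x i) = x i) (i : Fin N) :
    star (coact u x i) = coact u x i := by
  simp only [coact, star_sum, CStarTensor.star_tmul, hu, hx]

theorem sum_coact_mul_coact (hu : IsOrthogonalMatrix u) :
    ∑ i, coact u x i * coact u y i = CStarTensor.tmul 1 (∑ a, x a * y a) := by
  simp only [coact_mul]
  rw [Finset.sum_comm, CStarTensor.tmul_sum]
  refine Finset.sum_congr rfl fun a _ => ?_
  rw [Finset.sum_comm, Finset.sum_eq_single a]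
  · rw [← CStarTensor.sum_tmul, hu.col, if_pos rfl]
  · intro b _ hb
    rw [← CStarTensor.sum_tmul, hu.col, if_neg hb.symm, CStarTensor.zero_tmul]
  · simp

theorem isSphereFamily_coact (hu : IsOrthogonalMatrix u) (hx : IsSphereFamily x) :
    IsSphereFamily (coact u x) :=
  ⟨star_coact hu.star_eq hx.star_eq, by
    rw [sum_coact_mul_coact hu, hx.sum_eq, CStarTensor.one_tmul_one]⟩

theorem coact_comm (hu : ∀ p q, u p * u q = u q * u p) (hxy : ∀ a b, x a * y b = y b * x a)
    (i j : Fin N) : coact u x i * coact u y j = coact u y j * coact u x i := by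
  rw [coact_mul, coact_mul, Finset.sum_comm]
  simp only [hu (i, _), hxy]

theorem sum_comm_reverse {M σ : Type*} [AddCommMonoid M] [Fintype σ] (f : σ → σ → σ → M) :
    ∑ a, ∑ b, ∑ c, f a b c = ∑ c, ∑ b, ∑ a, f a b c := by
  calc ∑ a, ∑ b, ∑ c, f a b c = ∑ b, ∑ a, ∑ c, f a b c := Finset.sum_comm
    _ = ∑ b, ∑ c, ∑ a, f a b c := Finset.sum_congr rfl fun b _ => Finset.sum_comm
    _ = _ := Finset.sum_comm

theorem coact_mul_mul_comm (hu : ∀ p q r, u p * u q * u r = u r * u q * u p)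
    (hx : ∀ a b c, x a * y b * z c = z c * y b * x a) (i j k : Fin N) :
    coact u x i * coact u y j * coact u z k = coact u z k * coact u y j * coact u x i := by
  rw [coact_mul_mul, coact_mul_mul, sum_comm_reverse]
  simp only [hu (i, _), hx]

theorem coact_mul_self (hu : ∀ i a b, a ≠ b → u (i, a) * u (i, b) = 0) (i : Fin N) :
    coact u x i * coact u y i =
      ∑ a, CStarTensor.tmul (u (i, a) * u (i, a)) (x a * y a) := by
  rw [coact_mul]
  refine Finset.sum_congr rfl fun a _ => ?_
  rw [Finset.sum_eq_single a]
  · intro b _ hb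
    rw [hu i a b hb.symm, CStarTensor.zero_tmul]
  · simp

/-- Row orthogonality makes the square of ∑ u_ia ⊗ x_a diagonal, namely ∑ u_ia² ⊗ x_a², and each of
its terms commutes with u_jb ⊗ y_b, leg by leg. -/
theorem coact_central (hu : ∀ i a b, a ≠ b → u (i, a) * u (i, b) = 0)
    (hc : ∀ p q, u p * u p * u q = u q * (u p * u p))
    (hx : ∀ a b, x a * x a * y b = y b * (x a * x a)) (i j : Fin N) :
    coact u x i * coact u x i * coact u y j = coact u y j * (coact u x i * coact u x i) := by
  rw [coact_mul_self hu, coact, Finset.sum_mul_sum, Finset.sum_mul_sum, Finset.sum_comm]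
  simp only [CStarTensor.tmul_mul_tmul, hc, hx]

end coaction

-- Comultiplication of orthogonal matrices

section comultiplication

variable {N : ℕ} {A : Type} [CStarAlgebra A]

/-- The elements `∑ₖ u_ik ⊗ u_kj`. -/
def comult (u : Fin N × Fin N → A) (p : Fin N × Fin N) : CStarTensor A A :=
  coact u (fun k => u (k, p.2)) p.1

variable {u : Fin N × Fin N → A}

theorem isOrthogonalMatrix_comult (hu : IsOrthogonalMatrix u) : IsOrthogonalMatrix (comult u) := by
  refine ⟨fun p => star_coact hu.star_eq (fun _ => hu.star_eq _) _, fun i j => ?_, fun i j => ?_⟩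
  · simp only [comult, coact_mul]
    rw [Finset.sum_comm]
    trans ∑ a, CStarTensor.tmul (u (i, a) * u (j, a)) (1 : A)
    · refine Finset.sum_congr rfl fun a _ => ?_
      rw [Finset.sum_comm, Finset.sum_eq_single a]
      · rw [← CStarTensor.tmul_sum, hu.row, if_pos rfl]
      · intro b _ hb
        rw [← CStarTensor.tmul_sum, hu.row, if_neg hb.symm, CStarTensor.tmul_zero]
      · simp
    · rw [← CStarTensor.sum_tmul, hu.row]
      split_ifs
      · exact CStarTensor.one_tmul_one
      · exact CStarTensor.zero_tmul _
  · simp only [comult]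
    rw [sum_coact_mul_coact hu, hu.col]
    split_ifs
    · exact CStarTensor.one_tmul_one
    · exact CStarTensor.tmul_zero _

theorem isPairPositioner_comult (hu : IsPairPositioner u) : IsPairPositioner (comult u) where
  toIsOrthogonalMatrix := isOrthogonalMatrix_comult hu.toIsOrthogonalMatrix
  row_mul i a b hab := by
    simp only [comult]
    rw [coact_mul_self hu.row_mul]
    exact Finset.sum_eq_zero fun k _ => by rw [hu.row_mul _ _ _ hab, CStarTensor.tmul_zero]
  col_mul i j a hij := by
    simp only [comult, coact_mul]
    refine Finset.sum_eq_zero fun k _ => Finset.sum_eq_zero fun l _ => ?_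
    by_cases hkl : k = l
    · rw [hkl, hu.col_mul _ _ _ hij, CStarTensor.zero_tmul]
    · rw [hu.col_mul _ _ _ hkl, CStarTensor.tmul_zero]
  central p q := coact_central hu.row_mul hu.central (fun _ _ => hu.central _ _) _ _

/-- A space with orthogonal coordinates is a quantum group as soon as it has a universal property
given by relations which are satisfied by the comultiplication, the counit and the antipode. -/
theorem isOrthogonalQuantumGroup_of_universal {G : NCSpace (Fin N × Fin N)}
    (hG : IsOrthogonalMatrix G.coord) (hgen : GeneratesCStar G.coord)
    (hΔ : ∃ Δ : G.C →⋆ₐ[ℂ] CStarTensor G.C G.C, ∀ p, Δ (G.coord p) = comult G.coord p)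
    (hε : ∃ ε : G.C →⋆ₐ[ℂ] ℂ, ∀ p, ε (G.coord p) = if p.1 = p.2 then 1 else 0)
    (hS : ∃ S : G.C →⋆ₐ[ℂ] G.Cᵐᵒᵖ, ∀ p, S (G.coord p) = MulOpposite.op (G.coord (p.2, p.1))) :
    IsOrthogonalQuantumGroup G :=
  ⟨fun _ _ => hG.star_eq _, hG.row, hG.col, hgen, hΔ.imp fun _ h i j => h (i, j),
    hε.imp fun _ h i j => h (i, j), hS.imp fun _ h i j => h (i, j)⟩

end comultiplication

/-! ### The orthogonal group -/

section classical

variable {N : ℕ} {B : Type} [CStarAlgebra B]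

theorem orthogonalGroupSpace_mul_comm (f g : (orthogonalGroupSpace N).C) : f * g = g * f :=
  mul_comm (G := C(Matrix.orthogonalGroup (Fin N) ℝ, ℂ)) f g

theorem isOrthogonalMatrix_orthogonalGroupSpace :
    IsOrthogonalMatrix (orthogonalGroupSpace N).coord := by
  refine ⟨fun p => ?_, fun i j => ?_, fun i j => ?_⟩
  · refine ContinuousMap.ext fun U => ?_
    exact Complex.conj_ofReal _
  · refine ContinuousMap.ext fun U => ?_
    refine (ContinuousMap.sum_apply (β := ℂ) _ _ U).trans ?_
    have h := congrFun (congrFun ((Matrix.mem_orthogonalGroup_iff (Fin N) ℝ).1 U.2) i) j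
    rw [Matrix.mul_apply, Matrix.one_apply] at h
    have h' : ∑ k, ((U : Matrix (Fin N) (Fin N) ℝ) i k : ℂ) *
        ((U : Matrix (Fin N) (Fin N) ℝ) j k : ℂ) = if i = j then 1 else 0 := by
      have := congrArg (fun r : ℝ => (r : ℂ)) h
      push_cast at this
      rw [apply_ite Complex.ofReal] at this
      simpa using this
    refine Eq.trans h' ?_
    split_ifs <;> rfl
  · refine ContinuousMap.ext fun U => ?_
    refine (ContinuousMap.sum_apply (β := ℂ) _ _ U).trans ?_
    have h := congrFun (congrFun ((Matrix.mem_orthogonalGroup_iff' (Fin N) ℝ).1 U.2) i) j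
    rw [Matrix.mul_apply, Matrix.one_apply] at h
    have h' : ∑ k, ((U : Matrix (Fin N) (Fin N) ℝ) k i : ℂ) *
        ((U : Matrix (Fin N) (Fin N) ℝ) k j : ℂ) = if i = j then 1 else 0 := by
      have := congrArg (fun r : ℝ => (r : ℂ)) h
      push_cast at this
      rw [apply_ite Complex.ofReal] at this
      simpa using this
    refine Eq.trans h' ?_
    split_ifs <;> rfl

theorem generates_orthogonalGroupSpace : GeneratesCStar (orthogonalGroupSpace N).coord := by
  refine generates_continuousMap (K := Matrix.orthogonalGroup (Fin N) ℝ) _ fun U V hUV => ?_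
  by_contra! h
  refine hUV (Subtype.ext (Matrix.ext fun i j => ?_))
  exact Complex.ofReal_injective (h (i, j))

theorem exists_hom_orthogonalGroupSpace {u : Fin N × Fin N → B} (hu : IsOrthogonalMatrix u)
    (hc : ∀ p q, u p * u q = u q * u p) : ∃ φ : (orthogonalGroupSpace N).C →⋆ₐ[ℂ] B,
      ∀ p, φ ((orthogonalGroupSpace N).coord p) = u p := by
  have hind : Topology.IsInducing fun (U : Matrix.orthogonalGroup (Fin N) ℝ)
      (p : Fin N × Fin N) => (U : Matrix (Fin N) (Fin N) ℝ) p.1 p.2 := by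
    have h : Topology.IsInducing fun (U : Matrix (Fin N) (Fin N) ℝ) (p : Fin N × Fin N) =>
        U p.1 p.2 := by
      refine Topology.IsInducing.of_comp (g := fun f : Fin N × Fin N → ℝ => fun i j => f (i, j))
        (by fun_prop) (by fun_prop) ?_
      exact Topology.IsInducing.id
    exact h.comp Topology.IsInducing.subtypeVal
  refine (exists_hom_continuousMap u hu.star_eq hc _ hind ?_).imp fun φ hφ p =>
    hφ _ p fun U => rfl
  intro A _ w j hj hjw χ
  have hw : ∀ p, star (w p) = w p := fun i => hj (by rw [map_star, hjw, hu.star_eq])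
  have hs : ∀ a b, ∑ k, w (a, k) * w (b, k) = if a = b then 1 else 0 := fun a b => hj (by
    rw [map_sum, apply_ite j, map_one, map_zero, ← hu.row]
    simp only [map_mul, hjw])
  have h1 : ∀ a b, ∑ k, (χ (w (a, k))).re * (χ (w (b, k))).re = if a = b then 1 else 0 := by
    intro a b
    have := congrArg χ (hs a b)
    rw [map_sum, apply_ite χ, map_one, map_zero] at this
    apply Complex.ofReal_injective
    rw [apply_ite Complex.ofReal, Complex.ofReal_one, Complex.ofReal_zero, ← this,
      Complex.ofReal_sum]
    refine Finset.sum_congr rfl fun i _ => ?_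
    rw [map_mul, Complex.ofReal_mul, ← hom_complex_eq_ofReal χ (hw _),
      ← hom_complex_eq_ofReal χ (hw _)]
  refine ⟨⟨Matrix.of fun a b => (χ (w (a, b))).re, ?_⟩, fun p => hom_complex_eq_ofReal χ (hw p)⟩
  rw [Matrix.mem_orthogonalGroup_iff]
  ext a b
  rw [Matrix.mul_apply, Matrix.one_apply, ← h1]
  simp

theorem isOrthogonalQuantumGroup_orthogonalGroupSpace :
    IsOrthogonalQuantumGroup (orthogonalGroupSpace N) := by
  have hu := isOrthogonalMatrix_orthogonalGroupSpace (N := N)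
  refine isOrthogonalQuantumGroup_of_universal hu generates_orthogonalGroupSpace
    (exists_hom_orthogonalGroupSpace (isOrthogonalMatrix_comult hu) fun p q =>
      coact_comm (fun _ _ => orthogonalGroupSpace_mul_comm _ _)
        (fun _ _ => orthogonalGroupSpace_mul_comm _ _) _ _)
    (exists_hom_orthogonalGroupSpace isOrthogonalMatrix_one fun p q => mul_comm _ _)
    (exists_hom_orthogonalGroupSpace hu.op fun p q => ?_)
  rw [← MulOpposite.op_mul, ← MulOpposite.op_mul, orthogonalGroupSpace_mul_comm]

theorem actsAffinely_orthogonalGroupSpace :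
    ActsAffinely (orthogonalGroupSpace N) (realSphere N) :=
  exists_hom_realSphere
    (isSphereFamily_coact isOrthogonalMatrix_orthogonalGroupSpace isSphereFamily_realSphere)
    fun _ _ => coact_comm (fun _ _ => orthogonalGroupSpace_mul_comm _ _)
      (fun _ _ => realSphere_mul_comm _ _) _ _

end classical

/-! ### The half-liberated orthogonal quantum group -/

section half

variable {N : ℕ} {B : Type} [CStarAlgebra B]

theorem exists_hom_halfOrthogonalGroup {u : Fin N × Fin N → B} (hu : IsOrthogonalMatrix u)
    (hc : ∀ p q r, u p * u q * u r = u r * u q * u p) :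
    ∃ φ : (halfOrthogonalGroup N).C →⋆ₐ[ℂ] B, ∀ p, φ ((halfOrthogonalGroup N).coord p) = u p :=
  NCSpace.exists_hom_ofRel_orth hu (by
    rintro f ⟨p, q, r, rfl⟩
    simp [hc p q r])

theorem isOrthogonalMatrix_halfOrthogonalGroup :
    IsOrthogonalMatrix (halfOrthogonalGroup N).coord :=
  NCSpace.isOrthogonalMatrix_ofRel _

theorem halfOrthogonalGroup_mul_mul (p q r : Fin N × Fin N) :
    (halfOrthogonalGroup N).coord p * (halfOrthogonalGroup N).coord q *
        (halfOrthogonalGroup N).coord r =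
      (halfOrthogonalGroup N).coord r * (halfOrthogonalGroup N).coord q *
        (halfOrthogonalGroup N).coord p := by
  have h := UnivCStar.eval_gen_eq_zero (orthRel N ∪ {f | ∃ a b c : Fin N × Fin N,
    f = NCPoly.X a * NCPoly.X b * NCPoly.X c - NCPoly.X c * NCPoly.X b * NCPoly.X a})
    (Or.inr ⟨p, q, r, rfl⟩)
  simp only [map_sub, map_mul, NCPoly.eval_X, sub_eq_zero] at h
  exact h

theorem isOrthogonalQuantumGroup_halfOrthogonalGroup :
    IsOrthogonalQuantumGroup (halfOrthogonalGroup N) := by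
  have hu := isOrthogonalMatrix_halfOrthogonalGroup (N := N)
  refine isOrthogonalQuantumGroup_of_universal hu (NCSpace.generates_ofRel _)
    (exists_hom_halfOrthogonalGroup (isOrthogonalMatrix_comult hu) fun p q r =>
      coact_mul_mul_comm halfOrthogonalGroup_mul_mul
        (fun _ _ _ => halfOrthogonalGroup_mul_mul _ _ _) _ _ _)
    (exists_hom_halfOrthogonalGroup isOrthogonalMatrix_one fun p q r => by ring)
    (exists_hom_halfOrthogonalGroup hu.op fun p q r => ?_)
  simp only [← MulOpposite.op_mul, ← mul_assoc]
  rw [halfOrthogonalGroup_mul_mul]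

theorem actsAffinely_halfOrthogonalGroup : ActsAffinely (halfOrthogonalGroup N) (halfSphere N) :=
  exists_hom_halfSphere
    (isSphereFamily_coact isOrthogonalMatrix_halfOrthogonalGroup isSphereFamily_halfSphere)
    fun _ _ _ => coact_mul_mul_comm halfOrthogonalGroup_mul_mul halfSphere_mul_mul _ _ _

variable (N) in
theorem orthogonalGroupSpace_incl_halfOrthogonalGroup :
    (orthogonalGroupSpace N).Incl (halfOrthogonalGroup N) :=
  exists_hom_halfOrthogonalGroup isOrthogonalMatrix_orthogonalGroupSpace fun a b c => by
    rw [orthogonalGroupSpace_mul_comm _ ((orthogonalGroupSpace N).coord c),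
      orthogonalGroupSpace_mul_comm ((orthogonalGroupSpace N).coord a), mul_assoc]

end half

/-! ### The quantum group `H_N^{[∞]}` -/

section infinite

variable {N : ℕ} {B : Type} [CStarAlgebra B]

theorem exists_hom_hyperoctahedralInf [NeZero N] {u : Fin N × Fin N → B}
    (hu : IsPairPositioner u) :
    ∃ φ : (hyperoctahedralInf N).C →⋆ₐ[ℂ] B, ∀ p, φ ((hyperoctahedralInf N).coord p) = u p :=
  NCSpace.exists_hom_ofRel_orth hu.toIsOrthogonalMatrix (by
    rintro f ⟨k, l, π, hπ, hf⟩
    exact (intertwines_iff_eval hu.star_eq).1 (hu.intertwines hπ) f hf)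

theorem isPairPositioner_hyperoctahedralInf :
    IsPairPositioner (hyperoctahedralInf N).coord :=
  IsPairPositioner.of_intertwines (NCSpace.isOrthogonalMatrix_ofRel _)
    ((intertwines_iff_eval (B := UnivCStar _) (UnivCStar.star_gen _)).2 fun _ hf =>
      UnivCStar.eval_gen_eq_zero _ (Or.inr ⟨3, 3, _, eta_mem_PevenInf, hf⟩))

theorem isPairPositioner_one : IsPairPositioner (N := N) (B := B)
    fun p => if p.1 = p.2 then 1 else 0 where
  toIsOrthogonalMatrix := isOrthogonalMatrix_one
  row_mul i a b hab := by
    by_cases h : i = a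
    · subst h; simp [hab]
    · simp [h]
  col_mul i j a hij := by
    by_cases h : i = a
    · subst h; simp [Ne.symm hij]
    · simp [h]
  central p q := by split_ifs <;> simp

theorem IsPairPositioner.op {u : Fin N × Fin N → B} (hu : IsPairPositioner u) :
    IsPairPositioner (B := Bᵐᵒᵖ) fun p => MulOpposite.op (u (p.2, p.1)) where
  toIsOrthogonalMatrix := hu.toIsOrthogonalMatrix.op
  row_mul i a b hab := by
    rw [← MulOpposite.op_mul, hu.col_mul _ _ _ hab.symm, MulOpposite.op_zero]
  col_mul i j a hij := by
    rw [← MulOpposite.op_mul, hu.row_mul _ _ _ hij.symm, MulOpposite.op_zero]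
  central p q := by
    simp only [← MulOpposite.op_mul]
    rw [hu.central]

theorem isOrthogonalQuantumGroup_hyperoctahedralInf [NeZero N] :
    IsOrthogonalQuantumGroup (hyperoctahedralInf N) := by
  have hu := isPairPositioner_hyperoctahedralInf (N := N)
  exact isOrthogonalQuantumGroup_of_universal hu.toIsOrthogonalMatrix (NCSpace.generates_ofRel _)
    (exists_hom_hyperoctahedralInf (isPairPositioner_comult hu))
    (exists_hom_hyperoctahedralInf isPairPositioner_one)
    (exists_hom_hyperoctahedralInf hu.op)

theorem actsAffinely_hyperoctahedralInf [NeZero N] :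
    ActsAffinely (hyperoctahedralInf N) (infSphere N) := by
  have hu := isPairPositioner_hyperoctahedralInf (N := N)
  exact exists_hom_infSphere
    (isSphereFamily_coact hu.toIsOrthogonalMatrix (isSphereFamily_monomialSphere _))
    fun _ _ => coact_central hu.row_mul hu.central infSphere_central _ _

end infinite

/-! ### Slice maps -/

section slices

variable {A B : Type} [CStarAlgebra A] [CStarAlgebra B] {n : Type} [Fintype n] [DecidableEq n]

/-- A representation of `B` on a finite dimensional space and two basis vectors define a slice map
`A ⊗ B → A`. -/
theorem CStarTensor.exists_slice (ψ : B →⋆ₐ[ℂ] Matrix n n ℂ) (r s : n) :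
    ∃ L : CStarTensor A B →+ A, ∀ a b, L (tmul a b) = ψ b r s • a := by
  let := CStarAlgebra.spectralOrder A
  have := CStarAlgebra.spectralOrderedRing A
  let φ₀ : A →⋆ₐ[ℂ] Matrix n n A :=
    { Matrix.scalarAlgHom n ℂ with
      map_star' := fun a => by
        ext i j
        change Matrix.scalar n (star a) i j = star (Matrix.scalar n a) i j
        rw [Matrix.star_apply, Matrix.scalar_apply, Matrix.scalar_apply, Matrix.diagonal_apply,
          Matrix.diagonal_apply]
        by_cases h : i = j
        · simp [h]
        · simp [h, Ne.symm h] }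
  let ψ₀ : Matrix n n ℂ →⋆ₐ[ℂ] Matrix n n A :=
    { (Algebra.ofId ℂ A).mapMatrix with
      map_star' := fun M => by
        ext i j
        exact (algebraMap_star_comm (A := A) (M j i)) }
  -- The same algebra in the form that carries the C⋆-norm, as required of the target in
  -- `CStarTensor.exists_lift`.
  let e : Matrix n n A →⋆ₐ[ℂ] CStarMatrix n n A :=
    ((CStarMatrix.ofMatrixStarAlgEquiv : Matrix n n A ≃⋆ₐ[ℂ] CStarMatrix n n A) :
      Matrix n n A →⋆ₐ[ℂ] CStarMatrix n n A)
  -- Scalar matrices over A commute with complex matrices, so a ⊗ b ↦ a ψ(b) is a morphism to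
  -- M_n(A). The slice map is its entry at (r, s).
  obtain ⟨χ, hχ⟩ := CStarTensor.exists_lift (e.comp φ₀) ((e.comp ψ₀).comp ψ) fun a b => by
    have h : φ₀ a * ψ₀ (ψ b) = ψ₀ (ψ b) * φ₀ a := by
      ext i j
      change (Matrix.scalar n a * (ψ b).map (algebraMap ℂ A)) i j =
        ((ψ b).map (algebraMap ℂ A) * Matrix.scalar n a) i j
      rw [Matrix.scalar_apply, Matrix.diagonal_mul, Matrix.mul_diagonal, Matrix.map_apply,
        Algebra.commutes]
    change e (φ₀ a) * e (ψ₀ (ψ b)) = e (ψ₀ (ψ b)) * e (φ₀ a)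
    rw [← map_mul, h, map_mul]
  refine ⟨{ toFun := fun t => χ t r s, map_zero' := by rw [map_zero]; rfl,
            map_add' := fun t t' => by rw [map_add]; rfl }, fun a b => ?_⟩
  change χ (tmul a b) r s = _
  rw [hχ]
  change (Matrix.scalar n a * (ψ b).map (algebraMap ℂ A)) r s = _
  rw [Matrix.scalar_apply, Matrix.diagonal_mul, Matrix.map_apply, Algebra.smul_def,
    Algebra.commutes]

/-- A character of `B` defines a slice map `A ⊗ B → A`. -/
theorem CStarTensor.exists_slice_character (ψ : B →⋆ₐ[ℂ] ℂ) :
    ∃ L : CStarTensor A B →+ A, ∀ a b, L (tmul a b) = ψ b • a := by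
  obtain ⟨χ, hχ⟩ := CStarTensor.exists_lift (StarAlgHom.id ℂ A) ((StarAlgHom.ofId ℂ A).comp ψ)
    fun a b => (Algebra.commutes (ψ b) a).symm
  refine ⟨χ.toAlgHom.toLinearMap.toAddMonoidHom, fun a b => ?_⟩
  change χ (tmul a b) = _
  rw [hχ, Algebra.smul_def, Algebra.commutes]
  rfl

end slices

/-! ### Points -/

section points

variable {N : ℕ}

theorem realSphere_exists_character {y : Fin N → ℝ} (hy : ∑ i, y i * y i = 1) :
    ∃ ψ : (realSphere N).C →⋆ₐ[ℂ] ℂ, ∀ i, ψ ((realSphere N).coord i) = y i :=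
  exists_hom_realSphere (x := fun i => (y i : ℂ))
    ⟨fun i => Complex.conj_ofReal _, by exact_mod_cast hy⟩ fun a b => mul_comm _ _

variable {n : Type} [Fintype n] [DecidableEq n] {w : Fin N → Matrix n n ℂ}

open scoped ComplexOrder

theorem halfSphere_exists_matrix (hw : IsSphereFamily w)
    (hc : ∀ a b c, w a * w b * w c = w c * w b * w a) :
    ∃ ψ : (halfSphere N).C →⋆ₐ[ℂ] Matrix n n ℂ, ∀ i, ψ ((halfSphere N).coord i) = w i :=
  exists_hom_halfSphere (B := CStarMatrix n n ℂ) (x := w) ⟨hw.star_eq, hw.sum_eq⟩ hc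

theorem infSphere_exists_matrix [NeZero N] (hw : IsSphereFamily w)
    (hc : ∀ a b, w a * w a * w b = w b * (w a * w a)) :
    ∃ ψ : (infSphere N).C →⋆ₐ[ℂ] Matrix n n ℂ, ∀ i, ψ ((infSphere N).coord i) = w i :=
  exists_hom_infSphere (B := CStarMatrix n n ℂ) (x := w) ⟨hw.star_eq, hw.sum_eq⟩ hc

theorem hyperoctahedralInf_exists_matrix [NeZero N] {u : Fin N × Fin N → Matrix n n ℂ}
    (hu : IsPairPositioner u) :
    ∃ ψ : (hyperoctahedralInf N).C →⋆ₐ[ℂ] Matrix n n ℂ,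
      ∀ p, ψ ((hyperoctahedralInf N).coord p) = u p :=
  exists_hom_hyperoctahedralInf (B := CStarMatrix n n ℂ) (u := u)
    ⟨⟨hu.star_eq, hu.row, hu.col⟩, hu.row_mul, hu.col_mul, hu.central⟩

end points

/-! ### Polarization -/

section polarization

variable {N : ℕ} {M : Type*} [AddCommGroup M] [Module ℂ M]

/-- The form `∑ z_a \bar w_b v_c T_{abc}`. -/
def triForm (T : Fin N → Fin N → Fin N → M) (z w v : Fin N → ℂ) : M :=
  ∑ a, ∑ b, ∑ c, (z a * star (w b) * v c) • T a b c

variable (T : Fin N → Fin N → Fin N → M)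

theorem triForm_add_left (z z' w v : Fin N → ℂ) :
    triForm T (z + z') w v = triForm T z w v + triForm T z' w v := by
  simp only [triForm, Pi.add_apply, add_mul, add_smul, Finset.sum_add_distrib]

theorem triForm_add_mid (z w w' v : Fin N → ℂ) :
    triForm T z (w + w') v = triForm T z w v + triForm T z w' v := by
  simp only [triForm, Pi.add_apply, star_add, mul_add, add_mul, add_smul, Finset.sum_add_distrib]

theorem triForm_add_right (z w v v' : Fin N → ℂ) :
    triForm T z w (v + v') = triForm T z w v + triForm T z w v' := by
  simp only [triForm, Pi.add_apply, mul_add, add_smul, Finset.sum_add_distrib]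

theorem triForm_smul_left (s : ℂ) (z w v : Fin N → ℂ) :
    triForm T (s • z) w v = s • triForm T z w v := by
  simp only [triForm, Finset.smul_sum, smul_smul, Pi.smul_apply, smul_eq_mul, mul_assoc]

theorem triForm_smul_mid (s : ℂ) (z w v : Fin N → ℂ) :
    triForm T z (s • w) v = star s • triForm T z w v := by
  simp only [triForm, Finset.smul_sum, smul_smul, Pi.smul_apply, smul_eq_mul, star_mul']
  refine Finset.sum_congr rfl fun a _ => Finset.sum_congr rfl fun b _ =>
    Finset.sum_congr rfl fun c _ => ?_
  congr 1
  ring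

theorem triForm_smul_right (s : ℂ) (z w v : Fin N → ℂ) :
    triForm T z w (s • v) = s • triForm T z w v := by
  simp only [triForm, Finset.smul_sum, smul_smul, Pi.smul_apply, smul_eq_mul]
  refine Finset.sum_congr rfl fun a _ => Finset.sum_congr rfl fun b _ =>
    Finset.sum_congr rfl fun c _ => ?_
  congr 1
  ring

theorem triForm_single (a b c : Fin N) :
    triForm T (Pi.single a 1) (Pi.single b 1) (Pi.single c 1) = T a b c := by
  rw [triForm, Finset.sum_eq_single a, Finset.sum_eq_single b, Finset.sum_eq_single c]
  · simp
  · intro c' _ h; simp [h]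
  · simp
  · intro b' _ h; simp [h]
  · simp
  · intro a' _ h; simp [h]
  · simp

variable {T}

/-- The terms linear in `x` of the cubic form defined by `T` vanish. -/
theorem triForm_linear_terms {x y : Fin N → ℂ} (h : triForm T (x + y) (x + y) (x + y) = 0)
    (h' : triForm T (x + (-1 : ℂ) • y) (x + (-1 : ℂ) • y) (x + (-1 : ℂ) • y) = 0)
    (hy : triForm T y y y = 0) :
    triForm T y x x + triForm T x y x + triForm T x x y = 0 := by
  simp only [triForm_add_left, triForm_add_mid, triForm_add_right, triForm_smul_left,
    triForm_smul_mid, triForm_smul_right, star_neg, star_one, smul_add, smul_smul] at h h'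
  -- Half the difference of the values at x + y and x - y is the part odd in y, linear plus cubic;
  -- `hy` removes the cubic term.
  linear_combination (norm := module) (1 / 2 : ℂ) • h - (1 / 2 : ℂ) • h' - hy

/-- The middle variable enters conjugate linearly, so replacing y by iy changes the sign of the
middle term relative to the outer two. This isolates T(x, y, x) = 0, which is then polarized in x.
-/
theorem triForm_antisymm (h : ∀ z, triForm T z z z = 0) (a b c : Fin N) :
    T a b c + T c b a = 0 := by
  have key : ∀ x y, triForm T x y x = 0 := by
    intro x y
    have h1 := triForm_linear_terms (h (x + y)) (h _) (h y)
    have h2 := triForm_linear_terms (h (x + Complex.I • y)) (h _) (h (Complex.I • y))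
    simp only [triForm_smul_left, triForm_smul_mid, triForm_smul_right] at h2
    have h3 : Complex.I • (triForm T y x x - triForm T x y x + triForm T x x y) = 0 := by
      rw [← h2]
      simp only [smul_add, smul_sub, Complex.star_def, Complex.conj_I, neg_smul]
      abel
    rw [smul_eq_zero_iff_right Complex.I_ne_zero] at h3
    linear_combination (norm := module) (1 / 2 : ℂ) • h1 - (1 / 2 : ℂ) • h3
  have h1 := key (Pi.single a 1 + Pi.single c 1) (Pi.single b 1)
  rw [triForm_add_left, triForm_add_right, triForm_add_right, key (Pi.single a 1),
    key (Pi.single c 1), zero_add, add_zero, triForm_single, triForm_single] at h1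
  exact h1

end polarization

-- Forms vanishing on unit vectors

section scaling

variable {N : ℕ}

theorem exists_normalization {y : Fin N → ℝ} (hy : y ≠ 0) :
    ∃ t : ℝ, t ≠ 0 ∧ ∑ a, t * y a * (t * y a) = 1 := by
  have h0 : 0 < ∑ a, y a * y a := by
    obtain ⟨a, ha⟩ := Function.ne_iff.1 hy
    exact Finset.sum_pos' (fun b _ => mul_self_nonneg _)
      ⟨a, Finset.mem_univ a, mul_self_pos.2 ha⟩
  refine ⟨(√(∑ a, y a * y a))⁻¹, inv_ne_zero (Real.sqrt_ne_zero'.2 h0), ?_⟩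
  have : ∀ a, (√(∑ a, y a * y a))⁻¹ * y a * ((√(∑ a, y a * y a))⁻¹ * y a) =
      (∑ a, y a * y a)⁻¹ * (y a * y a) := fun a => by
    rw [mul_mul_mul_comm, ← mul_inv, Real.mul_self_sqrt h0.le]
  simp only [this]
  rw [← Finset.mul_sum, inv_mul_cancel₀ h0.ne']

variable {M : Type*} [AddCommGroup M] [Module ℂ M] {T : Fin N → Fin N → Fin N → M}

theorem triForm_zero_of_real (h : ∀ y : Fin N → ℝ, ∑ a, y a * y a = 1 →
      triForm T (fun a => (y a : ℂ)) (fun a => (y a : ℂ)) (fun a => (y a : ℂ)) = 0)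
    (y : Fin N → ℝ) :
    triForm T (fun a => (y a : ℂ)) (fun a => (y a : ℂ)) (fun a => (y a : ℂ)) = 0 := by
  by_cases hy : y = 0
  · simp [hy, triForm]
  · obtain ⟨t, ht, h1⟩ := exists_normalization hy
    have h2 := h (fun a => t * y a) h1
    have h3 : (fun a => ((t * y a : ℝ) : ℂ)) = (t : ℂ) • fun a => (y a : ℂ) := by
      ext a; simp
    have ht' : (t : ℂ) ≠ 0 := Complex.ofReal_ne_zero.2 ht
    rwa [h3, triForm_smul_left, triForm_smul_mid, triForm_smul_right,
      smul_eq_zero_iff_right ht', smul_eq_zero_iff_right (star_ne_zero.2 ht'),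
      smul_eq_zero_iff_right ht'] at h2

theorem triForm_zero_of_unit (h : ∀ z : Fin N → ℂ, ∑ a, z a * star (z a) = 1 →
      triForm T z z z = 0) (z : Fin N → ℂ) : triForm T z z z = 0 := by
  by_cases hz : z = 0
  · simp [hz, triForm]
  · obtain ⟨t, ht, h1⟩ := exists_normalization (y := fun a => ‖z a‖) fun h0 =>
      hz (funext fun a => norm_eq_zero.1 (congrFun h0 a))
    have ht' : (t : ℂ) ≠ 0 := Complex.ofReal_ne_zero.2 ht
    have h2 := h ((t : ℂ) • z) (by
      rw [← Complex.ofReal_one, ← h1, Complex.ofReal_sum]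
      refine Finset.sum_congr rfl fun a _ => ?_
      rw [Pi.smul_apply, smul_eq_mul, Complex.star_def, Complex.mul_conj, Complex.normSq_eq_norm_sq,
        norm_mul, Complex.norm_real, mul_pow, Real.norm_eq_abs, sq_abs]
      push_cast
      ring)
    rwa [triForm_smul_left, triForm_smul_mid, triForm_smul_right,
      smul_eq_zero_iff_right ht', smul_eq_zero_iff_right (star_ne_zero.2 ht'),
      smul_eq_zero_iff_right ht'] at h2

theorem antisymm_of_real_points {c : Fin N → Fin N → M} (h : ∀ y : Fin N → ℝ,
      ∑ a, y a * y a = 1 → ∑ a, ∑ b, ((y a : ℂ) * y b) • c a b = 0) (a b : Fin N) :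
    c a b + c b a = 0 := by
  -- The third variable is frozen at a basis vector, so that additivity and homogeneity of `triForm`
  -- serve for quadratic forms too.
  let Q : (Fin N → ℂ) → (Fin N → ℂ) → M := fun z w =>
    triForm (fun a b _ => c a b) z w (Pi.single a 1)
  have hQ : ∀ z w, Q z w = ∑ a, ∑ b, (z a * star (w b)) • c a b := fun z w => by
    refine Finset.sum_congr rfl fun a' _ => Finset.sum_congr rfl fun b' _ => ?_
    rw [Finset.sum_eq_single a]
    · simp
    · intro c' _ hc'; simp [hc']
    · simp
  have hs : ∀ a b, Q (Pi.single a 1) (Pi.single b 1) = c a b := fun a' b' => triForm_single _ _ _ _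
  have key : ∀ y : Fin N → ℝ, Q (fun a => (y a : ℂ)) (fun a => (y a : ℂ)) = 0 := by
    intro y
    by_cases hy : y = 0
    · simp [hy, hQ]
    · obtain ⟨t, ht, h1⟩ := exists_normalization hy
      have ht' : (t : ℂ) ≠ 0 := Complex.ofReal_ne_zero.2 ht
      have h2 := h (fun a => t * y a) h1
      have h3 : Q ((t : ℂ) • fun a => (y a : ℂ)) ((t : ℂ) • fun a => (y a : ℂ)) = 0 := by
        rw [hQ, ← h2]
        simp
      rwa [show Q _ _ = _ from triForm_smul_left _ _ _ _ _, triForm_smul_mid,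
        smul_eq_zero_iff_right ht', smul_eq_zero_iff_right (star_ne_zero.2 ht')] at h3
  have e : ∀ a : Fin N, (fun i => ((Pi.single a (1 : ℝ) : Fin N → ℝ) i : ℂ)) = Pi.single a 1 :=
    fun a => by
      ext i
      by_cases h : i = a <;> simp [h]
  have e' : (fun i => ((Pi.single a (1 : ℝ) + Pi.single b 1 : Fin N → ℝ) i : ℂ)) =
      Pi.single a 1 + Pi.single b 1 := by
    rw [← e, ← e]
    ext i
    simp
  have h1 := key (Pi.single a 1)
  have h2 := key (Pi.single b 1)
  have h3 := key (Pi.single a 1 + Pi.single b 1)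
  rw [e, hs] at h1 h2
  rw [e', show Q _ _ = _ from triForm_add_left _ _ _ _ _, triForm_add_mid, triForm_add_mid] at h3
  have h4 : c a a + c a b + (c b a + c b b) = 0 := by
    rw [← hs a a, ← hs a b, ← hs b a, ← hs b b]
    exact h3
  rwa [h1, h2, zero_add, add_zero] at h4

end scaling

theorem eq_zero_of_add_self {M : Type*} [AddCommGroup M] [Module ℂ M] {x : M} (h : x + x = 0) :
    x = 0 := by
  rw [← two_smul ℂ x] at h
  exact (smul_eq_zero_iff_right two_ne_zero).1 h

-- Maximality of O_N and O_N⋆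

section maximal

variable {N : ℕ} {H : NCSpace (Fin N × Fin N)}

theorem ActsAffinely.mul_comm_of_realSphere (hH : IsOrthogonalQuantumGroup H)
    (hA : ActsAffinely H (realSphere N)) (p q : Fin N × Fin N) :
    H.coord p * H.coord q = H.coord q * H.coord p := by
  obtain ⟨Φ, hΦ⟩ := hA
  obtain ⟨S, hS⟩ := hH.antipode
  have hΦ' : ∀ i, Φ ((realSphere N).coord i) = coact H.coord (realSphere N).coord i := hΦ
  -- The elements in question are the coefficients of x_a x_b in Φ(x_i x_j - x_j x_i). Real points
  -- see only their symmetric part in a and b.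
  have key : ∀ i j a b : Fin N,
      H.coord (i, a) * H.coord (j, b) - H.coord (j, a) * H.coord (i, b) +
        (H.coord (i, b) * H.coord (j, a) - H.coord (j, b) * H.coord (i, a)) = 0 := by
    intro i j
    refine antisymm_of_real_points fun y hy => ?_
    obtain ⟨ψ, hψ⟩ := realSphere_exists_character hy
    obtain ⟨L, hL⟩ := CStarTensor.exists_slice_character (A := H.C) ψ
    have h := congrArg Φ
      (realSphere_mul_comm ((realSphere N).coord i) ((realSphere N).coord j))
    rw [map_mul, map_mul, hΦ', hΦ', coact_mul, coact_mul] at h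
    have h' := congrArg L h
    simp only [map_sum, hL, map_mul, hψ] at h'
    simp only [smul_sub, Finset.sum_sub_distrib]
    exact sub_eq_zero.2 h'
  obtain ⟨i, a⟩ := p
  obtain ⟨j, b⟩ := q
  have h1 := key i j a b
  -- The antipode transposes the indices and reverses the products. The resulting relation has the
  -- same terms as `h1`, with the sign of the commutator of u_ia and u_jb changed; the difference is
  -- twice this commutator.
  have h2 := congrArg (fun t => MulOpposite.unop (S t)) (key a b i j)
  simp only [map_add, map_sub, map_mul, hS, map_zero, ← MulOpposite.op_mul, ← MulOpposite.op_sub,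
    ← MulOpposite.op_add, MulOpposite.unop_op, MulOpposite.unop_zero] at h2
  refine sub_eq_zero.1 (eq_zero_of_add_self ?_)
  rw [← sub_zero (0 : H.C)]
  nth_rewrite 1 [← h1]
  rw [← h2]
  abel

theorem isQuantumIsometryGroup_realSphere :
    IsQuantumIsometryGroup (orthogonalGroupSpace N) (realSphere N) where
  nondegenerate := linearIndependent_realSphere
  quantumGroup := isOrthogonalQuantumGroup_orthogonalGroupSpace
  acts := actsAffinely_orthogonalGroupSpace
  maximal _ hH hA :=
    exists_hom_orthogonalGroupSpace hH.isOrthogonalMatrix (hA.mul_comm_of_realSphere hH)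

/-- A product of three such antidiagonal matrices has the entries z_a \bar z_b z_c and its
conjugate, both symmetric in a and c. -/
theorem halfSphere_exists_complex_point {z : Fin N → ℂ} (hz : ∑ a, z a * star (z a) = 1) :
    ∃ ψ : (halfSphere N).C →⋆ₐ[ℂ] Matrix (Fin 2) (Fin 2) ℂ,
      ∀ i, ψ ((halfSphere N).coord i) = !![0, z i; star (z i), 0] := by
  refine halfSphere_exists_matrix ⟨fun i => ?_, ?_⟩ fun a b c => ?_
  · ext r s
    fin_cases r <;> fin_cases s <;> simp [Matrix.star_apply]
  · have h : ∀ i, !![0, z i; star (z i), 0] * !![0, z i; star (z i), 0] =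
        !![z i * star (z i), 0; 0, z i * star (z i)] := fun i => by
      rw [Matrix.mul_fin_two]
      simp [mul_comm]
    simp only [h]
    ext r s
    rw [Matrix.sum_apply]
    fin_cases r <;> fin_cases s <;> simp [← hz]
  · simp only [Matrix.mul_fin_two]
    ext r s
    fin_cases r <;> fin_cases s <;> simp [mul_comm, mul_left_comm]

theorem ActsAffinely.mul_mul_comm_of_halfSphere (hH : IsOrthogonalQuantumGroup H)
    (hA : ActsAffinely H (halfSphere N)) (p q r : Fin N × Fin N) :
    H.coord p * H.coord q * H.coord r = H.coord r * H.coord q * H.coord p := by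
  obtain ⟨Φ, hΦ⟩ := hA
  obtain ⟨S, hS⟩ := hH.antipode
  have hΦ' : ∀ i, Φ ((halfSphere N).coord i) = coact H.coord (halfSphere N).coord i := hΦ
  have key : ∀ i j k a b c : Fin N,
      H.coord (i, a) * H.coord (j, b) * H.coord (k, c) -
          H.coord (k, a) * H.coord (j, b) * H.coord (i, c) +
        (H.coord (i, c) * H.coord (j, b) * H.coord (k, a) -
          H.coord (k, c) * H.coord (j, b) * H.coord (i, a)) = 0 := by
    intro i j k a b c
    refine triForm_antisymm (T := fun a b c => H.coord (i, a) * H.coord (j, b) * H.coord (k, c) -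
          H.coord (k, a) * H.coord (j, b) * H.coord (i, c)) ?_ a b c
    refine triForm_zero_of_unit fun z hz => ?_
    obtain ⟨ψ, hψ⟩ := halfSphere_exists_complex_point hz
    obtain ⟨L, hL⟩ := CStarTensor.exists_slice (A := H.C) ψ 0 1
    have h := congrArg Φ (halfSphere_mul_mul i j k)
    rw [map_mul, map_mul, map_mul, map_mul, hΦ', hΦ', hΦ', coact_mul_mul, coact_mul_mul] at h
    have h' := congrArg L h
    have hz' : ∀ a b c, (!![0, z a; star (z a), 0] * !![0, z b; star (z b), 0] *
        !![0, z c; star (z c), 0] : Matrix (Fin 2) (Fin 2) ℂ) 0 1 = z a * star (z b) * z c := by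
      intro a b c
      simp only [Matrix.mul_fin_two]
      simp
    simp only [map_sum, hL, map_mul, hψ, hz'] at h'
    simp only [triForm, smul_sub, Finset.sum_sub_distrib]
    exact sub_eq_zero.2 h'
  obtain ⟨i, a⟩ := p
  obtain ⟨j, b⟩ := q
  obtain ⟨k, c⟩ := r
  have h1 := key i j k a b c
  -- As in the classical case, the antipode changes the sign of the wanted difference and keeps the
  -- other two terms.
  have h2 := congrArg (fun t => MulOpposite.unop (S t)) (key a b c i j k)
  simp only [map_add, map_sub, map_mul, hS, map_zero, ← MulOpposite.op_mul, ← MulOpposite.op_sub,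
    ← MulOpposite.op_add, MulOpposite.unop_op, MulOpposite.unop_zero, ← mul_assoc] at h2
  refine sub_eq_zero.1 (eq_zero_of_add_self ?_)
  rw [← sub_zero (0 : H.C)]
  nth_rewrite 1 [← h1]
  rw [← h2]
  abel

theorem isQuantumIsometryGroup_halfSphere :
    IsQuantumIsometryGroup (halfOrthogonalGroup N) (halfSphere N) where
  nondegenerate := (realSphere_incl_halfSphere N).linearIndependent linearIndependent_realSphere
  quantumGroup := isOrthogonalQuantumGroup_halfOrthogonalGroup
  acts := actsAffinely_halfOrthogonalGroup
  maximal _ hH hA :=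
    exists_hom_halfOrthogonalGroup hH.isOrthogonalMatrix (hA.mul_mul_comm_of_halfSphere hH)

end maximal

/-! ### A path of reflections -/

section path

variable {N : ℕ}

/-- Involutions of a path with vertices `0, 1, 2, 3`, having edges labelled `c`, `b`, `a`. -/
def pathPerm (a b c d : Fin N) : Equiv.Perm (Fin 4) :=
  if d = b then Equiv.swap 1 2
  else (if d = c then Equiv.swap 0 1 else 1) * (if d = a then Equiv.swap 2 3 else 1)

theorem pathPerm_mul_self (a b c d : Fin N) : pathPerm a b c d * pathPerm a b c d = 1 := by
  rw [pathPerm]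
  split_ifs <;> decide

/-- Each involution moves a vertex by at most one step, so going from 0 to 3 in three steps means
crossing the edges c, b, a in this order. The case a = c is allowed: that letter then flips both end
edges. -/
theorem pathPerm_path_iff {a b c : Fin N} (hab : a ≠ b) (hbc : b ≠ c) (d e f : Fin N) :
    (pathPerm a b c d * pathPerm a b c e * pathPerm a b c f) 0 = 3 ↔ d = a ∧ e = b ∧ f = c := by
  have h0 : ∀ d, pathPerm a b c d 0 = if d = c then 1 else 0 := by
    intro d
    rw [pathPerm]
    by_cases h1 : d = b
    · have h2 : d ≠ c := by rw [h1]; exact hbc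
      rw [if_pos h1, if_neg h2]; decide
    · rw [if_neg h1]; split_ifs <;> decide
  have h1 : ∀ d, pathPerm a b c d 1 = if d = b then 2 else if d = c then 0 else 1 := by
    intro d
    rw [pathPerm]
    split_ifs <;> decide
  have h2 : ∀ d, pathPerm a b c d 2 = if d = b then 1 else if d = a then 3 else 2 := by
    intro d
    rw [pathPerm]
    split_ifs <;> decide
  rw [Equiv.Perm.mul_apply, Equiv.Perm.mul_apply, h0]
  by_cases hf : f = c
  · rw [if_pos hf, h1]
    by_cases he : e = b
    · rw [if_pos he, h2]
      by_cases hd : d = b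
      · have : ¬ d = a := by rw [hd]; exact hab.symm
        rw [if_pos hd]
        simp [this]
      · rw [if_neg hd]
        by_cases hd' : d = a <;> simp [hd', he, hf]
    · rw [if_neg he]
      by_cases he' : e = c
      · rw [if_pos he', h0]
        by_cases hd : d = c <;> simp [hd, he]
      · rw [if_neg he', h1]
        by_cases hd : d = b
        · simp [hd, he]
        · rw [if_neg hd]
          by_cases hd' : d = c <;> simp [hd', he]
  · rw [if_neg hf, h0]
    by_cases he : e = c
    · rw [if_pos he, h1]
      by_cases hd : d = b
      · simp [hd, hf]
      · rw [if_neg hd]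
        by_cases hd' : d = c <;> simp [hd', hf]
    · rw [if_neg he, h0]
      by_cases hd : d = c <;> simp [hd, hf]

/-- The matrix of an involution of the path. -/
def pathMatrix (a b c d : Fin N) : Matrix (Fin 4) (Fin 4) ℂ :=
  (Equiv.Perm.permMatrix ℂ (pathPerm a b c d))

theorem pathMatrix_mul_self (a b c d : Fin N) : pathMatrix a b c d * pathMatrix a b c d = 1 := by
  rw [pathMatrix, ← Matrix.permMatrix_mul, pathPerm_mul_self, Matrix.permMatrix_one]

theorem star_pathMatrix (a b c d : Fin N) : star (pathMatrix a b c d) = pathMatrix a b c d := by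
  rw [pathMatrix, Matrix.star_eq_conjTranspose, Matrix.conjTranspose_permMatrix,
    inv_eq_of_mul_eq_one_left (pathPerm_mul_self a b c d)]

/-- Slicing with this entry picks the coefficient of the single word abc out of all words of length
three. -/
theorem pathMatrix_mul_mul_apply {a b c : Fin N} (hab : a ≠ b) (hbc : b ≠ c) (d e f : Fin N) :
    (pathMatrix a b c d * pathMatrix a b c e * pathMatrix a b c f) 3 0 =
      if d = a ∧ e = b ∧ f = c then 1 else 0 := by
  have hinv : ∀ d, (pathPerm a b c d)⁻¹ = pathPerm a b c d := fun d =>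
    inv_eq_of_mul_eq_one_left (pathPerm_mul_self a b c d)
  -- Passing to permutation matrices reverses products, and the reversed product of involutions is
  -- the inverse.
  have h : pathPerm a b c f * (pathPerm a b c e * pathPerm a b c d) =
      (pathPerm a b c d * pathPerm a b c e * pathPerm a b c f)⁻¹ := by
    rw [mul_inv_rev, mul_inv_rev, hinv, hinv, hinv]
  rw [pathMatrix, pathMatrix, pathMatrix, ← Matrix.permMatrix_mul, ← Matrix.permMatrix_mul, h,
    Equiv.Perm.permMatrix, PEquiv.toMatrix_apply]
  refine if_congr ?_ rfl rfl
  rw [← pathPerm_path_iff hab hbc, Equiv.toPEquiv_apply, Option.mem_some_iff,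
    Equiv.Perm.inv_eq_iff_eq, eq_comm]

/-- The N involutions are scaled by N^{-1/2}: their squares are the scalars 1/N, which are central
and add up to 1. -/
theorem infSphere_exists_path [NeZero N] (a b c : Fin N) :
    ∃ t : ℂ, t ≠ 0 ∧ ∃ ψ : (infSphere N).C →⋆ₐ[ℂ] Matrix (Fin 4) (Fin 4) ℂ,
      ∀ i, ψ ((infSphere N).coord i) = t • pathMatrix a b c i := by
  have hN : (0 : ℝ) < N := Nat.cast_pos.2 (NeZero.pos N)
  let t : ℝ := (√N)⁻¹
  have ht : (t : ℂ) * t = (N : ℂ)⁻¹ := by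
    rw [← Complex.ofReal_mul, ← mul_inv, Real.mul_self_sqrt hN.le, Complex.ofReal_inv,
      Complex.ofReal_natCast]
  have hsq : ∀ i, (t : ℂ) • pathMatrix a b c i * (t : ℂ) • pathMatrix a b c i =
      (N : ℂ)⁻¹ • (1 : Matrix (Fin 4) (Fin 4) ℂ) := fun i => by
    rw [smul_mul_smul_comm, pathMatrix_mul_self, ht]
  refine ⟨t, Complex.ofReal_ne_zero.2 (inv_ne_zero (Real.sqrt_ne_zero'.2 hN)),
    infSphere_exists_matrix ⟨fun i => ?_, ?_⟩ fun i j => ?_⟩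
  · rw [star_smul, star_pathMatrix, Complex.star_def, Complex.conj_ofReal]
  · simp only [hsq]
    rw [Finset.sum_const, Finset.card_univ, Fintype.card_fin, ← Nat.cast_smul_eq_nsmul ℂ,
      smul_smul, mul_inv_cancel₀ (Nat.cast_ne_zero.2 (NeZero.ne N)), one_smul]
  · simp only [hsq, smul_mul_assoc, mul_smul_comm, one_mul, mul_one]
    rw [smul_comm]

end path

/-! ### Consequences of the invariance of the cubic relations -/

section cubic

variable {N : ℕ} {A : Type*} [Ring A]

/-- The defect of centrality of squares, in terms of rows. -/
def rowDefect (u : Fin N × Fin N → A) (i k a b c : Fin N) : A :=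
  u (i, a) * u (i, b) * u (k, c) - u (k, a) * u (i, b) * u (i, c)

/-- The defect of centrality of squares, in terms of columns. -/
def colDefect (u : Fin N × Fin N → A) (a c i j k : Fin N) : A :=
  u (i, a) * u (j, a) * u (k, c) - u (i, c) * u (j, a) * u (k, a)

/-- A function on triples of indices is antisymmetric and concentrated on the indices of the
form `aab` and `baa`. -/
structure IsCubicDefect {M : Type*} [AddCommGroup M] (f : Fin N → Fin N → Fin N → M) : Prop where
  reduced : ∀ a b c, a ≠ b → b ≠ c → f a b c = 0
  antisymm : ∀ a b, a ≠ b → f a a b + f b a a = 0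
  diag : ∀ a, f a a a = 0

/-- Antisymmetry expresses twice the value at aac as the difference of the values at aac and caa.
The Kronecker symbols put all cases in one formula, the two terms cancelling on the diagonal. -/
theorem IsCubicDefect.two_nsmul {M : Type*} [AddCommGroup M] {f : Fin N → Fin N → Fin N → M}
    (hf : IsCubicDefect f) (a b c : Fin N) :
    f a b c + f a b c = (if a = b then f a a c - f c a a else 0) -
      if b = c then f b b a - f a b b else 0 := by
  by_cases hab : a = b
  · subst hab
    by_cases hac : a = c
    · subst hac
      simp [hf.diag]
    · rw [if_pos rfl, if_neg hac, sub_zero, eq_neg_of_add_eq_zero_right (hf.antisymm a c hac)]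
      abel
  · by_cases hbc : b = c
    · subst hbc
      rw [if_neg hab, if_pos rfl, eq_neg_of_add_eq_zero_left (hf.antisymm b a (Ne.symm hab))]
      abel
    · rw [if_neg hab, if_neg hbc, hf.reduced a b c hab hbc]
      simp

/-- The bridge between rows and columns: both sides consist of the same four monomials. -/
theorem rowDefect_sub_rowDefect (u : Fin N × Fin N → A) (i k a c : Fin N) :
    rowDefect u i k a a c - rowDefect u i k c a a =
      colDefect u a c i i k - colDefect u a c k i i := by
  simp only [rowDefect, colDefect]
  abel

variable [Algebra ℂ A] {u : Fin N × Fin N → A}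

/-- After doubling, `IsCubicDefect.two_nsmul` expands both sides into the same four terms. They
carry one condition among i = j, j = k and one among a = b, b = c, and their values are the
differences common to rows and columns. -/
theorem rowDefect_eq_colDefect (hr : ∀ i k, IsCubicDefect (rowDefect u i k))
    (hc : ∀ a c, IsCubicDefect (colDefect u a c)) (i j k a b c : Fin N) :
    ((if i = j then rowDefect u i k a b c else 0) - if j = k then rowDefect u j i a b c else 0) =
      (if a = b then colDefect u a c i j k else 0) -
        if b = c then colDefect u b a i j k else 0 := by
  refine sub_eq_zero.1 (eq_zero_of_add_self ?_)
  have h1 := (hr i k).two_nsmul a b c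
  have h2 := (hr j i).two_nsmul a b c
  have h3 := (hc a c).two_nsmul i j k
  have h4 := (hc b a).two_nsmul i j k
  simp only [rowDefect_sub_rowDefect] at h1 h2
  have e : ∀ x y z w : A, x - y - (z - w) + (x - y - (z - w)) =
      (x + x) - (y + y) - ((z + z) - (w + w)) := fun x y z w => by abel
  have e' : ∀ (P : Prop) [Decidable P] (x : A),
      ((if P then x else 0) + if P then x else 0) = if P then x + x else 0 := fun P _ x => by
    split_ifs <;> simp
  rw [e, e', e', e', e', h1, h2, h3, h4]
  by_cases hij : i = j
  · subst hij
    split_ifs <;> simp_all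
  · split_ifs <;> simp_all

variable [StarRing A]

/-- Orthogonality contracts the leading factors. The coefficient N - 2 arises as -1 from the first
defect and N - 1 from the second, where the free sum over i produces N. -/
theorem sum_rowDefect (hu : IsOrthogonalMatrix u) (j k b c : Fin N) :
    ∑ i, ∑ a, u (i, a) * ((if i = j then rowDefect u i k a b c else 0) -
      if j = k then rowDefect u j i a b c else 0) =
    u (j, b) * u (k, c) + ((N : ℂ) - 2) • if j = k then u (j, b) * u (j, c) else 0 := by
  have h1 : ∑ i, ∑ a, u (i, a) * (if i = j then rowDefect u i k a b c else 0) =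
      u (j, b) * u (k, c) - if j = k then u (j, b) * u (j, c) else 0 := by
    rw [Finset.sum_eq_single j]
    · simp only [if_true, rowDefect, mul_sub, Finset.sum_sub_distrib]
      have e1 : ∀ a, u (j, a) * (u (j, a) * u (j, b) * u (k, c)) =
        u (j, a) * u (j, a) * (u (j, b) * u (k, c)) := fun a => by simp only [mul_assoc]
      have e2 : ∀ a, u (j, a) * (u (k, a) * u (j, b) * u (j, c)) =
        u (j, a) * u (k, a) * (u (j, b) * u (j, c)) := fun a => by simp only [mul_assoc]
      simp only [e1, e2, ← Finset.sum_mul, hu.row, if_true, one_mul, ite_mul, zero_mul]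
    · intro i _ hi
      simp [hi]
    · simp
  have h2 : ∑ i, ∑ a, u (i, a) * rowDefect u j i a b c =
      u (j, b) * u (j, c) - (N : ℂ) • (u (j, b) * u (j, c)) := by
    simp only [rowDefect, mul_sub, Finset.sum_sub_distrib]
    have e1 : ∀ i a, u (i, a) * (u (j, a) * u (j, b) * u (i, c)) =
      u (i, a) * u (j, a) * (u (j, b) * u (i, c)) := fun i a => by simp only [mul_assoc]
    have e2 : ∀ i a, u (i, a) * (u (i, a) * u (j, b) * u (j, c)) =
      u (i, a) * u (i, a) * (u (j, b) * u (j, c)) := fun i a => by simp only [mul_assoc]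
    simp only [e1, e2, ← Finset.sum_mul, hu.row, if_true, one_mul, ite_mul, zero_mul]
    simp [Nat.cast_smul_eq_nsmul, mul_assoc]
  simp only [mul_sub, Finset.sum_sub_distrib]
  rw [h1]
  by_cases hjk : j = k
  · simp only [hjk, if_true]
    rw [hjk] at h2
    rw [h2]
    module
  · simp [hjk]

theorem sum_colDefect (hu : IsOrthogonalMatrix u) (j k b c : Fin N) :
    ∑ i, ∑ a, u (i, a) * ((if a = b then colDefect u a c i j k else 0) -
      if b = c then colDefect u b a i j k else 0) =
    u (j, b) * u (k, c) + ((N : ℂ) - 2) • if b = c then u (j, b) * u (k, b) else 0 := by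
  have h1 : ∑ a, ∑ i, u (i, a) * (if a = b then colDefect u a c i j k else 0) =
      u (j, b) * u (k, c) - if b = c then u (j, b) * u (k, b) else 0 := by
    rw [Finset.sum_eq_single b]
    · simp only [if_true, colDefect, mul_sub, Finset.sum_sub_distrib]
      have e1 : ∀ i, u (i, b) * (u (i, b) * u (j, b) * u (k, c)) =
        u (i, b) * u (i, b) * (u (j, b) * u (k, c)) := fun a => by simp only [mul_assoc]
      have e2 : ∀ i, u (i, b) * (u (i, c) * u (j, b) * u (k, b)) =
        u (i, b) * u (i, c) * (u (j, b) * u (k, b)) := fun a => by simp only [mul_assoc]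
      simp only [e1, e2, ← Finset.sum_mul, hu.col, if_true, one_mul, ite_mul, zero_mul]
    · intro i _ hi
      simp [hi]
    · simp
  have h2 : ∑ a, ∑ i, u (i, a) * colDefect u b a i j k =
      u (j, b) * u (k, b) - (N : ℂ) • (u (j, b) * u (k, b)) := by
    simp only [colDefect, mul_sub, Finset.sum_sub_distrib]
    have e1 : ∀ i a, u (i, a) * (u (i, b) * u (j, b) * u (k, a)) =
      u (i, a) * u (i, b) * (u (j, b) * u (k, a)) := fun i a => by simp only [mul_assoc]
    have e2 : ∀ i a, u (i, a) * (u (i, a) * u (j, b) * u (k, b)) =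
      u (i, a) * u (i, a) * (u (j, b) * u (k, b)) := fun i a => by simp only [mul_assoc]
    simp only [e1, e2, ← Finset.sum_mul, hu.col, if_true, one_mul, ite_mul, zero_mul]
    simp [Nat.cast_smul_eq_nsmul, mul_assoc]
  rw [Finset.sum_comm]
  simp only [mul_sub, Finset.sum_sub_distrib]
  rw [h1]
  by_cases hbc : b = c
  · simp only [hbc, if_true]
    rw [hbc] at h2
    rw [h2]
    module
  · simp [hbc]

/-- Contracting the common identity in its row form and in its column form, u_jb u_kc cancels and N
- 2 can be divided out. With distinct entries of a row now orthogonal, the mixed terms of the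
antisymmetry relation vanish and it becomes the centrality of squares. -/
theorem IsPairPositioner.of_isCubicDefect (hN : N ≠ 2) (hu : IsOrthogonalMatrix u)
    (hr : ∀ i k, IsCubicDefect (rowDefect u i k))
    (hc : ∀ a c, IsCubicDefect (colDefect u a c)) : IsPairPositioner u := by
  have h2 : (N : ℂ) - 2 ≠ 0 := sub_ne_zero.2 (by exact_mod_cast hN)
  have key : ∀ j k b c, (if j = k then u (j, b) * u (j, c) else 0) =
      if b = c then u (j, b) * u (k, b) else 0 := by
    intro j k b c
    have h := sum_rowDefect hu j k b c
    simp only [rowDefect_eq_colDefect hr hc] at h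
    rw [sum_colDefect hu] at h
    exact (smul_right_injective A h2 (add_left_cancel h)).symm
  have hrow : ∀ i a b, a ≠ b → u (i, a) * u (i, b) = 0 := fun i a b hab => by
    simpa [hab] using key i i a b
  have hcol : ∀ i j a, i ≠ j → u (i, a) * u (j, a) = 0 := fun i j a hij => by
    simpa [hij] using (key i j a a).symm
  refine ⟨hu, hrow, hcol, ?_⟩
  rintro ⟨i, a⟩ ⟨k, c⟩
  by_cases hac : a = c
  · subst hac
    have h := (hr i k).diag a
    rw [rowDefect, sub_eq_zero] at h
    rw [h, mul_assoc]
  · have h := (hr i k).antisymm a c hac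
    simp only [rowDefect] at h
    rw [mul_assoc (u (k, a)), hrow i a c hac, mul_zero, sub_zero, hrow i c a (Ne.symm hac), zero_mul,
      zero_sub, ← sub_eq_add_neg, sub_eq_zero, mul_assoc (u (k, c))] at h
    exact h

end cubic

-- Maximality of H_N^{[∞]}

section maximal

variable {N : ℕ} {H : NCSpace (Fin N × Fin N)}

/-- Path representations isolate the coefficients of reduced words. The classical points see the
cubic form with coefficients T, which controls the remaining ones. -/
theorem isCubicDefect_of_sum_tmul [NeZero N] {A : Type} [CStarAlgebra A]
    {T : Fin N → Fin N → Fin N → A} (hT : ∑ a, ∑ b, ∑ c, CStarTensor.tmul (T a b c)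
      ((infSphere N).coord a * (infSphere N).coord b * (infSphere N).coord c) = 0) :
    IsCubicDefect T := by
  have hred : ∀ a b c, a ≠ b → b ≠ c → T a b c = 0 := by
    intro a b c hab hbc
    obtain ⟨t, ht, ψ, hψ⟩ := infSphere_exists_path a b c
    obtain ⟨L, hL⟩ := CStarTensor.exists_slice (A := A) ψ 3 0
    have h := congrArg L hT
    simp only [map_sum, hL, map_mul, hψ, smul_mul_smul_comm, Matrix.smul_apply,
      pathMatrix_mul_mul_apply hab hbc, map_zero] at h
    rw [Finset.sum_eq_single a, Finset.sum_eq_single b, Finset.sum_eq_single c] at h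
    · simpa [ht] using h
    · intro c' _ h; simp [h]
    · simp
    · intro b' _ h; simp [h]
    · simp
    · intro a' _ h; simp [h]
    · simp
  have hreal : ∀ y : Fin N → ℝ,
      triForm T (fun a => (y a : ℂ)) (fun a => (y a : ℂ)) (fun a => (y a : ℂ)) = 0 := by
    refine triForm_zero_of_real fun y hy => ?_
    obtain ⟨φ, hφ⟩ := (realSphere_incl_halfSphere N).trans (halfSphere_incl_infSphere N)
    obtain ⟨ψ, hψ⟩ := realSphere_exists_character hy
    obtain ⟨L, hL⟩ := CStarTensor.exists_slice_character (A := A) (ψ.comp φ)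
    have h := congrArg L hT
    simp only [map_sum, hL, map_mul, StarAlgHom.comp_apply, hφ, hψ, map_zero] at h
    simpa [triForm] using h
  have e : ∀ (s : ℝ) (a b : Fin N),
      (fun i => ((Pi.single a (1 : ℝ) + s • Pi.single b 1 : Fin N → ℝ) i : ℂ)) =
        Pi.single a 1 + (s : ℂ) • Pi.single b 1 := fun s a b => by
    ext i
    by_cases h : i = a <;> by_cases h' : i = b <;> simp [h, h', Pi.single_apply] <;>
      split_ifs <;> simp
  have hd : ∀ a, T a a a = 0 := fun a => by
    have h := hreal (Pi.single a 1 + (0 : ℝ) • Pi.single a 1)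
    rw [e] at h
    simpa [triForm_single] using h
  refine ⟨hred, fun a b hab => ?_, hd⟩
  have h1 := hreal (Pi.single a 1 + (1 : ℝ) • Pi.single b 1)
  have h2 := hreal (Pi.single a 1 + (-1 : ℝ) • Pi.single b 1)
  rw [e] at h1 h2
  rw [Complex.ofReal_one, one_smul] at h1
  rw [Complex.ofReal_neg, Complex.ofReal_one] at h2
  -- The part linear in e_b has the coefficients of baa, aba and aab; the word aba is reduced, so
  -- its coefficient is already known to vanish.
  have h3 := triForm_linear_terms h1 h2 (by rw [triForm_single, hd])
  simp only [triForm_single] at h3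
  rw [hred a b a hab hab.symm, add_zero, add_comm] at h3
  exact h3

theorem ActsAffinely.isPairPositioner_of_infSphere [NeZero N] (hN : N ≠ 2)
    (hH : IsOrthogonalQuantumGroup H) (hA : ActsAffinely H (infSphere N)) :
    IsPairPositioner H.coord := by
  obtain ⟨Φ, hΦ⟩ := hA
  obtain ⟨S, hS⟩ := hH.antipode
  have hΦ' : ∀ i, Φ ((infSphere N).coord i) = coact H.coord (infSphere N).coord i := hΦ
  have hr : ∀ i k, IsCubicDefect (rowDefect H.coord i k) := by
    intro i k
    refine isCubicDefect_of_sum_tmul ?_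
    have h := congrArg Φ (infSphere_central i k)
    rw [← mul_assoc, map_mul, map_mul, map_mul, map_mul, hΦ', hΦ', coact_mul_mul, coact_mul_mul,
      ← sub_eq_zero] at h
    rw [← h]
    simp only [← Finset.sum_sub_distrib]
    refine Finset.sum_congr rfl fun a _ => Finset.sum_congr rfl fun b _ =>
      Finset.sum_congr rfl fun c _ => ?_
    rw [eq_sub_iff_add_eq, ← CStarTensor.add_tmul, rowDefect, sub_add_cancel]
  -- The antipode turns row defects into column defects, up to a sign and the exchange of the outer
  -- indices; both are harmless for the three properties to be transferred.
  have hSr : ∀ a c i j k, MulOpposite.unop (S (rowDefect H.coord a c i j k)) =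
      -colDefect H.coord a c k j i := by
    intro a c i j k
    simp only [rowDefect, colDefect, map_sub, map_mul, hS, MulOpposite.unop_sub,
      MulOpposite.unop_mul, MulOpposite.unop_op, mul_assoc, neg_sub]
  refine .of_isCubicDefect hN hH.isOrthogonalMatrix hr fun a c => ⟨fun i j k hij hjk => ?_,
    fun i j hij => ?_, fun i => ?_⟩
  · have := hSr a c k j i
    rw [(hr a c).reduced k j i hjk.symm hij.symm] at this
    simpa using this
  · have h1 := hSr a c j i i
    have h2 := hSr a c i i j
    have h3 := congrArg (fun t => MulOpposite.unop (S t)) ((hr a c).antisymm i j hij)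
    simp only [map_add, MulOpposite.unop_add, h1, h2, map_zero, MulOpposite.unop_zero] at h3
    rw [← neg_add, neg_eq_zero, add_comm] at h3
    exact h3
  · have := hSr a c i i i
    rw [(hr a c).diag i] at this
    simpa using this

theorem isQuantumIsometryGroup_infSphere [NeZero N] (hN : N ≠ 2) :
    IsQuantumIsometryGroup (hyperoctahedralInf N) (infSphere N) where
  nondegenerate := ((realSphere_incl_halfSphere N).trans
    (halfSphere_incl_infSphere N)).linearIndependent linearIndependent_realSphere
  quantumGroup := isOrthogonalQuantumGroup_hyperoctahedralInf
  acts := actsAffinely_hyperoctahedralInf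
  maximal _ hH hA := exists_hom_hyperoctahedralInf (hA.isPairPositioner_of_infSphere hN hH)

end maximal

/-! ### Non-inclusions -/

section noninclusion

variable {N : ℕ}

/-- A reflection matrix with nonzero entries at the positions `(i, i)` and `(i, j)`. -/
theorem exists_orthogonal_mul_ne_zero {i j : Fin N} (hij : i ≠ j) :
    ∃ U : Matrix.orthogonalGroup (Fin N) ℝ,
      (U : Matrix (Fin N) (Fin N) ℝ) i i * (U : Matrix (Fin N) (Fin N) ℝ) i j ≠ 0 := by
  -- The reflection in the hyperplane orthogonal to v = e_i + 2e_j, with factor 2/⟨v,v⟩ = 2/5. Its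
  -- entries at (i, i) and (i, j) are 3/5 and -4/5.
  let v : Fin N → ℝ := Pi.single i 1 + Pi.single j 2
  let M : Matrix (Fin N) (Fin N) ℝ := 1 - (2 / 5 : ℝ) • Matrix.vecMulVec v v
  have hv : v ⬝ᵥ v = 5 := by
    simp [v, hij, hij.symm]
    norm_num
  have hT : M.transpose = M := by
    ext a b
    simp [M, Matrix.transpose_apply, Matrix.one_apply, Matrix.vecMulVec_apply, mul_comm, eq_comm]
  have hM : M * M = 1 := by
    have : Matrix.vecMulVec v v * Matrix.vecMulVec v v = (5 : ℝ) • Matrix.vecMulVec v v := by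
      rw [Matrix.vecMulVec_mul_vecMulVec, hv]
      ext a b
      simp [Matrix.vecMulVec_apply]
      ring
    simp only [M, sub_mul, mul_sub, one_mul, mul_one, smul_mul_assoc, mul_smul_comm, this]
    module
  refine ⟨⟨M, (Matrix.mem_orthogonalGroup_iff _ _).2 (by
    change M * M.transpose = 1
    rw [hT, hM])⟩, ?_⟩
  have h1 : M i i = 3 / 5 := by
    simp [M, v, Matrix.vecMulVec_apply, hij]
    norm_num
  have h2 : M i j = -4 / 5 := by
    simp [M, v, Matrix.vecMulVec_apply, hij, hij.symm]
    norm_num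
  change M i i * M i j ≠ 0
  rw [h1, h2]
  norm_num

/-- An inclusion would restrict to the classical group O_N, which contains matrices with two nonzero
entries on a row. -/
theorem not_halfOrthogonalGroup_incl (hN : 2 ≤ N) :
    ¬ (halfOrthogonalGroup N).Incl (hyperoctahedralInf N) := by
  intro h
  obtain ⟨φ, hφ⟩ := (orthogonalGroupSpace_incl_halfOrthogonalGroup N).trans h
  let i : Fin N := ⟨0, by omega⟩
  let j : Fin N := ⟨1, by omega⟩
  have hij : i ≠ j := by simp [i, j]
  obtain ⟨U, hU⟩ := exists_orthogonal_mul_ne_zero hij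
  have h1 := congrArg φ ((isPairPositioner_hyperoctahedralInf (N := N)).row_mul i i j hij)
  rw [map_mul, hφ, hφ, map_zero] at h1
  have h2 : ((U : Matrix (Fin N) (Fin N) ℝ) i i : ℂ) *
      ((U : Matrix (Fin N) (Fin N) ℝ) i j : ℂ) = 0 :=
    congrArg (fun f : C(Matrix.orthogonalGroup (Fin N) ℝ, ℂ) => f U) h1
  exact hU (by exact_mod_cast h2)

/-- Arbitrary self-adjoint involutions are allowed on the diagonal: this is the dual of ℤ₂^{*N}
inside H_N^{[∞]}. -/
theorem isPairPositioner_diagonal {B : Type*} [Ring B] [StarRing B] {v : Fin N → B}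
    (hs : ∀ i, star (v i) = v i) (hv : ∀ i, v i * v i = 1) :
    IsPairPositioner fun p : Fin N × Fin N => if p.1 = p.2 then v p.1 else 0 where
  star_eq p := by split_ifs <;> simp [hs]
  row i j := by
    rw [Finset.sum_eq_single i]
    · by_cases h : i = j
      · simp [h, hv]
      · simp [h, Ne.symm h]
    · intro k _ hk; simp [hk.symm]
    · simp
  col i j := by
    rw [Finset.sum_eq_single i]
    · by_cases h : i = j
      · simp [h, hv]
      · simp [h]
    · intro k _ hk; simp [hk]
    · simp
  row_mul i a b hab := by
    by_cases h : i = a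
    · subst h; simp [hab]
    · simp [h]
  col_mul i j a hij := by
    by_cases h : i = a
    · subst h; simp [Ne.symm hij]
    · simp [h]
  central p q := by split_ifs <;> simp [hv]

/-- For three distinct letters the word abc of path involutions takes vertex 0 to 3 and cba does
not, so half-commutation fails in the diagonal model. -/
theorem not_hyperoctahedralInf_incl (hN : 3 ≤ N) :
    ¬ (hyperoctahedralInf N).Incl (halfOrthogonalGroup N) := by
  rintro ⟨φ, hφ⟩
  have : NeZero N := ⟨by omega⟩
  let a : Fin N := ⟨0, by omega⟩
  let b : Fin N := ⟨1, by omega⟩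
  let c : Fin N := ⟨2, by omega⟩
  have hab : a ≠ b := by simp [a, b]
  have hbc : b ≠ c := by simp [b, c]
  have hca : c ≠ a := by simp [a, c]
  obtain ⟨ψ, hψ⟩ := hyperoctahedralInf_exists_matrix
    (isPairPositioner_diagonal (star_pathMatrix a b c) (pathMatrix_mul_self a b c))
  have h := congrArg (fun t => ψ (φ t)) (halfOrthogonalGroup_mul_mul (a, a) (b, b) (c, c))
  simp only [map_mul, hφ, hψ, if_true] at h
  have h' := congrFun (congrFun h 3) 0
  rw [pathMatrix_mul_mul_apply hab hbc, pathMatrix_mul_mul_apply hab hbc] at h'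
  simp [hca] at h'

end noninclusion

end

-- The proposition

theorem proposition5p2 (N : ℕ) (hN : 1 ≤ N) :
    ((groupSphere N (Z2Pow.gen N)).Same (realSphere N) ∧
      (groupSphere N (Z2Half.gen N)).Same (halfSphere N) ∧
      (groupSphere N (Z2Free.gen N)).Same (infSphere N)) ∧
    ((realSphere N).Incl (halfSphere N) ∧ (halfSphere N).Incl (infSphere N)) ∧
    (IsQuantumIsometryGroup (orthogonalGroupSpace N) (realSphere N) ∧
      IsQuantumIsometryGroup (halfOrthogonalGroup N) (halfSphere N) ∧
      (N ≠ 2 → IsQuantumIsometryGroup (hyperoctahedralInf N) (infSphere N))) ∧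
    (orthogonalGroupSpace N).Incl (halfOrthogonalGroup N) ∧
    (2 ≤ N → ¬ (halfOrthogonalGroup N).Incl (hyperoctahedralInf N)) ∧
    (3 ≤ N → ¬ (hyperoctahedralInf N).Incl (halfOrthogonalGroup N)) := by
  have : NeZero N := ⟨by omega⟩
  exact ⟨⟨groupSphere_pow_same N, groupSphere_half_same N, groupSphere_free_same N⟩,
    ⟨realSphere_incl_halfSphere N, halfSphere_incl_infSphere N⟩,
    ⟨isQuantumIsometryGroup_realSphere, isQuantumIsometryGroup_halfSphere,
      isQuantumIsometryGroup_infSphere⟩,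
    orthogonalGroupSpace_incl_halfOrthogonalGroup N, not_halfOrthogonalGroup_incl,
    not_hyperoctahedralInf_incl⟩
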